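/- Let $p$ be a prime and $K$ a finite extension of $\mathbb Q_p$ with the norm extending that of $\mathbb Q_p$; $K^m$ carries the maximum norm. **Smoothness classes.** For a clopen $\Omega\subseteq K^m$ and $f:\Omega\to K^r$ put $$\Phi^v f(x;h_1,\dots,h_v;\zeta_1,\dots,\zeta_v)=\frac{1}{\zeta_1\cdots\zeta_v}\sum_{S\subseteq\{1,\dots,v\}}(-1)^{v-|S|}f\Big(x+\sum_{i\in S}\zeta_ih_i\Big),$$ where $\zeta_i\in K\setminus\{0\}$, $h_i\in K^m$ and all points $x+\sum_{i\in S}\zeta_ih_i$ lie in $\Omega$. The function $f$ is of class $C^l$ if for all $v\le l$ the function $\Phi^vf$ extends continuously to all such $(x;h;\zeta)$ with arbitrary $\zeta_i\in K$. It is of class $C^{(t,s)}$ if the same holds for the partial difference quotients in which $h_1,\dots,h_v$ are coordinate vectors, the $j$-th of them occurring $s_j$ times, whenever $\sum_j\max(s_j-s,0)\le t$. **Antiderivation.** Fix a partition of $K$ into compact clopen sets $U$ (for example the balls of a given radius) and, on each $U$, an approximation of the identity: maps $\sigma_k:U\to U$ ($k\ge 0$) such that $\sigma_0$ is constant, $\sigma_k\circ\sigma_i=\sigma_i\circ\sigma_k=\sigma_i$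 for $k\ge i$, and for some $0<\rho<1$ one has $\sigma_k(x)=\sigma_k(y)$ whenever $|x-y|<\rho^k$, and $|\sigma_k(x)-x|<\rho^k$ for $k\ge1$. For $n\ge1$ put $$P^n_{x_j}h(x)=\sum_{k\ge0}\sum_{i=0}^{n-1}\frac{\partial^ih}{\partial x_j^i}(x_1,\dots,\sigma_k(x_j),\dots,x_m)\,\frac{(\sigma_{k+1}(x_j)-\sigma_k(x_j))^{i+1}}{(i+1)!}.$$ For $q\ge0$, $n\ge1$, a map $f$ on a clopen $\Omega\subseteq K^m$ is of class ${}_SC^{(q+1,n-1)}$ if it is of class $C^{(q+1,n-1)}$ and for each $j$ there are $h$ of class $C^{(q,n-1)}$ on $\Omega$ and a function $g$, not depending on $x_j$ as long as $x_j$ stays in one set $U$ of the partition, with $f=P^n_{x_j}(h\chi_\Omega)+g$ on $\Omega$. **Manifolds.** An ${}_SC^{(q+1,n-1)}$-manifold $M$ of dimension $m=m_M$ is a topological space with an atlas of homeomorphisms $\phi_i:V_i\to\phi_i(V_i)$ from clopen sets $V_i$ covering $M$ onto clopen subsets of $K^{m}$ such that $\phi_i\circ\phi_j^{-1}$ is of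 class ${}_SC^{(q+1,n-1)}$ on $\phi_j(V_i\cap V_j)$ for all $i\neq j$. A map $f:M\to N$ between such manifolds is a $C^l$-mapping if it is continuous and of class $C^l$ in all charts of the given atlases. For a $C^l$-mapping $f$ with $l\geq 1$ let $\mathcal E=\{z\in M:\ \operatorname{rank}(d_zf)<m_N\}$. Let $\nu$ be the Haar measure on $K^{m_N}$ with $\nu(B(0,1))=1$, where $B(0,1)$ is the closed unit ball. A disjoint refinement of the atlas of $N$ (a partition of $N$ into clopen sets $W_i$, each contained in the domain of a chart $\psi_i$) induces the Borel measure $\mu$ on $N$ with $\mu(S)=\sum_i\nu(\psi_i(S\cap W_i))$; a set is called $\mu$-null if it is contained in a Borel set of $\mu$-measure $0$. **Theorem.** Let $q\ge0$, $n\ge1$, let $M$ and $N$ be ${}_SC^{(q+1,n-1)}$-manifolds over $K$, $M$ second countable, and let $f:M\to N$ be a $C^l$-mapping with $l>\max(m_M,m_N)$. Then: 1. $\mu(f(\mathcal E))=0$ for every measure $\mu$ on $N$ induced as above by a disjoint refinement of its atlas; 2. $N\setminus f(\mathcal E)$ is dense in $N$; 3. if $m_M<m_N$, then $\mu(f(M))=0$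 for every such $\mu$. -/

import Mathlib

open MeasureTheory Set
open scoped Manifold

noncomputable section

namespace NASard

section DifferenceQuotients

variable {K : Type*} [NontriviallyNormedField K] {m : ℕ}
  {Y : Type*} [NormedAddCommGroup Y] [NormedSpace K Y]

/-- The point `x + ∑_{i ∈ S} ζ_i h_i` of `K^m`. -/
def vertex {v : ℕ} (x : Fin m → K) (h : Fin v → Fin m → K) (ζ : Fin v → K)
    (S : Finset (Fin v)) : Fin m → K :=
  x + ∑ i ∈ S, ζ i • h i

/-- The domain of the `v`-th difference quotient of a function on `Ω ⊆ K^m`, with directions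
`(h_1, …, h_v)` restricted to the set `H`: all `(x; h_1, …, h_v; ζ_1, …, ζ_v)` for which every
point `x + ∑_{i ∈ S} ζ_i h_i` lies in `Ω`. -/
def quotDomain {v : ℕ} (H : Set (Fin v → Fin m → K)) (Ω : Set (Fin m → K)) :
    Set ((Fin m → K) × (Fin v → Fin m → K) × (Fin v → K)) :=
  {w | w.2.1 ∈ H ∧ ∀ S : Finset (Fin v), vertex w.1 w.2.1 w.2.2 S ∈ Ω}

/-- The iterated difference quotient
`Φ^v f (x; h_1, …, h_v; ζ_1, …, ζ_v)`, where `Φ^0 f = f` and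
`Φ^{v+1} f (x; h_1, …, h_{v+1}; ζ_1, …, ζ_{v+1}) =
  (Φ^v f (x + ζ_{v+1} h_{v+1}; …) - Φ^v f (x; …)) / ζ_{v+1}`,
written out as an alternating sum. It is meaningful if all `ζ_i` are nonzero. -/
def diffQuot {v : ℕ} (f : (Fin m → K) → Y) (x : Fin m → K) (h : Fin v → Fin m → K)
    (ζ : Fin v → K) : Y :=
  (∏ i, ζ i)⁻¹ • ∑ S : Finset (Fin v), (-1 : K) ^ (v - S.card) • f (vertex x h ζ S)

/-- The `v`-th difference quotient of `f` on `Ω` with directions in `H` extends continuously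
to the points where some of the `ζ_i` vanish. -/
def HasContDiffQuot {v : ℕ} (H : Set (Fin v → Fin m → K)) (Ω : Set (Fin m → K))
    (f : (Fin m → K) → Y) : Prop :=
  ∃ Φ : (Fin m → K) × (Fin v → Fin m → K) × (Fin v → K) → Y,
    ContinuousOn Φ (quotDomain H Ω) ∧
    ∀ x h ζ, (x, h, ζ) ∈ quotDomain H Ω → (∀ i, ζ i ≠ 0) → Φ (x, h, ζ) = diffQuot f x h ζ

/-- `f` is of class `C^l` on `Ω` in the sense of difference quotients. -/
def IsC (l : ℕ) (Ω : Set (Fin m → K)) (f : (Fin m → K) → Y) : Prop :=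
  ∀ v ≤ l, HasContDiffQuot (v := v) univ Ω f

/-- `f` is of class `C^{(t,s)}` on `Ω`: the partial difference quotients, of order `s_j` in the
`j`-th coordinate, have continuous extensions whenever the orders `s_j` exceed `s` by at most `t`
in total, `∑_j max (s_j - s, 0) ≤ t`. The directions are the coordinate vectors `e_{c 1}, …, e_{c v}`,
and `s_j` is the number of times that `j` occurs among the `c i`. -/
def IsCPair (t s : ℕ) (Ω : Set (Fin m → K)) (f : (Fin m → K) → Y) : Prop :=
  ∀ (v : ℕ) (c : Fin v → Fin m),
    ∑ j, ((Finset.univ.filter fun i => c i = j).card - s) ≤ t →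
      HasContDiffQuot {fun i => Pi.single (c i) 1} Ω f

end DifferenceQuotients

section Antiderivation

variable {K : Type*} [NontriviallyNormedField K]

/-- `σ` is an approximation of the identity on `U ⊆ K`. (The bound on `‖σ_k x - x‖` is asked for
`k ≥ 1` only: for `k = 0` it would exclude the sets `U` of diameter at least one, such as the
unit ball.) -/
structure IsApproxId (σ : ℕ → K → K) (U : Set K) : Prop where
  mapsTo : ∀ k, MapsTo (σ k) U U
  const_zero : ∀ x ∈ U, ∀ y ∈ U, σ 0 x = σ 0 y
  comp_left : ∀ k i, i ≤ k → ∀ x ∈ U, σ k (σ i x) = σ i x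
  comp_right : ∀ k i, i ≤ k → ∀ x ∈ U, σ i (σ k x) = σ i x
  exists_rate : ∃ ρ : ℝ, 0 < ρ ∧ ρ < 1 ∧
    (∀ k, ∀ x ∈ U, ∀ y ∈ U, ‖x - y‖ < ρ ^ k → σ k x = σ k y) ∧
    (∀ k, 1 ≤ k → ∀ x ∈ U, ‖σ k x - x‖ < ρ ^ k)

variable (K) in
/-- A decomposition of `K` into disjoint compact clopen sets (for instance, the balls of a given
radius) with an approximation of the identity on each of them; `σ k` is defined on `K` piecewise. -/
structure ApproxSystem where
  pieces : Set (Set K)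
  isPartition : Setoid.IsPartition pieces
  isClopen : ∀ U ∈ pieces, IsClopen U
  isCompact : ∀ U ∈ pieces, IsCompact U
  σ : ℕ → K → K
  approx : ∀ U ∈ pieces, IsApproxId σ U

variable {m : ℕ} {Y : Type*} [NormedAddCommGroup Y] [NormedSpace K Y]

/-- The antiderivation `P^n_{x_j}` in the `j`-th coordinate: with `x_{j,k} = σ_k (x_j)`,
`P^n_{x_j} f (x) = ∑_{k ≥ 0} ∑_{i < n}
  (∂^i f / ∂ x_j^i)(…, x_{j,k}, …) (x_{j,k+1} - x_{j,k})^{i+1} / (i+1)!`. -/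
def antideriv (A : ApproxSystem K) (n : ℕ) (j : Fin m) (f : (Fin m → K) → Y)
    (x : Fin m → K) : Y :=
  ∑' k : ℕ, ∑ i ∈ Finset.range n,
    ((A.σ (k + 1) (x j) - A.σ k (x j)) ^ (i + 1) / ((i + 1).factorial : K)) •
      iteratedDeriv i (fun t : K => f (Function.update x j t)) (A.σ k (x j))

/-- `f` is of class `_S C^{(q+1,n-1)}` on the clopen set `Ω ⊆ K^m`: it is of class `C^{(q+1,n-1)}`
and, for each coordinate `x_j`, it is `P^n_{x_j} h` for some `h` of class `C^{(q,n-1)}` on `Ω`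
(extended by zero), up to a summand which does not depend on `x_j` as long as `x_j` stays in one
and the same piece of `K`. -/
def IsSC (A : ApproxSystem K) (q n : ℕ) (Ω : Set (Fin m → K)) (f : (Fin m → K) → Y) : Prop :=
  IsCPair (q + 1) (n - 1) Ω f ∧
  ∀ j : Fin m, ∃ h g : (Fin m → K) → Y,
    IsCPair q (n - 1) Ω h ∧
    (∀ x, ∀ U ∈ A.pieces, x j ∈ U → ∀ t ∈ U, g (Function.update x j t) = g x) ∧
    ∀ x ∈ Ω, f x = antideriv A n j (Ω.indicator h) x + g x

end Antiderivation

section Manifolds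

variable {K : Type*} [NontriviallyNormedField K]

/-- `M`, with its given atlas, is an `_S C^{(q+1,n-1)}`-manifold of dimension `m` over `K`. -/
structure IsSCManifold (A : ApproxSystem K) (q n m : ℕ) (M : Type*) [TopologicalSpace M]
    [ChartedSpace (Fin m → K) M] : Prop where
  isClopen_source : ∀ e ∈ atlas (Fin m → K) M, IsClopen e.source
  isClopen_target : ∀ e ∈ atlas (Fin m → K) M, IsClopen e.target
  transition : ∀ e ∈ atlas (Fin m → K) M, ∀ e' ∈ atlas (Fin m → K) M, e ≠ e' →
    IsSC A q n (e.target ∩ e.symm ⁻¹' e'.source) (e' ∘ e.symm)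

variable {a b : ℕ} {M : Type*} [TopologicalSpace M] [ChartedSpace (Fin a → K) M]
  {N : Type*} [TopologicalSpace N] [ChartedSpace (Fin b → K) N]

variable (K a b) in
/-- `f : M → N` is a `C^l`-mapping: it is continuous and of class `C^l` in the charts of the
given atlases. -/
structure IsCMap (l : ℕ) (f : M → N) : Prop where
  continuous : Continuous f
  isC : ∀ e ∈ atlas (Fin a → K) M, ∀ e' ∈ atlas (Fin b → K) N,
    IsC l (e.target ∩ e.symm ⁻¹' (f ⁻¹' e'.source)) (e' ∘ f ∘ e.symm)

variable (K a b) in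
/-- The differential `d_z f`, with the tangent spaces identified with `K^a` and `K^b` by means of
the charts at `z` and at `f z`. -/
def differential (f : M → N) (z : M) : (Fin a → K) →L[K] (Fin b → K) :=
  mfderiv 𝓘(K, Fin a → K) 𝓘(K, Fin b → K) f z

variable (K a b) in
/-- The set of all `z ∈ M` such that the rank of `d_z f` is less than `b = dim N`. -/
def criticalSet (f : M → N) : Set M :=
  {z | Module.finrank K (LinearMap.range (differential K a b f z).toLinearMap) < b}

variable (K b N) in
/-- A disjoint refinement of the atlas of `N`: a partition of `N` into clopen sets `cell i`,
each of them contained in the domain of a chart `chart i` of the atlas. -/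
structure DisjointRefinement (ι : Type*) where
  chart : ι → OpenPartialHomeomorph N (Fin b → K)
  cell : ι → Set N
  chart_mem : ∀ i, chart i ∈ atlas (Fin b → K) N
  isClopen_cell : ∀ i, IsClopen (cell i)
  cell_subset : ∀ i, cell i ⊆ (chart i).source
  disjoint : Pairwise (Function.onFun Disjoint cell)
  iUnion_cell : ⋃ i, cell i = univ

end Manifolds

section InducedMeasure

variable (p : ℕ) [Fact p.Prime] (K : Type*) [NontriviallyNormedField K] [NormedAlgebra ℚ_[p] K]
  [FiniteDimensional ℚ_[p] K] [MeasurableSpace K] [BorelSpace K]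

/-- The closed unit ball of `K^b` (for the maximum norm). -/
def unitBall (b : ℕ) : TopologicalSpace.PositiveCompacts (Fin b → K) where
  carrier := Metric.closedBall 0 1
  isCompact' := by
    have : ProperSpace K := FiniteDimensional.proper ℚ_[p] K
    exact isCompact_closedBall 0 1
  interior_nonempty' :=
    ⟨0, Metric.ball_subset_interior_closedBall (Metric.mem_ball_self one_pos)⟩

/-- The Haar measure on `K^b` which gives measure one to the closed unit ball. -/
def haar (b : ℕ) : Measure (Fin b → K) :=
  haveI : ProperSpace K := FiniteDimensional.proper ℚ_[p] K
  Measure.addHaarMeasure (unitBall p K b)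

variable {K} {b : ℕ} {N : Type*} [TopologicalSpace N] [ChartedSpace (Fin b → K) N]
  [MeasurableSpace N]

/-- The measure on `N` induced by the Haar measure on `K^b` with the help of the charts of a
disjoint refinement `D` of the atlas: on each cell it is the Haar measure carried over by the
chart. -/
def inducedMeasure {ι : Type*} (D : DisjointRefinement K b N ι) : Measure N :=
  Measure.sum fun i =>
    ((haar p K b).restrict (D.chart i '' D.cell i)).map (D.chart i).symm

end InducedMeasure

end NASard

end

/-! The proof runs the classical induction on the number of variables, but on Whitney fields instead
of functions. Such a field consists of base points `u t` in K^n and polynomials `P t`, with t in a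
compact space, such that `P t z` and `P s z` differ by O((‖z - u t‖ + ‖z - u s‖)^l). Restricting a
field to a compact set of parameters gives a field again, so neither an extension theorem nor an
implicit function theorem for the class C^l is needed.

`sardAt` shows that the critical values of a field of order l in n variables form a null set if n <
l. The base points are stratified by the number of orders of derivatives that vanish. Where all
derivatives of orders 1, …, l - 1 vanish, the values are Hölder of exponent l in the base point, and
`measure_range_eq_zero_of_holder` applies, since n < l ≤ l b. Elsewhere some first derivative of a
function g does not vanish, where g is `F j` minus a constant, or a derivative of order k of `F j`
which is zero on the stratum. The equation g = 0 then eliminates one variable. Now g has only the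
order l - k, and so has the solution R of the equation; but on this stratum the `F j` are flat to
the order k, so that substituting R still gives fields of the full order l
(`IsWhitney.comp_implicit`). Thus l stays fixed while n drops. If g is `F j` minus a constant,
Fubini's theorem in the j-th coordinate of the target comes first.

The fields come from Taylor's formula (`IsC.exists_whitney`). As there is no mean value theorem over
K, a bound on differences of order l is carried down to lower orders by comparing the steps ζ and
pζ: iterating ζ ↦ pζ gives a convergent geometric series because ‖p‖ < 1 (`DiffBound.pred`).

Transition maps are differentiable, hence ranks may be bounded in any charts. Second countability of
M leaves countably many null sets to unite, and a null set contains no nonempty open set. -/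

noncomputable section

namespace NASard

/-! ### Uniformly bounded families of polynomials. -/

section PolyFamily

variable {K : Type*} [NontriviallyNormedField K] {T S : Type*} {n m : ℕ}

/-- Families `P t`, `t : T`, of polynomial functions on `K^n` whose degrees and coefficients are
bounded uniformly in `t`. -/
inductive PolyFamily : (T → (Fin n → K) → K) → Prop
  | param (θ : T → K) (C : ℝ) (h : ∀ t, ‖θ t‖ ≤ C) : PolyFamily fun t _ => θ t
  | coord (i : Fin n) : PolyFamily fun _ z => z i
  | add {P Q : T → (Fin n → K) → K} (hP : PolyFamily P) (hQ : PolyFamily Q) :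
      PolyFamily fun t z => P t z + Q t z
  | mul {P Q : T → (Fin n → K) → K} (hP : PolyFamily P) (hQ : PolyFamily Q) :
      PolyFamily fun t z => P t z * Q t z

namespace PolyFamily

variable {P Q : T → (Fin n → K) → K}

theorem const (c : K) : PolyFamily fun (_ : T) (_ : Fin n → K) => c :=
  param _ ‖c‖ fun _ => le_rfl

theorem neg (hP : PolyFamily P) : PolyFamily fun t z => -P t z := by
  simpa using (const (-1)).mul hP

theorem sub (hP : PolyFamily P) (hQ : PolyFamily Q) : PolyFamily fun t z => P t z - Q t z := by
  simpa [sub_eq_add_neg] using hP.add hQ.neg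

theorem sum {ι : Type*} (s : Finset ι) {P : ι → T → (Fin n → K) → K}
    (hP : ∀ i ∈ s, PolyFamily (P i)) : PolyFamily fun t z => ∑ i ∈ s, P i t z := by
  classical
  induction s using Finset.induction_on with
  | empty => simpa using const 0
  | insert i s hi ih =>
    simp only [Finset.sum_insert hi]
    exact (hP i (by simp)).add (ih fun j hj => hP j (by simp [hj]))

theorem prod {ι : Type*} (s : Finset ι) {P : ι → T → (Fin n → K) → K}
    (hP : ∀ i ∈ s, PolyFamily (P i)) : PolyFamily fun t z => ∏ i ∈ s, P i t z := by
  classical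
  induction s using Finset.induction_on with
  | empty => simpa using const 1
  | insert i s hi ih =>
    simp only [Finset.prod_insert hi]
    exact (hP i (by simp)).mul (ih fun j hj => hP j (by simp [hj]))

theorem comp_index (σ : S → T) (hP : PolyFamily P) : PolyFamily fun s => P (σ s) := by
  induction hP with
  | param θ C h => exact param _ C fun s => h (σ s)
  | coord i => exact coord i
  | add _ _ h₁ h₂ => exact h₁.add h₂
  | mul _ _ h₁ h₂ => exact h₁.mul h₂

theorem subst (hP : PolyFamily P) {G : Fin n → T → (Fin m → K) → K}
    (hG : ∀ i, PolyFamily (G i)) : PolyFamily fun t y => P t fun i => G i t y := by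
  induction hP with
  | param θ C h => exact param _ C h
  | coord i => exact hG i
  | add _ _ h₁ h₂ => exact h₁.add h₂
  | mul _ _ h₁ h₂ => exact h₁.mul h₂

theorem bounded (hP : PolyFamily P) (R : ℝ) :
    ∃ C, 0 ≤ C ∧ ∀ t z, ‖z‖ ≤ R → ‖P t z‖ ≤ C := by
  induction hP with
  | param θ C h => exact ⟨max C 0, le_max_right _ _, fun t _ _ => (h t).trans (le_max_left _ _)⟩
  | coord i => exact ⟨max R 0, le_max_right _ _, fun _ z hz =>
      (norm_le_pi_norm z i).trans (hz.trans (le_max_left _ _))⟩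
  | add _ _ h₁ h₂ =>
    obtain ⟨C₁, h₁₀, h₁⟩ := h₁
    obtain ⟨C₂, h₂₀, h₂⟩ := h₂
    exact ⟨C₁ + C₂, by positivity, fun t z hz => norm_add_le_of_le (h₁ t z hz) (h₂ t z hz)⟩
  | mul _ _ h₁ h₂ =>
    obtain ⟨C₁, h₁₀, h₁⟩ := h₁
    obtain ⟨C₂, h₂₀, h₂⟩ := h₂
    exact ⟨C₁ * C₂, by positivity, fun t z hz => norm_mul_le_of_le (h₁ t z hz) (h₂ t z hz)⟩

theorem lipschitz (hP : PolyFamily P) (R : ℝ) :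
    ∃ C, 0 ≤ C ∧ ∀ t z w, ‖z‖ ≤ R → ‖w‖ ≤ R → ‖P t z - P t w‖ ≤ C * ‖z - w‖ := by
  induction hP with
  | param θ C h => exact ⟨0, le_rfl, by simp⟩
  | coord i => exact ⟨1, zero_le_one, fun _ z w _ _ => by simpa using norm_le_pi_norm (z - w) i⟩
  | @add P Q _ _ h₁ h₂ =>
    obtain ⟨C₁, h₁₀, h₁⟩ := h₁
    obtain ⟨C₂, h₂₀, h₂⟩ := h₂
    refine ⟨C₁ + C₂, by positivity, fun t z w hz hw => ?_⟩
    rw [add_sub_add_comm, add_mul]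
    exact norm_add_le_of_le (h₁ t z w hz hw) (h₂ t z w hz hw)
  | @mul P Q hP hQ h₁ h₂ =>
    obtain ⟨C₁, h₁₀, h₁⟩ := h₁
    obtain ⟨C₂, h₂₀, h₂⟩ := h₂
    obtain ⟨B₁, hB₁, hP⟩ := hP.bounded R
    obtain ⟨B₂, hB₂, hQ⟩ := hQ.bounded R
    refine ⟨C₁ * B₂ + B₁ * C₂, by positivity, fun t z w hz hw => ?_⟩
    calc ‖P t z * Q t z - P t w * Q t w‖
        = ‖(P t z - P t w) * Q t z + P t w * (Q t z - Q t w)‖ := by ring_nf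
      _ ≤ C₁ * ‖z - w‖ * B₂ + B₁ * (C₂ * ‖z - w‖) :=
          norm_add_le_of_le (norm_mul_le_of_le (h₁ t z w hz hw) (hQ t z hz))
            (norm_mul_le_of_le (hP t w hw) (h₂ t z w hz hw))
      _ = _ := by ring

/-- On lines parallel to an axis the inequalities for polynomials in one variable become available,
with constants that depend only on the common degree bound. -/
theorem exists_polynomial (hP : PolyFamily P) :
    ∃ D : ℕ, ∀ t z i, ∃ q : Polynomial K, q.natDegree ≤ D ∧
      ∀ τ, P t (Function.update z i τ) = q.eval τ := by
  induction hP with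
  | param θ C h => exact ⟨0, fun t z i => ⟨.C (θ t), by simp, by simp⟩⟩
  | coord j =>
    refine ⟨1, fun t z i => ?_⟩
    by_cases hij : j = i
    · subst hij
      exact ⟨.X, by simp, by simp⟩
    · exact ⟨.C (z j), by simp, fun τ => by simp [Function.update_of_ne hij]⟩
  | add _ _ h₁ h₂ =>
    obtain ⟨D₁, h₁⟩ := h₁
    obtain ⟨D₂, h₂⟩ := h₂
    refine ⟨max D₁ D₂, fun t z i => ?_⟩
    obtain ⟨q₁, hq₁, e₁⟩ := h₁ t z i
    obtain ⟨q₂, hq₂, e₂⟩ := h₂ t z i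
    exact ⟨q₁ + q₂, (Polynomial.natDegree_add_le _ _).trans (max_le_max hq₁ hq₂),
      fun τ => by simp [e₁, e₂]⟩
  | mul _ _ h₁ h₂ =>
    obtain ⟨D₁, h₁⟩ := h₁
    obtain ⟨D₂, h₂⟩ := h₂
    refine ⟨D₁ + D₂, fun t z i => ?_⟩
    obtain ⟨q₁, hq₁, e₁⟩ := h₁ t z i
    obtain ⟨q₂, hq₂, e₂⟩ := h₂ t z i
    exact ⟨q₁ * q₂, Polynomial.natDegree_mul_le.trans (add_le_add hq₁ hq₂),
      fun τ => by simp [e₁, e₂]⟩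

end PolyFamily

/-- The partial derivative in the `i`-th coordinate of a family of functions on `K^n`. -/
def pd (i : Fin n) (P : T → (Fin n → K) → K) (t : T) (z : Fin n → K) : K :=
  deriv (fun τ => P t (Function.update z i τ)) (z i)

namespace PolyFamily

variable {P Q : T → (Fin n → K) → K}

theorem hasDerivAt (hP : PolyFamily P) (i : Fin n) (t : T) (z : Fin n → K) (τ : K) :
    HasDerivAt (fun τ => P t (Function.update z i τ)) (pd i P t (Function.update z i τ)) τ := by
  obtain ⟨D, h⟩ := hP.exists_polynomial
  obtain ⟨q, -, hq⟩ := h t z i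
  simp only [pd, Function.update_idem, Function.update_self, hq]
  exact q.differentiableAt.hasDerivAt

theorem hasDerivAt_self (hP : PolyFamily P) (i : Fin n) (t : T) (z : Fin n → K) :
    HasDerivAt (fun τ => P t (Function.update z i τ)) (pd i P t z) (z i) := by
  simpa using hP.hasDerivAt i t z (z i)

theorem pd_add (hP : PolyFamily P) (hQ : PolyFamily Q) (i : Fin n) :
    pd i (fun t z => P t z + Q t z) = fun t z => pd i P t z + pd i Q t z := by
  ext t z
  exact ((hP.hasDerivAt_self i t z).add (hQ.hasDerivAt_self i t z)).deriv

theorem pd_mul (hP : PolyFamily P) (hQ : PolyFamily Q) (i : Fin n) :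
    pd i (fun t z => P t z * Q t z) = fun t z => pd i P t z * Q t z + P t z * pd i Q t z := by
  ext t z
  have h := ((hP.hasDerivAt_self i t z).mul (hQ.hasDerivAt_self i t z)).deriv
  rwa [Function.update_eq_self] at h

theorem pd_coord (i j : Fin n) :
    pd i (fun (_ : T) (z : Fin n → K) => z j) = fun _ _ => if j = i then 1 else 0 := by
  ext t z
  by_cases h : j = i
  · subst h; simp [pd]
  · simp [pd, h]

theorem pd (hP : PolyFamily P) (i : Fin n) : PolyFamily (pd i P) := by
  induction hP with
  | param θ C h =>
    have : (NASard.pd i fun t (_ : Fin n → K) => θ t) = fun _ _ => 0 := by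
      ext t z; simp [NASard.pd]
    rw [this]
    exact const 0
  | coord j =>
    rw [pd_coord]
    exact const _
  | add hP hQ h₁ h₂ => rw [hP.pd_add hQ]; exact h₁.add h₂
  | mul hP hQ h₁ h₂ => rw [hP.pd_mul hQ]; exact (h₁.mul hQ).add (hP.mul h₂)

/-- The linear part is taken at a third point z, so that the factor ‖w - w'‖ survives in the error.
This is what lets a nonvanishing partial derivative at `u t` invert increments near `u t`. -/
theorem taylor_one (hP : PolyFamily P) (R : ℝ) :
    ∃ C, 0 ≤ C ∧ ∀ t z w w', ‖z‖ ≤ R → ‖w‖ ≤ R → ‖w'‖ ≤ R →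
      ‖P t w - P t w' - ∑ i, NASard.pd i P t z * (w i - w' i)‖ ≤
        C * (‖w - z‖ + ‖w' - z‖) * ‖w - w'‖ := by
  have key : ∀ {P : T → (Fin n → K) → K}, PolyFamily P → ∃ B, 0 ≤ B ∧
      ∀ t z (w w' : Fin n → K), ‖z‖ ≤ R →
        ‖∑ i, NASard.pd i P t z * (w i - w' i)‖ ≤ B * ‖w - w'‖ := by
    intro P hP
    choose B hB hB' using fun i => (hP.pd i).bounded R
    refine ⟨∑ i, B i, Finset.sum_nonneg fun i _ => hB i, fun t z w w' hz => ?_⟩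
    rw [Finset.sum_mul]
    exact norm_sum_le_of_le _ fun i _ =>
      norm_mul_le_of_le (hB' i t z hz) (norm_le_pi_norm (w - w') i)
  induction hP with
  | param θ C h => exact ⟨0, le_rfl, by simp [NASard.pd]⟩
  | coord i => exact ⟨0, le_rfl, by simp [pd_coord]⟩
  | @add P Q hP hQ h₁ h₂ =>
    obtain ⟨C₁, h₁₀, h₁⟩ := h₁
    obtain ⟨C₂, h₂₀, h₂⟩ := h₂
    refine ⟨C₁ + C₂, by positivity, fun t z w w' hz hw hw' => ?_⟩
    simp only [hP.pd_add hQ, add_mul, Finset.sum_add_distrib]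
    rw [add_sub_add_comm, add_sub_add_comm]
    exact norm_add_le_of_le (h₁ t z w w' hz hw hw') (h₂ t z w w' hz hw hw')
  | @mul P Q hP hQ h₁ h₂ =>
    obtain ⟨C₁, h₁₀, h₁⟩ := h₁
    obtain ⟨C₂, h₂₀, h₂⟩ := h₂
    obtain ⟨B₁, hB₁, hP'⟩ := hP.bounded R
    obtain ⟨B₂, hB₂, hQ'⟩ := hQ.bounded R
    obtain ⟨L₁, hL₁, hP''⟩ := hP.lipschitz R
    obtain ⟨L₂, hL₂, hQ''⟩ := hQ.lipschitz R
    obtain ⟨D₁, hD₁, hP'''⟩ := key hP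
    obtain ⟨D₂, hD₂, hQ'''⟩ := key hQ
    refine ⟨C₁ * B₂ + D₁ * L₂ + B₁ * C₂ + L₁ * D₂, by positivity, fun t z w w' hz hw hw' => ?_⟩
    simp only [hP.pd_mul hQ, add_mul, Finset.sum_add_distrib]
    set dP := ∑ i, NASard.pd i P t z * (w i - w' i) with hdP
    set dQ := ∑ i, NASard.pd i Q t z * (w i - w' i) with hdQ
    have e₁ : ∑ i, NASard.pd i P t z * Q t z * (w i - w' i) = dP * Q t z := by
      rw [hdP, Finset.sum_mul]; exact Finset.sum_congr rfl fun i _ => by ring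
    have e₂ : ∑ i, P t z * NASard.pd i Q t z * (w i - w' i) = P t z * dQ := by
      rw [hdQ, Finset.mul_sum]; exact Finset.sum_congr rfl fun i _ => by ring
    rw [e₁, e₂]
    have n₁ := norm_nonneg (w - z)
    have n₂ := norm_nonneg (w' - z)
    have n₃ := norm_nonneg (w - w')
    -- Product rule: each of the four summands contains either a linearisation error of one factor,
    -- or the linear part of one factor times an increment of the other from z.
    calc ‖P t w * Q t w - P t w' * Q t w' - (dP * Q t z + P t z * dQ)‖
        = ‖(P t w - P t w' - dP) * Q t w + dP * (Q t w - Q t z)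
          + P t w' * (Q t w - Q t w' - dQ) + (P t w' - P t z) * dQ‖ := by ring_nf
      _ ≤ C₁ * (‖w - z‖ + ‖w' - z‖) * ‖w - w'‖ * B₂ + D₁ * ‖w - w'‖ * (L₂ * ‖w - z‖)
          + B₁ * (C₂ * (‖w - z‖ + ‖w' - z‖) * ‖w - w'‖) + L₁ * ‖w' - z‖ * (D₂ * ‖w - w'‖) := by
        refine norm_add_le_of_le (norm_add_le_of_le (norm_add_le_of_le
          (norm_mul_le_of_le (h₁ t z w w' hz hw hw') (hQ' t w hw))
          (norm_mul_le_of_le (hP''' t z w w' hz) (hQ'' t w z hw hz)))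
          (norm_mul_le_of_le (hP' t w' hw') (h₂ t z w w' hz hw hw')))
          (norm_mul_le_of_le (hP'' t w' z hw' hz) (hQ''' t z w w' hz))
      _ ≤ C₁ * (‖w - z‖ + ‖w' - z‖) * ‖w - w'‖ * B₂
          + D₁ * ‖w - w'‖ * (L₂ * (‖w - z‖ + ‖w' - z‖))
          + B₁ * (C₂ * (‖w - z‖ + ‖w' - z‖) * ‖w - w'‖)
          + L₁ * (‖w - z‖ + ‖w' - z‖) * (D₂ * ‖w - w'‖) := by
        gcongr <;> linarith
      _ = _ := by ring

end PolyFamily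

end PolyFamily

/-! ### Markov and mean value inequalities for polynomials of bounded degree. -/

section Markov

variable {K : Type*} [NontriviallyNormedField K]

/-- A nonzero element of norm `≤ r`, of norm comparable to `r`. -/
theorem exists_norm_le_le_mul (K : Type*) [NontriviallyNormedField K] :
    ∃ c : ℝ, 1 < c ∧ ∀ r : ℝ, 0 < r → ∃ τ : K, τ ≠ 0 ∧ ‖τ‖ ≤ r ∧ r ≤ c * ‖τ‖ := by
  obtain ⟨c, hc⟩ := NormedField.exists_one_lt_norm K
  refine ⟨‖c‖, hc, fun r hr => ?_⟩
  obtain ⟨d, hd, h₁, h₂, -⟩ := rescale_to_shell hc hr (one_ne_zero (α := K))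
  simp only [smul_eq_mul, mul_one] at h₁ h₂
  exact ⟨d, hd, h₁.le, by rwa [div_le_iff₀' (by linarith)] at h₂⟩

/-- The coefficients of a polynomial of bounded degree are controlled by its size on a ball. -/
theorem exists_coeff_bound (K : Type*) [NontriviallyNormedField K] (D : ℕ) :
    ∃ W : ℝ, 0 ≤ W ∧ ∀ (q : Polynomial K), q.natDegree ≤ D → ∀ r M : ℝ, 0 < r →
      (∀ τ, ‖τ‖ ≤ r → ‖q.eval τ‖ ≤ M) → ∀ k, ‖q.coeff k‖ * r ^ k ≤ W * M := by
  obtain ⟨c, hc, hshell⟩ := exists_norm_le_le_mul K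
  obtain ⟨ϖ, hϖ₀, hϖ₁⟩ := NormedField.exists_norm_lt_one K
  -- Powers of ϖ give D + 1 distinct nodes in the unit ball whatever the size of the residue field.
  -- They are scaled by an element τ of norm comparable to r, so the bound does not depend on r.
  let v : ℕ → K := fun i => ϖ ^ i
  let s := Finset.range (D + 1)
  have hv : Set.InjOn v s := by
    intro i _ j _ hij
    have h : ‖ϖ‖ ^ i = ‖ϖ‖ ^ j := by simpa [v] using congrArg norm hij
    exact pow_right_injective₀ hϖ₀ hϖ₁.ne h
  let w : ℝ := ∑ k ∈ s, ∑ i ∈ s, ‖(Lagrange.basis s v i).coeff k‖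
  have hw : 0 ≤ w := by positivity
  refine ⟨c ^ D * w, by positivity, fun q hq r M hr hM k => ?_⟩
  have hM₀ : 0 ≤ M := (norm_nonneg _).trans (hM 0 (by simpa using hr.le))
  rcases lt_or_ge D k with hk | hk
  · rw [Polynomial.coeff_eq_zero_of_natDegree_lt (by omega)]
    simp; positivity
  obtain ⟨τ, hτ₀, hτ, hτ'⟩ := hshell r hr
  have hq' : (q.comp (.C τ * .X)).degree < (s.card : WithBot ℕ) := by
    refine Polynomial.degree_lt_iff_coeff_zero _ _ |>.2 fun m hm => ?_
    rw [Polynomial.comp_C_mul_X_coeff, Polynomial.coeff_eq_zero_of_natDegree_lt, zero_mul]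
    simp [s] at hm; omega
  have hco : q.coeff k * τ ^ k = ∑ i ∈ s, q.eval (τ * v i) * (Lagrange.basis s v i).coeff k := by
    rw [← Polynomial.comp_C_mul_X_coeff, Lagrange.eq_interpolate hv hq', Lagrange.interpolate_apply,
      Polynomial.finsetSum_coeff]
    simp
  have hb : ‖q.coeff k * τ ^ k‖ ≤ w * M := by
    rw [hco]
    calc ‖∑ i ∈ s, q.eval (τ * v i) * (Lagrange.basis s v i).coeff k‖
        ≤ ∑ i ∈ s, M * ‖(Lagrange.basis s v i).coeff k‖ := by
          refine norm_sum_le_of_le _ fun i _ => ?_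
          rw [norm_mul]
          gcongr
          refine hM _ ?_
          rw [norm_mul, norm_pow]
          calc ‖τ‖ * ‖ϖ‖ ^ i ≤ r * 1 := by
                gcongr
                exact pow_le_one₀ (norm_nonneg _) hϖ₁.le
            _ = r := mul_one r
      _ = (∑ i ∈ s, ‖(Lagrange.basis s v i).coeff k‖) * M := by rw [← Finset.mul_sum, mul_comm]
      _ ≤ w * M := by
          gcongr
          exact Finset.single_le_sum (f := fun k => ∑ i ∈ s, ‖(Lagrange.basis s v i).coeff k‖)
            (fun _ _ => by positivity) (by simp [s]; omega)
  calc ‖q.coeff k‖ * r ^ k ≤ ‖q.coeff k‖ * (c * ‖τ‖) ^ k := by gcongr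
    _ = c ^ k * ‖q.coeff k * τ ^ k‖ := by rw [norm_mul, norm_pow, mul_pow]; ring
    _ ≤ c ^ D * (w * M) := by
        gcongr
        exact hc.le
    _ = _ := by ring

theorem exists_derivative_bound (K : Type*) [NontriviallyNormedField K] (D : ℕ) :
    ∃ W : ℝ, 0 ≤ W ∧ ∀ (q : Polynomial K), q.natDegree ≤ D → ∀ x : K, ∀ r M : ℝ, 0 < r →
      (∀ τ, ‖τ - x‖ ≤ r → ‖q.eval τ‖ ≤ M) → ‖q.derivative.eval x‖ * r ≤ W * M := by
  obtain ⟨W, hW, h⟩ := exists_coeff_bound K D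
  refine ⟨W, hW, fun q hq x r M hr hM => ?_⟩
  have := h (Polynomial.taylor x q) (by rwa [Polynomial.natDegree_taylor]) r M hr
    (fun τ hτ => by rw [Polynomial.taylor_eval]; exact hM _ (by simpa using hτ)) 1
  simpa using this

/-- A substitute for the mean value inequality for polynomials of bounded degree. -/
theorem exists_mean_value_bound (K : Type*) [NontriviallyNormedField K] [CharZero K] (D : ℕ) :
    ∃ W : ℝ, 0 ≤ W ∧ ∀ (q : Polynomial K), q.natDegree ≤ D → ∀ x y : K, ∀ M : ℝ,
      (∀ τ, ‖τ - x‖ ≤ ‖y - x‖ → ‖q.derivative.eval τ‖ ≤ M) →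
        ‖q.eval y - q.eval x‖ ≤ W * M * ‖y - x‖ := by
  obtain ⟨W, hW, h⟩ := exists_coeff_bound K D
  -- A coefficient is recovered from that of the derivative by dividing by k + 1, which may have
  -- small norm; only its being nonzero matters.
  refine ⟨∑ k ∈ Finset.range D, W / ‖((k + 1 : ℕ) : K)‖, by positivity,
    fun q hq x y M hM => ?_⟩
  rcases eq_or_ne y x with rfl | hxy
  · simp
  have hr : 0 < ‖y - x‖ := norm_pos_iff.2 (sub_ne_zero.2 hxy)
  set Q := Polynomial.taylor x q with hQ
  have hQd : Q.natDegree ≤ D := by rwa [hQ, Polynomial.natDegree_taylor]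
  have hco : ∀ k, ‖((k + 1 : ℕ) : K)‖ * ‖Q.coeff (k + 1)‖ * ‖y - x‖ ^ k ≤ W * M := fun k => by
    have := h Q.derivative ((Polynomial.natDegree_derivative_le _).trans (by omega)) _ M hr
      (fun τ hτ => by
        have : Q.derivative = Polynomial.taylor x q.derivative := by
          simp [hQ, Polynomial.taylor_apply, Polynomial.derivative_comp]
        rw [this, Polynomial.taylor_eval]; exact hM _ (by simpa using hτ)) k
    rw [Polynomial.coeff_derivative, norm_mul, mul_comm ‖Q.coeff _‖] at this
    exact_mod_cast this
  have e₁ : q.eval y = Q.eval (y - x) := by simp [hQ, Polynomial.taylor_eval]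
  have e₂ : q.eval x = Q.coeff 0 := by simp [hQ]
  rw [e₁, e₂, Polynomial.eval_eq_sum_range' (Nat.lt_succ_of_le hQd), Finset.sum_range_succ']
  simp only [pow_zero, mul_one, add_sub_cancel_right]
  rw [Finset.sum_mul, Finset.sum_mul]
  refine norm_sum_le_of_le _ fun k _ => ?_
  have hk : 0 < ‖((k + 1 : ℕ) : K)‖ := norm_pos_iff.2 (Nat.cast_ne_zero.2 k.succ_ne_zero)
  rw [norm_mul, norm_pow, pow_succ, ← mul_assoc]
  refine mul_le_mul_of_nonneg_right ?_ hr.le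
  rw [div_mul_eq_mul_div, le_div_iff₀ hk]
  calc _ = _ := by ring
    _ ≤ _ := hco k

end Markov

/-! ### Changing the variables one at a time. -/

section Telescope

variable {X : Type*} {Y : Type*} [SeminormedAddCommGroup Y] {n : ℕ}

/-- A bound for an increment of a function of `n` variables by changing the variables one by one. -/
theorem norm_sub_le_of_update (G : (Fin n → X) → Y) (z w : Fin n → X) (B : ℝ)
    (h : ∀ (i : Fin n) (x : Fin n → X), (∀ j, x j = z j ∨ x j = w j) → x i = z i →
      ‖G (Function.update x i (w i)) - G x‖ ≤ B) : ‖G w - G z‖ ≤ n * B := by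
  have key : ∀ s : Finset (Fin n), ‖G (s.piecewise w z) - G z‖ ≤ s.card * B := by
    intro s
    induction s using Finset.induction_on with
    | empty => simp
    | insert i s hi ih =>
      rw [Finset.piecewise_insert, Finset.card_insert_of_notMem hi]
      have h1 := h i (s.piecewise w z)
        (fun j => by by_cases hj : j ∈ s <;> simp [hj]) (by simp [hi])
      calc _ = ‖(G (Function.update (s.piecewise w z) i (w i)) - G (s.piecewise w z))
            + (G (s.piecewise w z) - G z)‖ := by abel_nf
        _ ≤ B + s.card * B := norm_add_le_of_le h1 ih
        _ = _ := by push_cast; ring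
  simpa using key Finset.univ

end Telescope

/-! ### Whitney fields, their derivatives, and flatness. -/

section Whitney

variable {K : Type*} [NontriviallyNormedField K] {T S : Type*} {n m : ℕ}
  {P : T → (Fin n → K) → K} {u : T → Fin n → K}

theorem PolyFamily.exists_polynomial_pd (hP : PolyFamily P) :
    ∃ D : ℕ, ∀ t z i, ∃ q : Polynomial K, q.natDegree ≤ D ∧
      (∀ τ, P t (Function.update z i τ) = q.eval τ) ∧
      ∀ τ, NASard.pd i P t (Function.update z i τ) = q.derivative.eval τ := by
  obtain ⟨D, h⟩ := hP.exists_polynomial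
  refine ⟨D, fun t z i => ?_⟩
  obtain ⟨q, hq, e⟩ := h t z i
  refine ⟨q, hq, e, fun τ => ?_⟩
  have := hP.hasDerivAt i t z τ
  simp only [e] at this
  exact this.unique (q.hasDerivAt τ)

/-- The polynomials `P t`, considered as jets at the points `u t ∈ K^n`, satisfy the compatibility
conditions of Whitney's extension theorem of order `l`. -/
def IsWhitney (l : ℕ) (u : T → Fin n → K) (P : T → (Fin n → K) → K) : Prop :=
  ∀ R : ℝ, ∃ C, 0 ≤ C ∧ ∀ s t z, ‖z‖ ≤ R →
    ‖P t z - P s z‖ ≤ C * (‖z - u t‖ + ‖z - u s‖) ^ l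

theorem IsWhitney.comp_index {l : ℕ} (σ : S → T) (h : IsWhitney l u P) :
    IsWhitney l (fun s => u (σ s)) (fun s => P (σ s)) := fun R => by
  obtain ⟨C, hC, h⟩ := h R
  exact ⟨C, hC, fun s t z hz => h (σ s) (σ t) z hz⟩

theorem norm_update_sub_le (z w : Fin n → K) (i : Fin n) (τ : K) :
    ‖Function.update z i τ - w‖ ≤ ‖z - w‖ + ‖τ - z i‖ := by
  have h : Function.update z i τ - w = (z - w) + Pi.single i (τ - z i) := by
    ext j
    by_cases hj : j = i
    · subst hj; simp
    · simp [hj]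
  rw [h]
  exact norm_add_le_of_le le_rfl (Pi.norm_single (G := fun _ : Fin n => K) _).le

/-- The compatibility condition holds at all z, not only at base points. So Markov's inequality
applies to `P t - P s` on a segment of radius comparable to the distance to the base points and
costs exactly one power of it. -/
theorem IsWhitney.pd {l : ℕ} (h : IsWhitney (l + 1) u P) (hP : PolyFamily P)
    {B : ℝ} (hu : ∀ t, ‖u t‖ ≤ B) (i : Fin n) : IsWhitney l u (pd i P) := by
  intro R
  obtain ⟨D, hD⟩ := hP.exists_polynomial_pd
  obtain ⟨W, hW, hW'⟩ := exists_derivative_bound K D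
  obtain ⟨C, hC, hC'⟩ := h (3 * R + 2 * B + 1)
  refine ⟨W * C * 3 ^ (l + 1), by positivity, fun s t z hz => ?_⟩
  set ρ := ‖z - u t‖ + ‖z - u s‖ with hρ
  have hρ₀ : 0 ≤ ρ := by positivity
  have hρ₁ : ρ ≤ 2 * R + 2 * B := by
    have h₁ := norm_sub_le_of_le hz (hu t)
    have h₂ := norm_sub_le_of_le hz (hu s)
    linarith
  -- The radius must be positive whereas ρ may be 0, so the estimate is made for r > ρ and r then
  -- tends to ρ. Moving a coordinate of z by at most r changes the sum of the two distances from ρ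
  -- to at most 3r.
  have key : ∀ r ∈ Ioo ρ (ρ + 1),
      ‖NASard.pd i P t z - NASard.pd i P s z‖ ≤ W * C * 3 ^ (l + 1) * r ^ l := by
    rintro r ⟨hr, hr'⟩
    have hr₀ : 0 < r := hρ₀.trans_lt hr
    obtain ⟨q₁, hq₁, e₁, d₁⟩ := hD t z i
    obtain ⟨q₂, hq₂, e₂, d₂⟩ := hD s z i
    have := hW' (q₁ - q₂) ((Polynomial.natDegree_sub_le _ _).trans (max_le hq₁ hq₂)) (z i) r
      (C * (3 * r) ^ (l + 1)) hr₀ (fun τ hτ => by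
        rw [Polynomial.eval_sub, ← e₁, ← e₂]
        have b₀ := norm_update_sub_le z 0 i τ
        have b₁ := norm_update_sub_le z (u t) i τ
        have b₂ := norm_update_sub_le z (u s) i τ
        rw [sub_zero, sub_zero] at b₀
        refine (hC' s t _ (by linarith)).trans ?_
        gcongr
        linarith)
    rw [Polynomial.derivative_sub, Polynomial.eval_sub, ← d₁, ← d₂, Function.update_eq_self,
      mul_pow, pow_succ r] at this
    refine le_of_mul_le_mul_right (this.trans_eq ?_) hr₀
    ring
  have hlim : Filter.Tendsto (fun r : ℝ => W * C * 3 ^ (l + 1) * r ^ l)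
      (nhdsWithin ρ (Ioi ρ)) (nhds (W * C * 3 ^ (l + 1) * ρ ^ l)) :=
    ((by fun_prop : Continuous fun r : ℝ => W * C * 3 ^ (l + 1) * r ^ l).tendsto ρ).mono_left
      nhdsWithin_le_nhds
  refine ge_of_tendsto hlim ?_
  filter_upwards [Ioo_mem_nhdsGT (show ρ < ρ + 1 by linarith)] using key

/-- Iterated partial derivatives. -/
def pdL (L : List (Fin n)) (P : T → (Fin n → K) → K) : T → (Fin n → K) → K :=
  L.foldl (fun P i => pd i P) P

theorem pdL_concat (i : Fin n) (L : List (Fin n)) : pdL (L ++ [i]) P = pd i (pdL L P) := by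
  simp [pdL]

theorem PolyFamily.pdL (hP : PolyFamily P) (L : List (Fin n)) : PolyFamily (pdL L P) := by
  induction L generalizing P with
  | nil => exact hP
  | cons i L ih => exact ih (hP.pd i)

theorem IsWhitney.pdL {l : ℕ} (L : List (Fin n)) (h : IsWhitney (l + L.length) u P)
    (hP : PolyFamily P) {B : ℝ} (hu : ∀ t, ‖u t‖ ≤ B) : IsWhitney l u (pdL L P) := by
  induction L generalizing P with
  | nil => exact h
  | cons i L ih => exact ih (IsWhitney.pd (by simpa [add_assoc] using h) hP hu i) (hP.pd i)

theorem pdL_comp_index (σ : S → T) (L : List (Fin n)) :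
    pdL L (fun s => P (σ s)) = fun s => pdL L P (σ s) := by
  induction L generalizing P with
  | nil => rfl
  | cons i L ih => exact ih (P := pd i P)

/-- `P t` varies slowly near `u t`, to the order `k`. -/
def IsFlat (k : ℕ) (u : T → Fin n → K) (P : T → (Fin n → K) → K) : Prop :=
  ∀ R : ℝ, ∃ C, 0 ≤ C ∧ ∀ t z w, ‖z‖ ≤ R → ‖w‖ ≤ R →
    ‖P t z - P t w‖ ≤ C * (‖z - u t‖ + ‖w - u t‖) ^ k * ‖z - w‖

theorem IsFlat.comp_index {k : ℕ} (σ : S → T) (h : IsFlat k u P) :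
    IsFlat k (fun s => u (σ s)) (fun s => P (σ s)) := fun R => by
  obtain ⟨C, hC, h⟩ := h R
  exact ⟨C, hC, fun t => h (σ t)⟩

theorem PolyFamily.isFlat_zero (hP : PolyFamily P) : IsFlat 0 u P := fun R => by
  simpa using hP.lipschitz R

/-- By induction each first partial derivative is flat of one order less and vanishes at `u t`,
hence is O(‖z - u t‖^k) when the derivatives of orders 1, …, k vanish. The mean value inequality
along each axis turns this into a bound for increments. -/
theorem PolyFamily.isFlat [CharZero K] (hP : PolyFamily P) {B : ℝ} (hu : ∀ t, ‖u t‖ ≤ B) {k : ℕ}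
    (hvan : ∀ t, ∀ L : List (Fin n), 1 ≤ L.length → L.length ≤ k → NASard.pdL L P t (u t) = 0) :
    IsFlat k u P := by
  induction k generalizing P with
  | zero => exact hP.isFlat_zero
  | succ k ih =>
    intro R
    obtain ⟨D, hD⟩ := hP.exists_polynomial_pd
    obtain ⟨W, hW, hW'⟩ := exists_mean_value_bound K D
    have hder : ∀ i, ∃ C, 0 ≤ C ∧ ∀ t z, ‖z‖ ≤ 5 * (|R| + |B|) →
        ‖NASard.pd i P t z‖ ≤ C * ‖z - u t‖ ^ (k + 1) := fun i => by
      obtain ⟨C, hC, h⟩ := ih (hP.pd i)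
        (fun t L h₁ h₂ => hvan t (i :: L) (by simp) (by simpa using h₂)) (5 * (|R| + |B|))
      refine ⟨C, hC, fun t z hz => ?_⟩
      have h0 : NASard.pd i P t (u t) = 0 := hvan t [i] (by simp) (by simp)
      have hut : ‖u t‖ ≤ 5 * (|R| + |B|) := by
        have := hu t; have := le_abs_self B; have := abs_nonneg R; have := abs_nonneg B; linarith
      have := h t z (u t) hz hut
      rw [h0, sub_self, norm_zero, add_zero, sub_zero] at this
      rwa [pow_succ, ← mul_assoc]
    choose C hC hC' using hder
    set A := ∑ i, C i with hA
    have hA₀ : 0 ≤ A := Finset.sum_nonneg fun i _ => hC i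
    have hCA : ∀ i, C i ≤ A := fun i => Finset.single_le_sum (fun i _ => hC i) (Finset.mem_univ i)
    refine ⟨n * (W * (A * 2 ^ (k + 1))), by positivity, fun t z w hz hw => ?_⟩
    set ρ := ‖z - u t‖ + ‖w - u t‖ with hρ
    have hρ₀ : 0 ≤ ρ := by positivity
    have hzw : ‖w - z‖ ≤ ρ := by
      calc ‖w - z‖ = ‖(w - u t) - (z - u t)‖ := by abel_nf
        _ ≤ ‖w - u t‖ + ‖z - u t‖ := norm_sub_le _ _
        _ = ρ := by rw [hρ]; ring
    have hρ₁ : ρ ≤ 2 * (|R| + |B|) := by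
      have h₁ := norm_sub_le_of_le hz (hu t)
      have h₂ := norm_sub_le_of_le hw (hu t)
      have := le_abs_self B
      have := le_abs_self R
      linarith
    rw [← norm_neg, neg_sub]
    refine (norm_sub_le_of_update (P t) z w (W * (A * 2 ^ (k + 1)) * ρ ^ (k + 1) * ‖z - w‖)
      fun i x hx hxi => ?_).trans_eq (by ring)
    obtain ⟨q, hq, e, d⟩ := hD t x i
    have hxu : ‖x - u t‖ ≤ ρ := by
      refine (pi_norm_le_iff_of_nonneg hρ₀).2 fun j => ?_
      rcases hx j with h | h
      · rw [Pi.sub_apply, h]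
        exact (norm_le_pi_norm (z - u t) j).trans (le_add_of_nonneg_right (norm_nonneg _))
      · rw [Pi.sub_apply, h]
        exact (norm_le_pi_norm (w - u t) j).trans (le_add_of_nonneg_left (norm_nonneg _))
    have hwz : ‖w i - x i‖ ≤ ‖z - w‖ := by
      rw [hxi, ← norm_neg, neg_sub]; exact norm_le_pi_norm (z - w) i
    have := hW' q hq (x i) (w i) (A * (2 * ρ) ^ (k + 1)) fun τ hτ => by
      rw [← d]
      have hb := norm_update_sub_le x (u t) i τ
      have hb' : ‖Function.update x i τ - u t‖ ≤ 2 * ρ := by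
        have := norm_sub_rev w z
        linarith
      have hb'' : ‖Function.update x i τ‖ ≤ 5 * (|R| + |B|) := by
        have h₁ : ‖Function.update x i τ‖ ≤ ‖Function.update x i τ - u t‖ + ‖u t‖ := by
          simpa using norm_add_le (Function.update x i τ - u t) (u t)
        have h₂ := hu t
        have h₃ := le_abs_self B
        have h₄ := abs_nonneg R
        linarith
      calc _ ≤ C i * ‖Function.update x i τ - u t‖ ^ (k + 1) := hC' i t _ hb''
        _ ≤ A * (2 * ρ) ^ (k + 1) := by
          gcongr
          exact hCA i
    rw [← e, ← e, Function.update_eq_self] at this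
    calc _ ≤ W * (A * (2 * ρ) ^ (k + 1)) * ‖w i - x i‖ := this
      _ ≤ W * (A * (2 * ρ) ^ (k + 1)) * ‖z - w‖ := by gcongr
      _ = _ := by rw [mul_pow]; ring

/-- Order one suffices. Applied to derivatives, this makes the strata in Sard's theorem closed,
hence compact. -/
theorem IsWhitney.continuous [TopologicalSpace T] {l : ℕ} (h : IsWhitney (l + 1) u P)
    (hP : PolyFamily P) {B : ℝ} (hu : ∀ t, ‖u t‖ ≤ B) (hc : Continuous u) :
    Continuous fun t => P t (u t) := by
  obtain ⟨C, hC, h⟩ := h B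
  obtain ⟨C', hC', h'⟩ := hP.lipschitz B
  refine continuous_iff_continuousAt.2 fun t => ?_
  rw [ContinuousAt, tendsto_iff_norm_sub_tendsto_zero]
  have hlim : Filter.Tendsto (fun s => C * ‖u s - u t‖ ^ (l + 1) + C' * ‖u s - u t‖) (nhds t)
      (nhds 0) := by
    have : Continuous fun s => C * ‖u s - u t‖ ^ (l + 1) + C' * ‖u s - u t‖ := by fun_prop
    simpa using this.tendsto t
  refine squeeze_zero (fun _ => norm_nonneg _) (fun s => ?_) hlim
  have h₁ := h t s (u s) (hu s)
  rw [sub_self, norm_zero, zero_add] at h₁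
  calc ‖P s (u s) - P t (u t)‖ = ‖(P s (u s) - P t (u s)) + (P t (u s) - P t (u t))‖ := by abel_nf
    _ ≤ _ := norm_add_le_of_le h₁ (h' t _ _ (hu s) (hu t))

end Whitney

/-! ### Elimination of one variable by an equation. -/

section Implicit

variable {K : Type*} [NontriviallyNormedField K] {T : Type*} {n : ℕ} {i : Fin (n + 1)}

theorem norm_le_apply_add_removeNth (i : Fin (n + 1)) (z : Fin (n + 1) → K) :
    ‖z‖ ≤ ‖z i‖ + ‖i.removeNth z‖ := by
  refine (pi_norm_le_iff_of_nonneg (by positivity)).2 fun j => ?_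
  induction j using i.succAboveCases with
  | x => exact le_add_of_nonneg_right (norm_nonneg _)
  | p j => exact (norm_le_pi_norm (i.removeNth z) j).trans (le_add_of_nonneg_left (norm_nonneg _))

theorem norm_removeNth_le (i : Fin (n + 1)) (z : Fin (n + 1) → K) : ‖i.removeNth z‖ ≤ ‖z‖ :=
  (pi_norm_le_iff_of_nonneg (norm_nonneg _)).2 fun j => norm_le_pi_norm z (i.succAbove j)

theorem norm_insertNth_le (i : Fin (n + 1)) (a : K) (y : Fin n → K) :
    ‖(i.insertNth a y : Fin (n + 1) → K)‖ ≤ ‖a‖ + ‖y‖ := by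
  simpa using norm_le_apply_add_removeNth i (i.insertNth a y : Fin (n + 1) → K)

theorem norm_insertNth_sub_le (i : Fin (n + 1)) (a : K) (y : Fin n → K) (z : Fin (n + 1) → K) :
    ‖(i.insertNth a y : Fin (n + 1) → K) - z‖ ≤ ‖a - z i‖ + ‖y - i.removeNth z‖ := by
  have h := norm_le_apply_add_removeNth i ((i.insertNth a y : Fin (n + 1) → K) - z)
  have e : i.removeNth ((i.insertNth a y : Fin (n + 1) → K) - z) = y - i.removeNth z := by
    ext j; simp [Fin.removeNth]
  rwa [e, Pi.sub_apply, Fin.insertNth_apply_same] at h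

variable {P : T → (Fin (n + 1) → K) → K} {u : T → Fin (n + 1) → K} {R : T → (Fin n → K) → K}
  {B c : ℝ}

theorem PolyFamily.insertNth (hP : PolyFamily P) (hR : PolyFamily R) (i : Fin (n + 1)) :
    PolyFamily fun t y => P t (i.insertNth (R t y) y) := by
  refine hP.subst (G := fun j t y => (i.insertNth (R t y) y : Fin (n + 1) → K) j) fun j => ?_
  induction j using i.succAboveCases with
  | x => simpa using hR
  | p j => simpa using coord j

/-- `P t z` is, to the first order at `u t` and along the `i`-th axis, linear. -/
theorem PolyFamily.taylor_insertNth (hP : PolyFamily P) (i : Fin (n + 1)) (N : ℝ) :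
    ∃ C, 0 ≤ C ∧ ∀ t z a b (y : Fin n → K), ‖z‖ ≤ N →
      ‖(i.insertNth a y : Fin (n + 1) → K)‖ ≤ N → ‖(i.insertNth b y : Fin (n + 1) → K)‖ ≤ N →
      ‖P t (i.insertNth a y) - P t (i.insertNth b y) - NASard.pd i P t z * (a - b)‖ ≤
        C * (‖(i.insertNth a y : Fin (n + 1) → K) - z‖ +
          ‖(i.insertNth b y : Fin (n + 1) → K) - z‖) * ‖a - b‖ := by
  obtain ⟨C, hC, h⟩ := hP.taylor_one N
  refine ⟨C, hC, fun t z a b y hz ha hb => ?_⟩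
  have := h t z _ _ hz ha hb
  rw [Fin.sum_univ_succAbove _ i] at this
  simp only [Fin.insertNth_apply_same, Fin.insertNth_apply_succAbove, sub_self, mul_zero,
    Finset.sum_const_zero, add_zero] at this
  refine this.trans ?_
  gcongr
  refine (norm_insertNth_sub_le i a y _).trans ?_
  simp

/-- For two nearby base points, `P t (u s)` is small of second order, since `P s (u s) = 0` and the
order is at least 2. The linear part of `P t` along u s - u t is therefore small of second order
too, and its i-th term is controlled by the other coordinates. The quadratic errors are absorbed for
small δ. -/
theorem IsWhitney.exists_lipschitz {j : ℕ} (h : IsWhitney (j + 2) u P) (hP : PolyFamily P)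
    (hu : ∀ t, ‖u t‖ ≤ B) (h0 : ∀ t, P t (u t) = 0) (hc : 0 < c)
    (hpd : ∀ t, c ≤ ‖NASard.pd i P t (u t)‖) :
    ∃ δ, 0 < δ ∧ ∃ Λ, 0 ≤ Λ ∧ ∀ s t, ‖u s - u t‖ ≤ δ →
      ‖u s i - u t i‖ ≤ Λ * ‖i.removeNth (u s) - i.removeNth (u t)‖ := by
  obtain ⟨C₁, hC₁, h₁⟩ := hP.taylor_one B
  obtain ⟨C₂, hC₂, h₂⟩ := h B
  choose D hD hD' using fun j => (hP.pd j).bounded B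
  set E := ∑ j, D (i.succAbove j) with hE
  have hE₀ : 0 ≤ E := Finset.sum_nonneg fun j _ => hD _
  refine ⟨min 1 (c / (2 * (C₁ + C₂ + 1))), by positivity, 2 / c * (E + c / 2), by positivity,
    fun s t hst => ?_⟩
  set Δ := ‖u s - u t‖ with hΔ
  set Δ' := ‖i.removeNth (u s) - i.removeNth (u t)‖ with hΔ'
  have hΔ₀ : 0 ≤ Δ := norm_nonneg _
  have hΔ₁ : Δ ≤ 1 := hst.trans (min_le_left _ _)
  have hΔ₂ : Δ * (C₁ + C₂) ≤ c / 2 := by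
    have := hst.trans (min_le_right _ _)
    rw [le_div_iff₀ (by positivity)] at this
    nlinarith
  have hΔ₃ : Δ ≤ ‖u s i - u t i‖ + Δ' := norm_le_apply_add_removeNth i (u s - u t)
  have t₁ := h₁ t (u t) (u s) (u t) (hu t) (hu s) (hu t)
  have t₂ := h₂ t s (u s) (hu s)
  rw [sub_self, norm_zero, zero_add, h0, zero_sub, norm_neg] at t₂
  rw [h0, sub_zero, sub_self, norm_zero, add_zero, Fin.sum_univ_succAbove _ i] at t₁
  have t₃ : ‖∑ j, NASard.pd (i.succAbove j) P t (u t) *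
      (u s (i.succAbove j) - u t (i.succAbove j))‖ ≤ E * Δ' := by
    rw [hE, Finset.sum_mul]
    exact norm_sum_le_of_le _ fun j _ => norm_mul_le_of_le (hD' _ t _ (hu t))
      (norm_le_pi_norm (i.removeNth (u s) - i.removeNth (u t)) j)
  set X := NASard.pd i P t (u t) * (u s i - u t i) with hX
  set Z := ∑ j, NASard.pd (i.succAbove j) P t (u t) *
      (u s (i.succAbove j) - u t (i.succAbove j))
  have t₄ : c * ‖u s i - u t i‖ ≤ ‖X‖ := by
    rw [hX, norm_mul]
    gcongr
    exact hpd t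
  have t₅ : ‖X‖ ≤ ‖P t (u s)‖ + ‖P t (u s) - (X + Z)‖ + ‖Z‖ := by
    calc ‖X‖ = ‖P t (u s) - (P t (u s) - (X + Z)) - Z‖ := by abel_nf
      _ ≤ _ := (norm_sub_le _ _).trans (by gcongr; exact norm_sub_le _ _)
  have t₆ : Δ ^ (j + 2) ≤ Δ * Δ := by
    rw [pow_add, pow_two]
    exact mul_le_of_le_one_left (by positivity) (pow_le_one₀ hΔ₀ hΔ₁)
  have t₇ : C₂ * Δ ^ (j + 2) ≤ C₂ * (Δ * Δ) := by gcongr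
  have t₈ : (Δ * (C₁ + C₂)) * Δ ≤ c / 2 * (‖u s i - u t i‖ + Δ') := by gcongr
  have t₉ : c / 2 * ‖u s i - u t i‖ ≤ (E + c / 2) * Δ' := by linarith
  calc ‖u s i - u t i‖ = 2 / c * (c / 2 * ‖u s i - u t i‖) := by field_simp
    _ ≤ 2 / c * ((E + c / 2) * Δ') := by gcongr
    _ = _ := by ring

/-- Bounds for the points of the graphs of `R t`. -/
theorem PolyFamily.exists_graph_bound (hR : PolyFamily R) (hu : ∀ t, ‖u t‖ ≤ B)
    (hRu : ∀ t, R t (i.removeNth (u t)) = u t i) (ρ : ℝ) :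
    ∃ κ N, 0 ≤ κ ∧ B ≤ N ∧ ∀ t y, ‖y‖ ≤ ρ →
      ‖(i.insertNth (R t y) y : Fin (n + 1) → K)‖ ≤ N ∧
      ‖R t y - u t i‖ ≤ κ * ‖y - i.removeNth (u t)‖ ∧
      ‖(i.insertNth (R t y) y : Fin (n + 1) → K) - u t‖ ≤ κ * ‖y - i.removeNth (u t)‖ := by
  obtain ⟨C, hC, hC'⟩ := hR.bounded ρ
  obtain ⟨A, hA, hA'⟩ := hR.lipschitz (|ρ| + |B|)
  refine ⟨A + 1, max B (C + ρ), by positivity, le_max_left _ _, fun t y hy => ?_⟩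
  have h₁ : ‖R t y - u t i‖ ≤ A * ‖y - i.removeNth (u t)‖ := by
    rw [← hRu]
    refine hA' t _ _ (hy.trans ?_) ((norm_removeNth_le i _).trans ((hu t).trans ?_))
    · exact (le_abs_self ρ).trans (le_add_of_nonneg_right (abs_nonneg _))
    · exact (le_abs_self B).trans (le_add_of_nonneg_left (abs_nonneg _))
  refine ⟨?_, h₁.trans (by gcongr; linarith), (norm_insertNth_sub_le _ _ _ _).trans (by linarith)⟩
  exact (norm_insertNth_le _ _ _).trans ((add_le_add (hC' t y hy) hy).trans (le_max_right _ _))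

/-- The Taylor polynomials of the solution `R` of the equation `P t (y, R t y) = 0`. -/
theorem PolyFamily.exists_implicit (hP : PolyFamily P) (hu : ∀ t, ‖u t‖ ≤ B)
    (h0 : ∀ t, P t (u t) = 0) (hc : 0 < c) (hpd : ∀ t, c ≤ ‖NASard.pd i P t (u t)‖) (k : ℕ) :
    ∃ R : T → (Fin n → K) → K, PolyFamily R ∧ (∀ t, R t (i.removeNth (u t)) = u t i) ∧
      ∀ ρ, ∃ C, 0 ≤ C ∧ ∀ t y, ‖y‖ ≤ ρ →
        ‖P t (i.insertNth (R t y) y)‖ ≤ C * ‖y - i.removeNth (u t)‖ ^ (k + 1) := by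
  induction k with
  | zero =>
    have hR : PolyFamily fun t (_ : Fin n → K) => u t i :=
      param _ B fun t => (norm_le_pi_norm _ i).trans (hu t)
    refine ⟨fun t _ => u t i, hR, fun t => rfl, fun ρ => ?_⟩
    obtain ⟨κ, N, hκ, hN, hg⟩ := hR.exists_graph_bound (i := i) hu (fun _ => rfl) ρ
    obtain ⟨C, hC, hC'⟩ := hP.lipschitz N
    refine ⟨C * κ, by positivity, fun t y hy => ?_⟩
    obtain ⟨g₁, -, g₂⟩ := hg t y hy
    have := hC' t _ (u t) g₁ ((hu t).trans hN)
    rw [h0, sub_zero] at this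
    refine this.trans ?_
    rw [zero_add, pow_one, mul_assoc]
    gcongr
  | succ k ih =>
    obtain ⟨R, hR, hRu, hRP⟩ := ih
    have hinv : PolyFamily fun t (_ : Fin n → K) => (NASard.pd i P t (u t))⁻¹ :=
      param _ c⁻¹ fun t => by rw [norm_inv]; exact inv_anti₀ hc (hpd t)
    -- A Newton step with the slope frozen at the base point: it stays polynomial, and each step
    -- gains one order.
    set R' : T → (Fin n → K) → K :=
      fun t y => R t y - (NASard.pd i P t (u t))⁻¹ * P t (i.insertNth (R t y) y) with hR'd
    have hR' : PolyFamily R' := hR.sub (hinv.mul (hP.insertNth hR i))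
    have hRu' : ∀ t, R' t (i.removeNth (u t)) = u t i := fun t => by
      simp only [hR'd, hRu, Fin.insertNth_self_removeNth, h0, mul_zero, sub_zero]
    refine ⟨R', hR', hRu', fun ρ => ?_⟩
    obtain ⟨C, hC, hC'⟩ := hRP ρ
    obtain ⟨κ₁, N₁, hκ₁, hN₁, hg₁⟩ := hR.exists_graph_bound (i := i) hu hRu ρ
    obtain ⟨κ₂, N₂, hκ₂, hN₂, hg₂⟩ := hR'.exists_graph_bound (i := i) hu hRu' ρ
    obtain ⟨A, hA, hA'⟩ := hP.taylor_insertNth i (max N₁ N₂)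
    refine ⟨A * (κ₂ + κ₁) * (c⁻¹ * C), by positivity, fun t y hy => ?_⟩
    obtain ⟨g₁, -, g₂⟩ := hg₁ t y hy
    obtain ⟨g₃, -, g₄⟩ := hg₂ t y hy
    have ht := hA' t (u t) (R' t y) (R t y) y ((hu t).trans (hN₁.trans (le_max_left _ _)))
      (g₃.trans (le_max_right _ _)) (g₁.trans (le_max_left _ _))
    have hne : NASard.pd i P t (u t) ≠ 0 := norm_pos_iff.1 (hc.trans_le (hpd t))
    have e₁ : R' t y - R t y = -((NASard.pd i P t (u t))⁻¹ * P t (i.insertNth (R t y) y)) := by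
      simp [hR'd]
    have e₂ : P t (i.insertNth (R' t y) y) - P t (i.insertNth (R t y) y)
        - NASard.pd i P t (u t) * (R' t y - R t y) = P t (i.insertNth (R' t y) y) := by
      rw [e₁, mul_neg, mul_inv_cancel_left₀ hne]; ring
    rw [e₂] at ht
    have e₃ : ‖R' t y - R t y‖ ≤ c⁻¹ * (C * ‖y - i.removeNth (u t)‖ ^ (k + 1)) := by
      rw [e₁, norm_neg]
      refine norm_mul_le_of_le ?_ (hC' t y hy)
      rw [norm_inv]; exact inv_anti₀ hc (hpd t)
    calc _ ≤ _ := ht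
      _ ≤ A * (κ₂ * ‖y - i.removeNth (u t)‖ + κ₁ * ‖y - i.removeNth (u t)‖) *
          (c⁻¹ * (C * ‖y - i.removeNth (u t)‖ ^ (k + 1))) := by gcongr
      _ = _ := by rw [pow_succ _ (k + 1)]; ring

/-- Points of the graph of `R s` are close to `u t` if `u s` and `u t` are. -/
theorem norm_insertNth_sub_le_of_lipschitz {Λ κ : ℝ} (hκ : 0 ≤ κ)
    (hΛ' : 0 ≤ Λ) {s t : T} {y : Fin n → K}
    (hΛ : ‖u s i - u t i‖ ≤ Λ * ‖i.removeNth (u s) - i.removeNth (u t)‖)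
    (h : ‖R s y - u s i‖ ≤ κ * ‖y - i.removeNth (u s)‖) :
    ‖(i.insertNth (R s y) y : Fin (n + 1) → K) - u t‖ ≤
      (κ + Λ + 1) * (‖y - i.removeNth (u t)‖ + ‖y - i.removeNth (u s)‖) := by
  set a := ‖y - i.removeNth (u t)‖ with ha
  set b := ‖y - i.removeNth (u s)‖ with hb
  have hab : ‖i.removeNth (u s) - i.removeNth (u t)‖ ≤ a + b := by
    calc _ = ‖(y - i.removeNth (u t)) - (y - i.removeNth (u s))‖ := by abel_nf
      _ ≤ _ := norm_sub_le _ _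
  have h₁ : ‖R s y - u t i‖ ≤ κ * b + Λ * (a + b) := by
    calc _ = ‖(R s y - u s i) + (u s i - u t i)‖ := by abel_nf
      _ ≤ _ := norm_add_le_of_le h (hΛ.trans (by gcongr))
  have ha₀ : 0 ≤ a := norm_nonneg _
  have hb₀ : 0 ≤ b := norm_nonneg _
  have h₂ := norm_insertNth_sub_le i (R s y) y (u t)
  nlinarith [mul_nonneg hκ ha₀]

/-- Both `P t` on the graph of `R t` and `P s` on the graph of `R s` are O(r^j), and compatibility
replaces `P s` by `P t` at the same cost. So `P t` differs by O(r^j) between two points on a line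
parallel to the i-th axis, where its slope is bounded below. -/
theorem IsWhitney.implicit {j : ℕ} {Λ : ℝ} (h : IsWhitney j u P) (hP : PolyFamily P)
    (hu : ∀ t, ‖u t‖ ≤ B) (hc : 0 < c)
    (hpd : ∀ t, c ≤ ‖NASard.pd i P t (u t)‖) (hΛ₀ : 0 ≤ Λ)
    (hΛ : ∀ s t, ‖u s i - u t i‖ ≤ Λ * ‖i.removeNth (u s) - i.removeNth (u t)‖)
    (hR : PolyFamily R) (hRu : ∀ t, R t (i.removeNth (u t)) = u t i)
    (hRP : ∀ ρ, ∃ C, 0 ≤ C ∧ ∀ t y, ‖y‖ ≤ ρ →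
        ‖P t (i.insertNth (R t y) y)‖ ≤ C * ‖y - i.removeNth (u t)‖ ^ j) :
    IsWhitney j (fun t => i.removeNth (u t)) R := by
  intro ρ
  obtain ⟨CE, hCE, hE⟩ := hRP ρ
  obtain ⟨κ, N, hκ, hN, hg⟩ := hR.exists_graph_bound (i := i) hu hRu ρ
  obtain ⟨CR, hCR, hCR'⟩ := hR.bounded ρ
  obtain ⟨CW, hCW, hCW'⟩ := h N
  obtain ⟨A, hA, hA'⟩ := hP.taylor_insertNth i N
  set κ' := κ + Λ + 1 with hκ'
  have hκ'₀ : 0 < κ' := by positivity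
  -- Below r₀ the error of the linearisation is at most half of the slope c; beyond r₀ the
  -- boundedness of R suffices.
  set r₀ := c / (4 * (A + 1) * κ') with hr₀
  have hr₀' : 0 < r₀ := by positivity
  set E := 2 * CE + CW * (2 * κ') ^ j with hE'
  refine ⟨2 / c * E + 2 * CR / r₀ ^ j, by positivity, fun s t y hy => ?_⟩
  set r := ‖y - i.removeNth (u t)‖ + ‖y - i.removeNth (u s)‖ with hr
  have hr' : 0 ≤ r := by positivity
  rcases le_or_gt r r₀ with hrr | hrr
  · obtain ⟨s₁, s₂, s₃⟩ := hg s y hy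
    obtain ⟨t₁, t₂, t₃⟩ := hg t y hy
    have w₁ : ‖(i.insertNth (R s y) y : Fin (n + 1) → K) - u t‖ ≤ κ' * r :=
      norm_insertNth_sub_le_of_lipschitz hκ hΛ₀ (hΛ s t) s₂
    have w₂ : ‖(i.insertNth (R s y) y : Fin (n + 1) → K) - u s‖ ≤ κ' * r := by
      refine s₃.trans ?_
      gcongr
      · linarith
      · exact le_add_of_nonneg_left (norm_nonneg _)
    have w₃ : ‖(i.insertNth (R t y) y : Fin (n + 1) → K) - u t‖ ≤ κ' * r := by
      refine t₃.trans ?_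
      gcongr
      · linarith
      · exact le_add_of_nonneg_right (norm_nonneg _)
    have v₁ : ‖P t (i.insertNth (R t y) y)‖ ≤ CE * r ^ j := (hE t y hy).trans (by
      gcongr; exact le_add_of_nonneg_right (norm_nonneg _))
    have v₂ : ‖P s (i.insertNth (R s y) y)‖ ≤ CE * r ^ j := (hE s y hy).trans (by
      gcongr; exact le_add_of_nonneg_left (norm_nonneg _))
    have v₃ : ‖P t (i.insertNth (R s y) y) - P s (i.insertNth (R s y) y)‖
        ≤ CW * (2 * κ') ^ j * r ^ j := by
      refine (hCW' s t _ s₁).trans ?_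
      rw [mul_assoc, ← mul_pow]
      gcongr
      linarith
    have v₄ := hA' t (u t) (R t y) (R s y) y ((hu t).trans hN) t₁ s₁
    set X := NASard.pd i P t (u t) * (R t y - R s y) with hX
    have x₁ : c * ‖R t y - R s y‖ ≤ ‖X‖ := by
      rw [hX, norm_mul]; gcongr; exact hpd t
    have x₂ : ‖X‖ ≤ CE * r ^ j + (CW * (2 * κ') ^ j * r ^ j + CE * r ^ j) +
        A * (κ' * r + κ' * r) * ‖R t y - R s y‖ := by
      calc ‖X‖ = ‖P t (i.insertNth (R t y) y) - ((P t (i.insertNth (R s y) y)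
            - P s (i.insertNth (R s y) y)) + P s (i.insertNth (R s y) y))
            - (P t (i.insertNth (R t y) y) - P t (i.insertNth (R s y) y) - X)‖ := by abel_nf
        _ ≤ _ := norm_sub_le_of_le (norm_sub_le_of_le v₁ (norm_add_le_of_le v₃ v₂))
            (v₄.trans (by gcongr))
    have x₃ : A * (κ' * r + κ' * r) ≤ c / 2 := by
      have : r * (4 * (A + 1) * κ') ≤ c := by
        rwa [hr₀, le_div_iff₀ (by positivity)] at hrr
      nlinarith [mul_nonneg hr' hκ'₀.le]
    have x₄ : A * (κ' * r + κ' * r) * ‖R t y - R s y‖ ≤ c / 2 * ‖R t y - R s y‖ := by gcongr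
    have x₅ : c / 2 * ‖R t y - R s y‖ ≤ E * r ^ j := by rw [hE']; linarith
    calc ‖R t y - R s y‖ = 2 / c * (c / 2 * ‖R t y - R s y‖) := by field_simp
      _ ≤ 2 / c * (E * r ^ j) := by gcongr
      _ ≤ (2 / c * E + 2 * CR / r₀ ^ j) * r ^ j := by
        rw [← mul_assoc]; gcongr; exact le_add_of_nonneg_right (by positivity)
  · calc ‖R t y - R s y‖ ≤ 2 * CR := by
          rw [two_mul]; exact norm_sub_le_of_le (hCR' t y hy) (hCR' s y hy)
      _ = 2 * CR / r₀ ^ j * r₀ ^ j := by field_simp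
      _ ≤ (2 / c * E + 2 * CR / r₀ ^ j) * r ^ j := by
        gcongr; exact le_add_of_nonneg_left (by positivity)

/-- The gap O(r^j) between the graphs of `R t` and `R s` is multiplied by the factor r^k coming from
flatness. The low order j of R is thus compensated and the composite keeps the order j + k of F. -/
theorem IsWhitney.comp_implicit {j k : ℕ} {Λ : ℝ} {F : T → (Fin (n + 1) → K) → K}
    (h : IsWhitney (j + k) u F) (hF : IsFlat k u F)
    (hu : ∀ t, ‖u t‖ ≤ B) (hΛ₀ : 0 ≤ Λ)
    (hΛ : ∀ s t, ‖u s i - u t i‖ ≤ Λ * ‖i.removeNth (u s) - i.removeNth (u t)‖)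
    (hR : PolyFamily R) (hRu : ∀ t, R t (i.removeNth (u t)) = u t i)
    (hRW : IsWhitney j (fun t => i.removeNth (u t)) R) :
    IsWhitney (j + k) (fun t => i.removeNth (u t)) fun t y => F t (i.insertNth (R t y) y) := by
  intro ρ
  obtain ⟨κ, N, hκ, hN, hg⟩ := hR.exists_graph_bound (i := i) hu hRu ρ
  obtain ⟨CR, hCR, hCR'⟩ := hRW ρ
  obtain ⟨CW, hCW, hCW'⟩ := h N
  obtain ⟨CF, hCF, hCF'⟩ := hF N
  set κ' := κ + Λ + 1 with hκ'
  have hκ'₀ : 0 < κ' := by positivity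
  refine ⟨CF * (2 * κ') ^ k * CR + CW * (2 * κ') ^ (j + k), by positivity, fun s t y hy => ?_⟩
  set r := ‖y - i.removeNth (u t)‖ + ‖y - i.removeNth (u s)‖ with hr
  have hr' : 0 ≤ r := by positivity
  obtain ⟨s₁, s₂, s₃⟩ := hg s y hy
  obtain ⟨t₁, t₂, t₃⟩ := hg t y hy
  have w₁ : ‖(i.insertNth (R s y) y : Fin (n + 1) → K) - u t‖ ≤ κ' * r :=
    norm_insertNth_sub_le_of_lipschitz hκ hΛ₀ (hΛ s t) s₂
  have w₂ : ‖(i.insertNth (R s y) y : Fin (n + 1) → K) - u s‖ ≤ κ' * r := by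
    refine s₃.trans ?_
    gcongr
    · linarith
    · exact le_add_of_nonneg_left (norm_nonneg _)
  have w₃ : ‖(i.insertNth (R t y) y : Fin (n + 1) → K) - u t‖ ≤ κ' * r := by
    refine t₃.trans ?_
    gcongr
    · linarith
    · exact le_add_of_nonneg_right (norm_nonneg _)
  have v₁ : ‖(i.insertNth (R t y) y : Fin (n + 1) → K) - i.insertNth (R s y) y‖ ≤ CR * r ^ j := by
    refine (norm_insertNth_sub_le i _ _ _).trans ?_
    simpa using hCR' s t y hy
  calc ‖F t (i.insertNth (R t y) y) - F s (i.insertNth (R s y) y)‖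
      = ‖(F t (i.insertNth (R t y) y) - F t (i.insertNth (R s y) y))
        + (F t (i.insertNth (R s y) y) - F s (i.insertNth (R s y) y))‖ := by abel_nf
    _ ≤ CF * (κ' * r + κ' * r) ^ k * (CR * r ^ j) + CW * (κ' * r + κ' * r) ^ (j + k) :=
        norm_add_le_of_le ((hCF' t _ _ t₁ s₁).trans (by gcongr))
          ((hCW' s t _ s₁).trans (by gcongr))
    _ = _ := by
        rw [show κ' * r + κ' * r = 2 * κ' * r by ring, mul_pow (2 * κ'), mul_pow (2 * κ'),
          pow_add r]
        ring

end Implicit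

/-! ### Haar measure of balls and images of Hölder maps. -/

section Scaling

variable {K : Type*} [NontriviallyNormedField K] [ProperSpace K] [MeasurableSpace K] [BorelSpace K]
  (μ : Measure K) [μ.IsAddHaarMeasure]

/-- The image of μ under multiplication by c⁻¹ is again a Haar measure, hence a multiple of μ by
uniqueness. -/
theorem exists_measure_closedBall_mul (c : K) (hc : c ≠ 0) :
    ∃ θ : ENNReal, θ ≠ ⊤ ∧
      ∀ r : ℝ, μ (Metric.closedBall 0 (‖c‖ * r)) = θ * μ (Metric.closedBall 0 r) := by
  let e := Homeomorph.mulLeft₀ c⁻¹ (inv_ne_zero hc)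
  have : (μ.map (AddMonoidHom.mulLeft c⁻¹)).IsAddHaarMeasure :=
    Measure.isAddHaarMeasure_map μ (AddMonoidHom.mulLeft c⁻¹) e.continuous e.surjective
      e.isClosedEmbedding.tendsto_cocompact
  refine ⟨(μ.map (AddMonoidHom.mulLeft c⁻¹)).addHaarScalarFactor μ, ENNReal.coe_ne_top,
    fun r => ?_⟩
  have h := congrArg (fun ν : Measure K => ν (Metric.closedBall 0 r))
    (Measure.isAddLeftInvariant_eq_smul (μ.map (AddMonoidHom.mulLeft c⁻¹)) μ)
  simp only [Measure.smul_apply] at h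
  rw [Measure.map_apply (show Measurable (AddMonoidHom.mulLeft c⁻¹) from e.continuous.measurable)
    measurableSet_closedBall] at h
  rw [show Metric.closedBall (0 : K) (‖c‖ * r) =
    AddMonoidHom.mulLeft c⁻¹ ⁻¹' Metric.closedBall 0 r from ?_, h]
  · rfl
  · ext x
    simp [inv_mul_le_iff₀ (norm_pos_iff.2 hc)]

/-- The measure of a ball decreases geometrically with its radius. -/
theorem exists_measure_closedBall_pow :
    ∃ (η : ℝ) (θ : ENNReal), 0 < η ∧ η < 1 ∧ θ ≠ 0 ∧ θ < 1 ∧ ∀ (N : ℕ) (r : ℝ),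
      μ (Metric.closedBall 0 (η ^ N * r)) = θ ^ N * μ (Metric.closedBall 0 r) := by
  obtain ⟨x, hx₀, hx₁⟩ := NormedField.exists_norm_lt K (show (0 : ℝ) < 1 / 2 by norm_num)
  have hx : x ≠ 0 := norm_pos_iff.1 hx₀
  obtain ⟨θ, hθ, h⟩ := exists_measure_closedBall_mul μ (x ^ 2) (pow_ne_zero 2 hx)
  rw [norm_pow] at h
  have hη₁ : ‖x‖ ^ 2 < 1 := by nlinarith
  have h1 := h 1
  rw [mul_one] at h1
  have hV : μ (Metric.closedBall 0 1) ≠ 0 :=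
    (Metric.measure_closedBall_pos μ 0 one_pos).ne'
  have hV' : μ (Metric.closedBall 0 1) ≠ ⊤ := (isCompact_closedBall 0 1).measure_lt_top.ne
  refine ⟨‖x‖ ^ 2, θ, by positivity, hη₁, ?_, ?_, fun N r => ?_⟩
  · rintro rfl
    rw [zero_mul] at h1
    exact (Metric.measure_closedBall_pos μ 0 (show 0 < ‖x‖ ^ 2 by positivity)).ne' h1
  -- Two disjoint translates of the ball of radius ‖x‖² fit into the unit ball because ‖x‖ < 1/2.
  -- Hence 2θ ≤ 1.
  · have hd : Disjoint (Metric.closedBall (0 : K) (‖x‖ ^ 2)) (Metric.closedBall x (‖x‖ ^ 2)) :=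
      Metric.closedBall_disjoint_closedBall (by rw [dist_zero_left]; nlinarith)
    have hsub : Metric.closedBall (0 : K) (‖x‖ ^ 2) ∪ Metric.closedBall x (‖x‖ ^ 2) ⊆
        Metric.closedBall 0 1 := by
      refine union_subset (Metric.closedBall_subset_closedBall hη₁.le)
        (Metric.closedBall_subset_closedBall' ?_)
      rw [dist_zero_right]; nlinarith
    have hle := measure_mono (μ := μ) hsub
    rw [measure_union hd measurableSet_closedBall, Measure.addHaar_closedBall_center μ x, h1,
      ← two_mul, ← mul_assoc] at hle
    have h2 : 2 * θ ≤ 1 := by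
      have : 2 * θ * μ (Metric.closedBall 0 1) ≤ 1 * μ (Metric.closedBall 0 1) := by
        rwa [one_mul]
      exact (ENNReal.mul_le_mul_iff_left hV hV').1 this
    by_contra hcon
    have : (2 : ENNReal) * 1 ≤ 1 := (mul_le_mul_right (not_lt.1 hcon) 2).trans h2
    norm_num at this
  · induction N with
    | zero => simp
    | succ N ih => rw [pow_succ' (‖x‖ ^ 2), pow_succ' θ, mul_assoc, mul_assoc, h, ih]

variable {T : Type*} {n b : ℕ}

theorem pi_measure_closedBall (x : Fin n → K) {r : ℝ} (hr : 0 ≤ r) :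
    (Measure.pi fun _ : Fin n => μ) (Metric.closedBall x r) = μ (Metric.closedBall 0 r) ^ n := by
  rw [Measure.pi_closedBall _ _ hr]
  simp [Measure.addHaar_closedBall_center μ]

/-- A set which is the image of a subset of `K^n` under a map to `K^b` that is Hölder of exponent
`l > n / b` is a null set. -/
theorem measure_range_eq_zero_of_holder {l : ℕ} (hl : n < l * b) (u : T → Fin n → K)
    (f : T → Fin b → K) {B C : ℝ} (hC : 0 ≤ C) (hu : ∀ t, ‖u t‖ ≤ B)
    (hf : ∀ s t, ‖f s - f t‖ ≤ C * ‖u s - u t‖ ^ l) (hm : MeasurableSet (range f)) :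
    (Measure.pi fun _ : Fin b => μ) (range f) = 0 := by
  obtain ⟨η, θ, hη₀, hη₁, hθ₀, hθ₁, h⟩ := exists_measure_closedBall_pow μ
  have hθt : θ ≠ ⊤ := (hθ₁.trans ENNReal.one_lt_top).ne
  set lam := Measure.pi fun _ : Fin n => μ with hlam
  set ν := Measure.pi fun _ : Fin b => μ with hν
  set V := μ (Metric.closedBall 0 1)
  have hV : V ≠ 0 := (Metric.measure_closedBall_pos μ 0 one_pos).ne'
  have hV' : V ≠ ⊤ := (isCompact_closedBall 0 1).measure_lt_top.ne
  set D := 1 + C * 2 ^ l with hD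
  set W := μ (Metric.closedBall 0 D) ^ b * lam (Metric.closedBall 0 (B + 1)) with hW
  have hWt : W ≠ ⊤ := ENNReal.mul_ne_top
    (ENNReal.pow_ne_top (isCompact_closedBall 0 _).measure_lt_top.ne)
    (isCompact_closedBall 0 _).measure_lt_top.ne
  have key : ∀ N : ℕ, ν (range f) * (θ * V) ^ n ≤ θ ^ N * W := by
    intro N
    set r := η ^ N with hr
    have hr₀ : 0 < r := pow_pos hη₀ N
    have hr₁ : r ≤ 1 := pow_le_one₀ hη₀.le hη₁.le
    -- The measure of this neighbourhood of the correspondence u t ↦ f t is computed in two orders.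
    -- By the Hölder bound a slice over x lies in a ball of radius D r^l, while a slice over a value
    -- f t contains a ball of radius comparable to r. No covering argument is needed.
    set A : Set ((Fin n → K) × (Fin b → K)) :=
      ⋃ t, Metric.ball (u t) r ×ˢ Metric.ball (f t) (r ^ l) with hA
    have hAo : IsOpen A := isOpen_iUnion fun t => Metric.isOpen_ball.prod Metric.isOpen_ball
    have upper : (lam.prod ν) A ≤
        (θ ^ (N * l) * μ (Metric.closedBall 0 D)) ^ b * lam (Metric.closedBall 0 (B + 1)) := by
      rw [Measure.prod_apply hAo.measurableSet]
      calc ∫⁻ x, ν (Prod.mk x ⁻¹' A) ∂lam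
          ≤ ∫⁻ x, (Metric.closedBall 0 (B + 1)).indicator
              (fun _ => (θ ^ (N * l) * μ (Metric.closedBall 0 D)) ^ b) x ∂lam := by
            refine lintegral_mono fun x => ?_
            rcases (Prod.mk x ⁻¹' A).eq_empty_or_nonempty with he | ⟨y₀, hy₀⟩
            · simp [he]
            obtain ⟨t₀, hx₀, -⟩ := mem_iUnion.1 hy₀
            have hxB : x ∈ Metric.closedBall 0 (B + 1) := by
              have h₁ := mem_ball_iff_norm.1 hx₀
              have h₂ : ‖x‖ ≤ ‖x - u t₀‖ + ‖u t₀‖ := by simpa using norm_add_le (x - u t₀) (u t₀)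
              have h₃ := hu t₀
              rw [mem_closedBall_zero_iff]; linarith
            rw [indicator_of_mem hxB, ← h, ← pi_measure_closedBall μ (f t₀) (by positivity)]
            refine measure_mono fun y hy => ?_
            obtain ⟨t, hx, hy⟩ := mem_iUnion.1 hy
            have h₁ := mem_ball_iff_norm.1 hx₀
            have h₂ := mem_ball_iff_norm.1 hx
            have h₃ := mem_ball_iff_norm.1 hy
            have h₄ : ‖u t - u t₀‖ ≤ 2 * r := by
              calc ‖u t - u t₀‖ = ‖(x - u t₀) - (x - u t)‖ := by abel_nf
                _ ≤ ‖x - u t₀‖ + ‖x - u t‖ := norm_sub_le _ _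
                _ ≤ 2 * r := by linarith
            rw [mem_closedBall_iff_norm]
            calc ‖y - f t₀‖ = ‖(y - f t) + (f t - f t₀)‖ := by abel_nf
              _ ≤ r ^ l + C * (2 * r) ^ l := norm_add_le_of_le h₃.le ((hf t t₀).trans (by gcongr))
              _ = η ^ (N * l) * D := by rw [mul_pow, hr, ← pow_mul, hD]; ring
        _ = _ := by
            rw [lintegral_indicator_const measurableSet_closedBall]
    -- The exponent N + 1 puts a closed ball of radius η^(N+1) inside the open ball of radius r =
    -- η^N.
    have lower : ν (range f) * (θ ^ (N + 1) * V) ^ n ≤ (lam.prod ν) A := by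
      rw [Measure.prod_apply_symm hAo.measurableSet, mul_comm, ← setLIntegral_const]
      refine (setLIntegral_mono' hm ?_).trans (setLIntegral_le_lintegral _ _)
      rintro _ ⟨t, rfl⟩
      rw [← h, ← pi_measure_closedBall μ (u t) (by positivity)]
      refine measure_mono fun x hx => mem_iUnion.2 ⟨t, ?_, Metric.mem_ball_self (pow_pos hr₀ l)⟩
      rw [mem_closedBall_iff_norm, mul_one] at hx
      exact mem_ball_iff_norm.2 (hx.trans_lt (pow_lt_pow_right_of_lt_one₀ hη₀ hη₁ N.lt_succ_self))
    -- The two bounds compare θ^(N n) with θ^(N l b); the excess of at least N factors θ tends to 0.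
    obtain ⟨k, hk⟩ : ∃ k, l * b = n + (k + 1) := ⟨l * b - n - 1, by omega⟩
    have hθN₀ : θ ^ (N * n) ≠ 0 := pow_ne_zero _ hθ₀
    have hθNt : θ ^ (N * n) ≠ ⊤ := ENNReal.pow_ne_top hθt
    refine (ENNReal.mul_le_mul_iff_right hθN₀ hθNt).1 ?_
    calc θ ^ (N * n) * (ν (range f) * (θ * V) ^ n) = ν (range f) * (θ ^ (N + 1) * V) ^ n := by
          rw [pow_succ, mul_assoc (θ ^ N), mul_pow (θ ^ N), ← pow_mul]; ring
      _ ≤ _ := lower.trans upper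
      _ = θ ^ (N * n) * (θ ^ (N * (k + 1)) * W) := by
          rw [mul_pow, ← pow_mul, mul_assoc N, hk, mul_add, pow_add, hW]; ring
      _ ≤ θ ^ (N * n) * (θ ^ N * W) := by
          gcongr θ ^ (N * n) * (?_ * W)
          exact pow_le_pow_of_le_one zero_le hθ₁.le (Nat.le_mul_of_pos_right _ k.succ_pos)
  have hlim : Filter.Tendsto (fun N : ℕ => θ ^ N * W) Filter.atTop (nhds (0 * W)) :=
    ENNReal.Tendsto.mul_const (ENNReal.tendsto_pow_atTop_nhds_zero_of_lt_one hθ₁) (Or.inr hWt)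
  have h0 := ge_of_tendsto' hlim key
  rw [zero_mul, nonpos_iff_eq_zero, mul_eq_zero] at h0
  exact h0.resolve_right (pow_ne_zero _ (mul_ne_zero hθ₀ hV))

end Scaling

/-! ### Sard's theorem for Whitney fields. -/

section Sard

theorem measure_range_eq_zero_of_cover {T Y ι : Type*} [Countable ι] [MeasurableSpace Y]
    (ν : Measure Y) (f : T → Y) (S : ι → Set T) (hS : ∀ t, ∃ k, t ∈ S k)
    (h : ∀ k, ν (range fun t : S k => f t) = 0) : ν (range f) = 0 := by
  refine measure_mono_null ?_ (measure_iUnion_null h)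
  rintro _ ⟨t, rfl⟩
  obtain ⟨k, hk⟩ := hS t
  exact mem_iUnion.2 ⟨k, ⟨t, hk⟩, rfl⟩

universe w

variable {K : Type*} [NontriviallyNormedField K] {T : Type w} {n b : ℕ}

/-- Some nontrivial linear combination of the functions `F j t` has a critical point at `u t`. -/
def IsCritical (u : T → Fin n → K) (F : Fin b → T → (Fin n → K) → K) (t : T) : Prop :=
  ∃ v : Fin b → K, v ≠ 0 ∧ ∀ R : ℝ, ∃ C, 0 ≤ C ∧ ∀ z, ‖z‖ ≤ R →
    ‖∑ j, v j * (F j t z - F j t (u t))‖ ≤ C * ‖z - u t‖ ^ 2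

theorem exists_norm_le_of_continuous [TopologicalSpace T] [CompactSpace T] {u : T → Fin n → K}
    (hu : Continuous u) : ∃ B, ∀ t, ‖u t‖ ≤ B := by
  obtain ⟨B, hB⟩ := (isCompact_range hu).isBounded.exists_norm_le
  exact ⟨B, fun t => hB _ (mem_range_self t)⟩

theorem PolyFamily.pd_eq_zero {P : T → (Fin n → K) → K} (hP : PolyFamily P) (t : T)
    (a : Fin n → K) (h : ∀ R : ℝ, ∃ C, 0 ≤ C ∧ ∀ z, ‖z‖ ≤ R → ‖P t z - P t a‖ ≤ C * ‖z - a‖ ^ 2)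
    (i : Fin n) : NASard.pd i P t a = 0 := by
  obtain ⟨C, hC, h⟩ := h (‖a‖ + 1)
  have h₁ : (fun τ => P t (Function.update a i τ) - P t a) =O[nhds (a i)]
      fun τ => ‖τ - a i‖ ^ 2 := by
    refine Asymptotics.IsBigO.of_bound C ?_
    filter_upwards [Metric.ball_mem_nhds (a i) one_pos] with τ hτ
    have h₂ := norm_update_sub_le a a i τ
    have h₃ := norm_update_sub_le a 0 i τ
    rw [sub_self, norm_zero, zero_add] at h₂
    rw [sub_zero, sub_zero] at h₃
    have h₄ := mem_ball_iff_norm.1 hτ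
    refine (h _ (by linarith)).trans ?_
    rw [norm_pow, norm_norm]
    gcongr
  have h₂ := (Asymptotics.IsBigO.hasFDerivAt (𝕜 := K) h₁ one_lt_two).hasDerivAt
  have h₃ := (hP.hasDerivAt_self i t a).sub_const (P t a)
  simpa using h₃.unique h₂

variable [MeasurableSpace K] (μ : Measure K)

/-- Sard's theorem for Whitney jets of order `l` in `n` variables. -/
def SardAt (l n : ℕ) : Prop :=
  ∀ (b : ℕ) (T : Type w) [TopologicalSpace T] [CompactSpace T] (u : T → Fin n → K)
    (F : Fin b → T → (Fin n → K) → K), Continuous u → (∀ j, PolyFamily (F j)) →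
    (∀ j, IsWhitney l u (F j)) → (∀ t, IsCritical u F t) →
    (Measure.pi fun _ : Fin b => μ) (range fun t j => F j t (u t)) = 0

variable [TopologicalSpace T] [CompactSpace T]

/-- The reduction of the number of variables by means of an equation `g = 0`. -/
theorem SardAt.of_equation {j k : ℕ} (hS : SardAt.{w} μ (j + 2 + k) n) {u : T → Fin (n + 1) → K}
    {F : Fin b → T → (Fin (n + 1) → K) → K} {g : T → (Fin (n + 1) → K) → K} (hu : Continuous u)
    (hF : ∀ j, PolyFamily (F j)) (hFW : ∀ i, IsWhitney (j + 2 + k) u (F i))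
    (hFk : ∀ i, IsFlat k u (F i)) (hg : PolyFamily g) (hgW : IsWhitney (j + 2) u g)
    (hg0 : ∀ t, g t (u t) = 0) {c : ℝ} (hc : 0 < c) {i : Fin (n + 1)}
    (hpd : ∀ t, c ≤ ‖pd i g t (u t)‖)
    (hcrit : ∀ t, ∃ v : Fin b → K, v ≠ 0 ∧ ∃ v₀ : K, ∀ R : ℝ, ∃ C, 0 ≤ C ∧ ∀ z, ‖z‖ ≤ R →
      ‖∑ j, v j * (F j t z - F j t (u t)) + v₀ * g t z‖ ≤ C * ‖z - u t‖ ^ 2) :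
    (Measure.pi fun _ : Fin b => μ) (range fun t j => F j t (u t)) = 0 := by
  obtain ⟨B, hB⟩ := exists_norm_le_of_continuous hu
  obtain ⟨δ, hδ, Λ, hΛ₀, hΛ⟩ := hgW.exists_lipschitz hg hB hg0 hc hpd
  -- The approximation order j + 1 gives an error of exponent j + 2, the order of the field g.
  obtain ⟨R, hR, hRu, hRP⟩ := hg.exists_implicit hB hg0 hc hpd (j + 1)
  have hnhds : ∀ t, u ⁻¹' Metric.closedBall (u t) (δ / 2) ∈ nhds t := fun t =>
    hu.continuousAt (Metric.closedBall_mem_nhds _ (by positivity))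
  obtain ⟨s, hs⟩ := CompactSpace.elim_nhds_subcover _ hnhds
  -- The Lipschitz bound holds only for base points at distance at most δ, so the parameters are
  -- divided into finitely many closed pieces on which it holds for all pairs.
  refine measure_range_eq_zero_of_cover _ _
    (fun t : s => u ⁻¹' Metric.closedBall (u t) (δ / 2)) (fun t => ?_) fun t₀ => ?_
  · have : t ∈ (⊤ : Set T) := trivial
    rw [← hs] at this
    obtain ⟨t', ht', h⟩ := mem_iUnion₂.1 this
    exact ⟨⟨t', ht'⟩, h⟩
  set S : Set T := u ⁻¹' Metric.closedBall (u t₀) (δ / 2) with hSdef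
  have hSc : CompactSpace S :=
    isCompact_iff_compactSpace.1 ((Metric.isClosed_closedBall.preimage hu).isCompact)
  have hΛS : ∀ s t : S, ‖u s i - u t i‖ ≤ Λ * ‖i.removeNth (u s) - i.removeNth (u t)‖ := by
    intro s t
    refine hΛ s t ?_
    have h₁ := mem_closedBall_iff_norm.1 s.2
    have h₂ := mem_closedBall_iff_norm.1 t.2
    calc ‖u s - u t‖ = ‖(u s - u t₀) - (u t - u t₀)‖ := by abel_nf
      _ ≤ δ / 2 + δ / 2 := norm_sub_le_of_le h₁ h₂
      _ = δ := by ring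
  have hR' : PolyFamily fun t : S => R t := hR.comp_index Subtype.val
  have hu' : Continuous fun t : S => i.removeNth (u t) := by
    refine continuous_pi fun j => ?_
    exact (continuous_apply (i.succAbove j)).comp (hu.comp continuous_subtype_val)
  have hRW : IsWhitney (j + 2) (fun t : S => i.removeNth (u t)) fun t : S => R t :=
    (hgW.comp_index (Subtype.val : S → T)).implicit (hg.comp_index _) (fun t => hB t) hc
      (fun t => hpd t) hΛ₀ hΛS hR' (fun t => hRu t) fun ρ => by
        obtain ⟨C, hC, h⟩ := hRP ρ
        exact ⟨C, hC, fun t => h t⟩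
  have key := hS b S (fun t => i.removeNth (u t)) (fun j t y => F j t (i.insertNth (R t y) y)) hu'
    (fun j => ((hF j).comp_index (Subtype.val : S → T)).insertNth hR' i)
    (fun j => ((hFW j).comp_index (Subtype.val : S → T)).comp_implicit
      ((hFk j).comp_index _) (fun t => hB t) hΛ₀ hΛS hR' (fun t => hRu t) hRW) ?_
  · simpa only [hRu, Fin.insertNth_self_removeNth] using key
  intro t
  obtain ⟨v, hv, v₀, hv₀⟩ := hcrit t
  refine ⟨v, hv, fun ρ => ?_⟩
  obtain ⟨κ, N, hκ, hN, hgr⟩ := hR.exists_graph_bound (i := i) hB hRu ρ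
  obtain ⟨C, hC, hC'⟩ := hv₀ N
  obtain ⟨A, hA, hA'⟩ := hRP ρ
  refine ⟨C * κ ^ 2 + ‖v₀‖ * (A * (|ρ| + |B|) ^ j), by positivity, fun y hy => ?_⟩
  obtain ⟨g₁, -, g₂⟩ := hgr t y hy
  have h₁ := hC' _ g₁
  have h₂ := hA' t y hy
  simp only [hRu, Fin.insertNth_self_removeNth]
  set r := ‖y - i.removeNth (u t)‖ with hr
  have hr₁ : r ≤ |ρ| + |B| := norm_sub_le_of_le (hy.trans (le_abs_self _))
    ((norm_removeNth_le i _).trans ((hB t).trans (le_abs_self _)))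
  have hr₀ : 0 ≤ r := norm_nonneg _
  set z : Fin (n + 1) → K := i.insertNth (R t y) y
  -- On the graph of `R t` the function g is O(r^(j+2)), so the Lagrange multiplier term is
  -- quadratically small and the substituted functions are critical with the same v.
  calc ‖∑ j, v j * (F j t z - F j t (u t))‖
      = ‖(∑ j, v j * (F j t z - F j t (u t)) + v₀ * g t z) - v₀ * g t z‖ := by rw [add_sub_cancel_right]
    _ ≤ C * (κ * r) ^ 2 + ‖v₀‖ * (A * ((|ρ| + |B|) ^ j * r ^ 2)) := by
        refine norm_sub_le_of_le (h₁.trans (by gcongr)) (norm_mul_le_of_le le_rfl (h₂.trans ?_))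
        rw [add_assoc, one_add_one_eq_two, pow_add]
        gcongr
    _ = _ := by ring

variable [ProperSpace K] [BorelSpace K] [μ.IsAddHaarMeasure]

/-- The reduction of the number of variables by means of the equations `F j₀ = const`. -/
theorem SardAt.of_pd_ne_zero {l : ℕ} (hS : SardAt.{w} μ (l + 2) n) {u : T → Fin (n + 1) → K}
    {F : Fin b → T → (Fin (n + 1) → K) → K} (hu : Continuous u)
    (hF : ∀ j, PolyFamily (F j)) (hFW : ∀ i, IsWhitney (l + 2) u (F i)) {c : ℝ} (hc : 0 < c)
    {i : Fin (n + 1)} {j₀ : Fin b} (hpd : ∀ t, c ≤ ‖pd i (F j₀) t (u t)‖)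
    (hcrit : ∀ t, IsCritical u F t) :
    (Measure.pi fun _ : Fin b => μ) (range fun t j => F j t (u t)) = 0 := by
  obtain ⟨B, hB⟩ := exists_norm_le_of_continuous hu
  have hcont : ∀ j, Continuous fun t => F j t (u t) := fun j =>
    (hFW j).continuous (hF j) hB hu
  obtain _ | b := b
  · exact j₀.elim0
  set A := range fun t j => F j t (u t) with hA
  have hAm : MeasurableSet A :=
    (isCompact_range (continuous_pi hcont)).isClosed.measurableSet
  let e := MeasurableEquiv.piFinSuccAbove (fun _ : Fin (b + 1) => K) j₀
  have hpres := measurePreserving_piFinSuccAbove (fun _ : Fin (b + 1) => μ) j₀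
  have hAe : A = e ⁻¹' (e.symm ⁻¹' A) := by
    rw [← preimage_comp, e.symm_comp_self, preimage_id]
  have hAm' : MeasurableSet (e.symm ⁻¹' A) := e.symm.measurable hAm
  -- Fubini: it suffices that every slice, with the j₀-th value fixed to x, is null. On it `F j₀ =
  -- x` is an equation, and the remaining values are those of a field with one component fewer.
  rw [hAe, hpres.measure_preimage hAm'.nullMeasurableSet, Measure.measure_prod_null hAm']
  refine Filter.Eventually.of_forall fun x => ?_
  let S : Set T := {t | F j₀ t (u t) = x}
  have hSc : CompactSpace S := isCompact_iff_compactSpace.1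
    (isClosed_eq (hcont j₀) continuous_const).isCompact
  have he : ∀ y, e.symm (x, y) = j₀.insertNth x y := fun _ => rfl
  refine measure_mono_null (t := range fun (t : S) j => F (j₀.succAbove j) t (u t)) ?_ ?_
  · rintro y ⟨t, ht⟩
    rw [he] at ht
    have h₁ : F j₀ t (u t) = x := by
      have := congrFun ht j₀
      simpa using this
    refine ⟨⟨t, h₁⟩, funext fun j => ?_⟩
    have := congrFun ht (j₀.succAbove j)
    simpa using this
  have hpd' : ∀ t : S, pd i (fun (t : S) z => F j₀ t z - x) t (u t) = pd i (F j₀) t (u t) :=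
    fun t => by simp [pd]
  refine SardAt.of_equation (j := l) (k := 0) μ hS (u := fun t : S => u t)
    (F := fun j (t : S) => F (j₀.succAbove j) t) (g := fun t z => F j₀ t z - x)
    (hu.comp continuous_subtype_val)
    (fun j => (hF _).comp_index _) (fun j => (hFW _).comp_index _)
    (fun j => ((hF _).comp_index (Subtype.val : S → T)).isFlat_zero)
    (((hF j₀).comp_index _).sub (.const x)) ?_ (fun t => sub_eq_zero.2 t.2) hc
    (fun t => (hpd t).trans_eq (by rw [hpd'])) fun t => ?_
  · intro R
    obtain ⟨C, hC, h⟩ := hFW j₀ R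
    exact ⟨C, hC, fun s t z hz => by simpa using h s t z hz⟩
  · obtain ⟨v, hv, h⟩ := hcrit t
    -- The j₀-th entry of v becomes the multiplier. If the other entries all vanished, `F j₀` itself
    -- would be critical, against the lower bound for its derivative.
    refine ⟨fun j => v (j₀.succAbove j), fun hv0 => ?_, v j₀, fun R => ?_⟩
    · have hv₀ : v j₀ ≠ 0 := fun h0 => hv <| funext fun j => by
        induction j using j₀.succAboveCases with
        | x => exact h0
        | p j => exact congrFun hv0 j
      have h0 : pd i (F j₀) t (u t) = 0 := by
        refine (hF j₀).pd_eq_zero _ _ (fun R => ?_) i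
        obtain ⟨C, hC, h⟩ := h R
        refine ⟨‖v j₀‖⁻¹ * C, by positivity, fun z hz => ?_⟩
        have h₁ := h z hz
        rw [Fin.sum_univ_succAbove _ j₀] at h₁
        simp only [show ∀ j, v (j₀.succAbove j) = 0 from congrFun hv0, zero_mul,
          Finset.sum_const_zero, add_zero, norm_mul] at h₁
        rw [mul_assoc]
        exact (le_inv_mul_iff₀ (norm_pos_iff.2 hv₀)).2 h₁
      have := hpd t
      rw [h0, norm_zero] at this
      exact absurd this (not_le.2 hc)
    · obtain ⟨C, hC, h⟩ := h R
      refine ⟨C, hC, fun z hz => ?_⟩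
      have h₁ := h z hz
      rw [Fin.sum_univ_succAbove _ j₀, add_comm, show F j₀ t (u t) = x from t.2] at h₁
      exact h₁

/-- Here k counts the orders of derivatives known to vanish at all base points, and d = l - 1 - k is
the number of orders left. Induction on d serves the stratum where the next order vanishes too; the
other strata reduce to fewer variables. -/
theorem sardAt_step [CharZero K] {l : ℕ} (hn : n < l)
    (ih : ∀ m, n = m + 1 → SardAt.{w} μ l m) : SardAt.{w} μ l n := by
  suffices H : ∀ d k, k + d + 1 = l → ∀ (b : ℕ) (T : Type w) [TopologicalSpace T] [CompactSpace T]
      (u : T → Fin n → K) (F : Fin b → T → (Fin n → K) → K), Continuous u →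
      (∀ j, PolyFamily (F j)) → (∀ j, IsWhitney l u (F j)) → (∀ t, IsCritical u F t) →
      (∀ j t, ∀ L : List (Fin n), 1 ≤ L.length → L.length ≤ k → pdL L (F j) t (u t) = 0) →
      (Measure.pi fun _ : Fin b => μ) (range fun t j => F j t (u t)) = 0 by
    intro b T _ _ u F hu hF hFW hcrit
    exact H (l - 1) 0 (by omega) b T u F hu hF hFW hcrit fun j t L h₁ h₂ => by omega
  intro d
  induction d with
  | zero =>
    intro k hk b T _ _ u F hu hF hFW hcrit hvan
    obtain ⟨B, hB⟩ := exists_norm_le_of_continuous hu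
    obtain hT | ⟨⟨t₀⟩⟩ := isEmpty_or_nonempty T
    · rw [range_eq_empty, measure_empty]
    have hb : 0 < b := by
      obtain ⟨v, hv, -⟩ := hcrit t₀
      obtain ⟨j, -⟩ := Function.ne_iff.1 hv
      exact j.pos
    have hflat : ∀ j, IsFlat k u (F j) := fun j => (hF j).isFlat hB (hvan j)
    choose C hC hC' using fun j => hflat j B
    choose D hD hD' using fun j => hFW j B
    obtain ⟨m, rfl⟩ : ∃ m, l = m + 1 := ⟨l - 1, by omega⟩
    have hcont : ∀ j, Continuous fun t => F j t (u t) := fun j => (hFW j).continuous (hF j) hB hu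
    -- Flatness of order l - 1 bounds increments by the distance to the power (l - 1) + 1 = l. A
    -- critical point has a nonzero v, so b ≥ 1 and n < l ≤ l b.
    refine measure_range_eq_zero_of_holder μ (l := m + 1) (hn.trans_le (Nat.le_mul_of_pos_right _ hb))
      u _ (B := B) (C := ∑ j, (C j + D j)) (Finset.sum_nonneg fun j _ => add_nonneg (hC j) (hD j))
      hB (fun s t => ?_) (isCompact_range (continuous_pi hcont)).isClosed.measurableSet
    refine (pi_norm_le_iff_of_nonneg (mul_nonneg (Finset.sum_nonneg fun j _ =>
      add_nonneg (hC j) (hD j)) (by positivity))).2 fun j => ?_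
    have h₁ := hC' j s (u s) (u t) (hB s) (hB t)
    have h₂ := hD' j t s (u t) (hB t)
    rw [sub_self, norm_zero, zero_add, norm_sub_rev (u t), mul_assoc, ← pow_succ,
      show k + 1 = m + 1 by omega] at h₁
    rw [sub_self, norm_zero, add_zero, norm_sub_rev (u t)] at h₂
    calc ‖F j s (u s) - F j t (u t)‖
        = ‖(F j s (u s) - F j s (u t)) + (F j s (u t) - F j t (u t))‖ := by abel_nf
      _ ≤ _ := norm_add_le_of_le h₁ h₂
      _ = (C j + D j) * ‖u s - u t‖ ^ (m + 1) := by ring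
      _ ≤ _ := by
          gcongr
          exact Finset.single_le_sum (f := fun j => C j + D j)
            (fun j _ => add_nonneg (hC j) (hD j)) (Finset.mem_univ j)
  | succ d ihd =>
    intro k hk b T _ _ u F hu hF hFW hcrit hvan
    obtain ⟨B, hB⟩ := exists_norm_le_of_continuous hu
    have hcont : ∀ j L, L.length = k + 1 → Continuous fun t => pdL L (F j) t (u t) := by
      intro j L hL
      refine IsWhitney.continuous (l := d) (IsWhitney.pdL L ?_ (hF j) hB) ((hF j).pdL L) hB hu
      rw [hL, show d + 1 + (k + 1) = l by omega]
      exact hFW j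
    let Z : Set T := {t | ∀ j L, L.length = k + 1 → pdL L (F j) t (u t) = 0}
    -- The lower bounds 1/(N+1) exhaust the complement of Z by countably many compact sets, each
    -- with one fixed nonvanishing derivative.
    let S : Fin b × List (Fin n) × Fin n × ℕ → Set T := fun a =>
      {t | a.2.1.length = k ∧ 1 / ((a.2.2.2 : ℝ) + 1) ≤
        ‖pdL (a.2.1 ++ [a.2.2.1]) (F a.1) t (u t)‖}
    refine measure_range_eq_zero_of_cover _ _ (fun o : Option _ => o.elim Z S) (fun t => ?_) ?_
    · by_cases ht : t ∈ Z
      · exact ⟨none, ht⟩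
      simp only [Z, mem_ofPred_eq, not_forall] at ht
      obtain ⟨j, L, hL, hne⟩ := ht
      obtain rfl | ⟨L, i, rfl⟩ := L.eq_nil_or_concat'
      · simp at hL
      obtain ⟨N, hN⟩ := exists_nat_one_div_lt (norm_pos_iff.2 hne)
      exact ⟨some (j, L, i, N), by simpa using hL, hN.le⟩
    rintro (_ | ⟨j, L, i, N⟩)
    · have hZ : IsClosed Z := by
        simp only [Z, ofPred_forall]
        exact isClosed_iInter fun j => isClosed_iInter fun L => isClosed_iInter fun hL =>
          isClosed_eq (hcont j L hL) continuous_const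
      have : CompactSpace Z := isCompact_iff_compactSpace.1 hZ.isCompact
      refine ihd (k + 1) (by omega) b Z (fun t => u t) (fun j t => F j t)
        (hu.comp continuous_subtype_val) (fun j => (hF j).comp_index _)
        (fun j => (hFW j).comp_index _) (fun t => hcrit t) fun j t L h₁ h₂ => ?_
      rw [pdL_comp_index]
      rcases h₂.eq_or_lt with h | h
      · exact t.2 j L h
      · exact hvan j t L h₁ (by omega)
    · change (Measure.pi fun _ : Fin b => μ) (range fun (t : S (j, L, i, N)) j => F j t (u t)) = 0
      by_cases hL : L.length = k
      swap
      · have : IsEmpty (S (j, L, i, N)) := ⟨fun t => hL t.2.1⟩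
        rw [range_eq_empty, measure_empty]
      have hSc : IsClosed (S (j, L, i, N)) := by
        simp only [S, ofPred_and]
        refine isClosed_const.inter (isClosed_le continuous_const ?_)
        exact (hcont j _ (by simp [hL])).norm
      have : CompactSpace (S (j, L, i, N)) := isCompact_iff_compactSpace.1 hSc.isCompact
      set S' := S (j, L, i, N) with hS'
      have hc : (0 : ℝ) < 1 / ((N : ℝ) + 1) := by positivity
      have hpd : ∀ t : S', 1 / ((N : ℝ) + 1) ≤ ‖pd i (pdL L (F j)) t (u t)‖ := fun t => by
        rw [← pdL_concat]; exact t.2.2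
      obtain _ | n := n
      · exact i.elim0
      have ih := ih n rfl
      -- For k = 0 the equation is `F j = const`, which is not satisfied on the whole stratum, hence
      -- the detour through slices. For larger k a derivative of order k vanishes there and serves
      -- as g, with multiplier 0.
      obtain _ | k := k
      · obtain rfl : L = [] := List.length_eq_zero_iff.1 hL
        obtain ⟨l, rfl⟩ : ∃ l', l = l' + 2 := ⟨l - 2, by omega⟩
        exact SardAt.of_pd_ne_zero (l := l) μ ih (u := fun t : S' => u t) (F := fun j t => F j t)
          (hu.comp continuous_subtype_val) (fun j => (hF j).comp_index _)
          (fun j => (hFW j).comp_index _) hc (j₀ := j) (i := i) hpd fun t => hcrit t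
      · obtain rfl : l = d + 2 + (k + 1) := by omega
        refine SardAt.of_equation (j := d) (k := k + 1) μ ih (u := fun t : S' => u t)
          (F := fun j t => F j t) (g := fun t => pdL L (F j) t)
          (hu.comp continuous_subtype_val) (fun j => (hF j).comp_index _)
          (fun j => (hFW j).comp_index _)
          (fun j => ((hF j).isFlat hB (hvan j)).comp_index _) (((hF j).pdL L).comp_index _)
          ((IsWhitney.pdL L (by rw [hL]; exact hFW j) (hF j) hB).comp_index _)
          (fun t => hvan j t L (by omega) (by omega)) hc (i := i) hpd fun t => ?_
        obtain ⟨v, hv, h⟩ := hcrit t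
        exact ⟨v, hv, 0, by simpa using h⟩

theorem sardAt [CharZero K] {l : ℕ} (hn : n < l) : SardAt.{w} μ l n := by
  induction n with
  | zero => exact sardAt_step μ hn fun m hm => by omega
  | succ n ih =>
    refine sardAt_step μ hn fun m hm => ?_
    obtain rfl : n = m := by omega
    exact ih (by omega)

end Sard

/-! ### Difference operators in the group algebra, and descent of bounds to lower orders. -/

section Differences

variable {K : Type*} [NontriviallyNormedField K] {E : Type*}
  {Y : Type*} [NormedAddCommGroup Y] [NormedSpace K Y]

/-- The pairing of the formal combination `∑ c_k [k]` with a function `φ`, that is, `∑ c_k φ(k)`. -/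
def pairing (φ : E → Y) : AddMonoidAlgebra K E →ₗ[K] Y :=
  Finsupp.linearCombination K φ ∘ₗ (AddMonoidAlgebra.coeffLinearEquiv K).toLinearMap

@[simp] theorem pairing_single (φ : E → Y) (k : E) (c : K) :
    pairing φ (AddMonoidAlgebra.single k c) = c • φ k := by
  simp [pairing]

theorem pairing_sub (φ ψ : E → Y) (X : AddMonoidAlgebra K E) :
    pairing (fun y => φ y - ψ y) X = pairing φ X - pairing ψ X := by
  induction X using AddMonoidAlgebra.induction_linear with
  | zero => simp
  | add X X' h h' => rw [map_add, map_add, map_add, h, h']; abel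
  | single y c => simp [smul_sub]

theorem pairing_sum {ι : Type*} (s : Finset ι) (φ : ι → E → Y) (X : AddMonoidAlgebra K E) :
    pairing (fun y => ∑ i ∈ s, φ i y) X = ∑ i ∈ s, pairing (φ i) X := by
  induction X using AddMonoidAlgebra.induction_linear with
  | zero => simp
  | add X X' h h' => simp only [map_add, h, h', Finset.sum_add_distrib]
  | single y c => simp [Finset.smul_sum]

theorem pairing_smul_const (φ : E → K) (c : Y) (X : AddMonoidAlgebra K E) :
    pairing (fun y => φ y • c) X = pairing φ X • c := by
  induction X using AddMonoidAlgebra.induction_linear with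
  | zero => simp
  | add X X' h h' => rw [map_add, map_add, h, h', add_smul]
  | single y a => simp [smul_smul]

variable [AddCommGroup E]

@[simp] theorem pairing_one (φ : E → Y) : pairing φ (1 : AddMonoidAlgebra K E) = φ 0 := by
  rw [AddMonoidAlgebra.one_def, pairing_single, one_smul]

theorem pairing_single_mul (φ : E → Y) (k : E) (X : AddMonoidAlgebra K E) :
    pairing φ (AddMonoidAlgebra.single k 1 * X) = pairing (fun y => φ (k + y)) X := by
  induction X using AddMonoidAlgebra.induction_linear with
  | zero => simp
  | add X X' h h' => rw [mul_add, map_add, map_add, h, h']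
  | single y c => simp [AddMonoidAlgebra.single_mul_single]

variable (K) in
/-- The difference operator `[k] - [0]`. -/
def dif (k : E) : AddMonoidAlgebra K E := AddMonoidAlgebra.single k 1 - 1

@[simp] theorem dif_zero : dif K (0 : E) = 0 := by
  simp [dif, AddMonoidAlgebra.one_def]

theorem dif_add (k k' : E) : dif K (k + k') = AddMonoidAlgebra.single k' 1 * dif K k + dif K k' := by
  rw [dif, dif, dif, mul_sub, AddMonoidAlgebra.single_mul_single, mul_one, add_comm k', mul_one]
  abel

/-- The defect of linearity of a difference is a sum of second differences. With N = p this relates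
differences of order v to those of order v + 1. -/
theorem dif_nsmul_sub (N : ℕ) (k : E) :
    dif K (N • k) - (N : AddMonoidAlgebra K E) * dif K k =
      ∑ c ∈ Finset.range N, dif K (c • k) * dif K k := by
  induction N with
  | zero => simp
  | succ N ih =>
    rw [Finset.sum_range_succ, ← ih, succ_nsmul, dif_add]
    have : AddMonoidAlgebra.single k (1 : K) = dif K k + 1 := by simp [dif]
    rw [this]; push_cast; ring

theorem pairing_dif_mul (φ : E → Y) (k : E) (X : AddMonoidAlgebra K E) :
    pairing φ (dif K k * X) = pairing (fun y => φ (k + y) - φ y) X := by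
  rw [dif, sub_mul, one_mul, map_sub, pairing_single_mul, pairing_sub]

theorem pairing_prod_dif {v : ℕ} (φ : E → Y) (k : Fin v → E) :
    pairing φ (∏ i, dif K (k i)) =
      ∑ S : Finset (Fin v), (-1 : K) ^ (v - S.card) • φ (∑ i ∈ S, k i) := by
  have h : ∀ S : Finset (Fin v), ∏ i ∈ S, AddMonoidAlgebra.single (k i) (1 : K) =
      AddMonoidAlgebra.single (∑ i ∈ S, k i) 1 := fun S => by
    induction S using Finset.induction_on with
    | empty => simp [AddMonoidAlgebra.one_def]
    | insert i S hi ih =>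
      rw [Finset.prod_insert hi, ih, AddMonoidAlgebra.single_mul_single, Finset.sum_insert hi,
        one_mul]
  simp only [dif, sub_eq_add_neg]
  rw [Finset.prod_add, Finset.powerset_univ, map_sum]
  refine Finset.sum_congr rfl fun S _ => ?_
  rw [h, Finset.prod_const, Finset.card_sdiff_of_subset (Finset.subset_univ S), Finset.card_univ,
    Fintype.card_fin,
    show (-1 : AddMonoidAlgebra K E) = AddMonoidAlgebra.single 0 (-1) by
      rw [AddMonoidAlgebra.one_def, AddMonoidAlgebra.single_neg],
    AddMonoidAlgebra.single_pow, AddMonoidAlgebra.single_mul_single, pairing_single]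
  simp

/-- The product of the difference operators of the elements of a list. -/
def difs (L : List K) : AddMonoidAlgebra K K := (L.map (dif K)).prod

@[simp] theorem difs_nil : difs ([] : List K) = 1 := rfl

@[simp] theorem difs_cons (ζ : K) (L : List K) : difs (ζ :: L) = dif K ζ * difs L := by
  simp [difs]

@[simp] theorem difs_append (L L' : List K) : difs (L ++ L') = difs L * difs L' := by
  simp [difs]

/-- The product of the norms of the elements of a list. -/
def normProd (L : List K) : ℝ := (L.map norm).prod

@[simp] theorem normProd_nil : normProd ([] : List K) = 1 := rfl

@[simp] theorem normProd_cons (ζ : K) (L : List K) : normProd (ζ :: L) = ‖ζ‖ * normProd L := by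
  simp [normProd]

@[simp] theorem normProd_append (L L' : List K) :
    normProd (L ++ L') = normProd L * normProd L' := by
  simp [normProd]

theorem normProd_eq (L : List K) : normProd L = ‖L.prod‖ := by
  induction L with
  | nil => simp
  | cons ζ L ih => simp [ih]

theorem normProd_nonneg (L : List K) : 0 ≤ normProd L := by
  rw [normProd_eq]; positivity

theorem normProd_map_mul (c : K) (L : List K) :
    normProd (L.map (c * ·)) = ‖c‖ ^ L.length * normProd L := by
  induction L with
  | nil => simp
  | cons ζ L ih => simp [ih, pow_succ]; ring

/-- The `v`-th differences of `φ` with steps of size `≤ ρ ≤ δ`, divided by the product of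
the steps, are at most `C ρ^{l-v}`. -/
def DiffBound (δ : ℝ) (l v : ℕ) (C : ℝ) (φ : K → Y) : Prop :=
  ∀ L : List K, L.length = v → (∀ ζ ∈ L, ζ ≠ 0) → ∀ ρ, 0 ≤ ρ → ρ ≤ δ → (∀ ζ ∈ L, ‖ζ‖ ≤ ρ) →
    ‖pairing φ (difs L)‖ ≤ C * ρ ^ (l - v) * normProd L

variable [CharZero K] {p : ℕ}

/-- The steps in L are multiplied by p one after another, `L₀` holding those left unscaled. Each
replacement costs a sum of p differences of order v + 1 whose steps have norm at most ρ, because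
integers have norm at most 1. -/
theorem DiffBound.scale {δ C : ℝ} {l v : ℕ} {φ : K → Y} (hφ : DiffBound δ l (v + 1) C φ)
    (hC : 0 ≤ C) (hv : v < l) (hp : p ≠ 0) (hnat : ∀ c : ℕ, ‖(c : K)‖ ≤ 1) (L L₀ : List K)
    (hL : L₀.length + L.length = v) (h0 : ∀ ζ ∈ L₀ ++ L, ζ ≠ 0) {ρ : ℝ} (hρδ : ρ ≤ δ)
    (hρ₀ : 0 ≤ ρ) (hρ : ∀ ζ ∈ L₀ ++ L, ‖ζ‖ ≤ ρ) :
    ‖((p : K) ^ L.length)⁻¹ • pairing φ (difs L₀ * difs (L.map ((p : K) * ·)))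
      - pairing φ (difs L₀ * difs L)‖ ≤
      L.length * (p / ‖(p : K)‖ * C * ρ ^ (l - v) * (normProd L₀ * normProd L)) := by
  have hpK : (p : K) ≠ 0 := Nat.cast_ne_zero.2 hp
  have hpn : 0 < ‖(p : K)‖ := norm_pos_iff.2 hpK
  induction L generalizing L₀ with
  | nil => simp
  | cons ζ L ih =>
    have ih' := ih (L₀ ++ [ζ]) (by simp at hL ⊢; omega)
      (by simpa [or_assoc] using h0) (by simpa [or_assoc] using hρ)
    have hζ₀ : ζ ≠ 0 := h0 ζ (by simp)
    have hζρ : ‖ζ‖ ≤ ρ := hρ ζ (by simp)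
    set L' := L.map ((p : K) * ·) with hL'
    have step : ‖pairing φ (difs L₀ * ((dif K ((p : K) * ζ) - (p : AddMonoidAlgebra K K) * dif K ζ)
        * difs L'))‖ ≤ p * (C * ρ ^ (l - v) *
          (normProd L₀ * (‖ζ‖ * (‖(p : K)‖ ^ L.length * normProd L)))) := by
      rw [← nsmul_eq_mul, dif_nsmul_sub, Finset.sum_mul, Finset.mul_sum, map_sum]
      refine (norm_sum_le _ _).trans ((Finset.sum_le_card_nsmul _ _ _ fun c _ => ?_).trans_eq
        (by rw [Finset.card_range, nsmul_eq_mul]))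
      rcases eq_or_ne c 0 with rfl | hc
      · have := normProd_nonneg L₀
        have := normProd_nonneg L
        simp; positivity
      have hlist : difs L₀ * (dif K (c • ζ) * dif K ζ * difs L') =
          difs (L₀ ++ (c • ζ) :: ζ :: L') := by
        rw [difs_append, difs_cons, difs_cons, mul_assoc (dif K (c • ζ))]
      rw [hlist]
      have hcn := hnat c
      have hcζ : ‖c • ζ‖ ≤ ρ := by
        rw [nsmul_eq_mul, norm_mul]
        exact (mul_le_of_le_one_left (norm_nonneg _) hcn).trans hζρ
      refine (hφ _ ?_ ?_ ρ hρ₀ hρδ ?_).trans ?_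
      · simp [hL'] at hL ⊢; omega
      · intro x hx
        simp only [List.mem_append, List.mem_cons, hL', List.mem_map] at hx
        rcases hx with hx | rfl | rfl | ⟨x, hx, rfl⟩
        · exact h0 x (by simp [hx])
        · exact smul_ne_zero hc hζ₀
        · exact hζ₀
        · exact mul_ne_zero hpK (h0 x (by simp [hx]))
      · intro x hx
        simp only [List.mem_append, List.mem_cons, hL', List.mem_map] at hx
        rcases hx with hx | rfl | rfl | ⟨x, hx, rfl⟩
        · exact hρ x (by simp [hx])
        · exact hcζ
        · exact hζρ
        · rw [norm_mul]
          exact (mul_le_of_le_one_left (norm_nonneg _) (hnat p)).trans (hρ x (by simp [hx]))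
      · have n₁ := normProd_nonneg L₀
        have n₂ := normProd_nonneg L
        rw [normProd_append, normProd_cons, normProd_cons, hL', normProd_map_mul,
          show l - v = (l - (v + 1)) + 1 by omega, pow_succ]
        calc _ ≤ C * ρ ^ (l - (v + 1)) *
              (normProd L₀ * (ρ * (‖ζ‖ * (‖(p : K)‖ ^ L.length * normProd L)))) := by gcongr
          _ = _ := by ring
    have hsplit : ((p : K) ^ (ζ :: L).length)⁻¹ • pairing φ (difs L₀ * difs ((ζ :: L).map ((p : K) * ·)))
        - pairing φ (difs L₀ * difs (ζ :: L)) =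
        ((p : K) ^ (L.length + 1))⁻¹ • pairing φ (difs L₀ *
          ((dif K ((p : K) * ζ) - (p : AddMonoidAlgebra K K) * dif K ζ) * difs L')) +
        (((p : K) ^ L.length)⁻¹ • pairing φ (difs (L₀ ++ [ζ]) * difs L')
          - pairing φ (difs (L₀ ++ [ζ]) * difs L)) := by
      have e₁ : difs L₀ * ((dif K ((p : K) * ζ) - (p : AddMonoidAlgebra K K) * dif K ζ) * difs L') =
          difs L₀ * difs (((p : K) * ζ) :: L') - (p : K) • (difs (L₀ ++ [ζ]) * difs L') := by
        rw [Nat.cast_smul_eq_nsmul, nsmul_eq_mul]; simp; ring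
      rw [e₁, map_sub, map_smul, smul_sub, smul_smul, pow_succ, mul_inv, mul_assoc,
        inv_mul_cancel₀ hpK, mul_one]
      simp only [List.length_cons, List.map_cons, difs_append, difs_cons, difs_nil, mul_one,
        mul_assoc, pow_succ, mul_inv, ← hL']
      abel
    rw [hsplit]
    refine (norm_add_le_of_le (le_of_eq_of_le (norm_smul _ _) (mul_le_mul_of_nonneg_left step
      (norm_nonneg _))) ih').trans_eq ?_
    rw [norm_inv, norm_pow]
    simp
    field_simp
    ring

/-- The normalised differences `q N` with steps p^N ζ tend to 0 by `hsmall`, and consecutive ones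
differ by O(‖p‖^N) because v < l. Summing the geometric series bounds `q 0`. -/
theorem DiffBound.pred {δ C : ℝ} {l v : ℕ} {φ : K → Y} (hφ : DiffBound δ l (v + 1) C φ)
    (hC : 0 ≤ C) (hv : v < l) (hp : p ≠ 0) (hnat : ∀ c : ℕ, ‖(c : K)‖ ≤ 1) (hp1 : ‖(p : K)‖ < 1)
    (hsmall : ∀ ε > 0, ∃ η > 0, ∀ L : List K, L.length = v → (∀ ζ ∈ L, ζ ≠ 0) →
      (∀ ζ ∈ L, ‖ζ‖ ≤ η) → ‖pairing φ (difs L)‖ ≤ ε * normProd L) :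
    DiffBound δ l v (l * (p / ‖(p : K)‖) / (1 - ‖(p : K)‖) * C) φ := by
  intro L hL h0 ρ hρ₀ hρδ hρ
  have hpK : (p : K) ≠ 0 := Nat.cast_ne_zero.2 hp
  have hpn : 0 < ‖(p : K)‖ := norm_pos_iff.2 hpK
  let q : ℕ → Y := fun N => (((p : K) ^ N) ^ v)⁻¹ • pairing φ (difs (L.map (((p : K) ^ N) * ·)))
  have hq0 : q 0 = pairing φ (difs L) := by simp [q]
  have n₁ := normProd_nonneg L
  have hpow0 : ∀ N : ℕ, ((p : K) ^ N) ≠ 0 := fun N => pow_ne_zero N hpK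
  have hmem0 : ∀ N : ℕ, ∀ ζ ∈ L.map (((p : K) ^ N) * ·), ζ ≠ 0 := by
    intro N ζ hζ
    obtain ⟨x, hx, rfl⟩ := List.mem_map.1 hζ
    exact mul_ne_zero (hpow0 N) (h0 x hx)
  have hmemρ : ∀ N : ℕ, ∀ ζ ∈ L.map (((p : K) ^ N) * ·), ‖ζ‖ ≤ ‖(p : K)‖ ^ N * ρ := by
    intro N ζ hζ
    obtain ⟨x, hx, rfl⟩ := List.mem_map.1 hζ
    rw [norm_mul, norm_pow]
    gcongr
    exact hρ x hx
  have hstep : ∀ N, dist (q N) (q (N + 1)) ≤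
      (l * (p / ‖(p : K)‖) * C * ρ ^ (l - v) * normProd L) * ‖(p : K)‖ ^ N := by
    intro N
    have hle : ‖(p : K)‖ ^ N * ρ ≤ ρ :=
      mul_le_of_le_one_left hρ₀ (pow_le_one₀ hpn.le hp1.le)
    have := hφ.scale hC hv hp hnat (L.map (((p : K) ^ N) * ·)) [] (by simpa using hL)
      (by simpa using hmem0 N) (hle.trans hρδ) (by positivity) (by simpa using hmemρ N)
    have e : (L.map (((p : K) ^ N) * ·)).map ((p : K) * ·) = L.map (((p : K) ^ (N + 1)) * ·) := by
      simp [pow_succ', mul_assoc, Function.comp_def]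
    rw [e, List.length_map, hL, normProd_map_mul, hL, difs_nil, one_mul, one_mul, normProd_nil,
      one_mul] at this
    have e₂ : q N - q (N + 1) = -((((p : K) ^ N) ^ v)⁻¹ • (((p : K) ^ v)⁻¹ •
        pairing φ (difs (L.map (((p : K) ^ (N + 1)) * ·))) -
        pairing φ (difs (L.map (((p : K) ^ N) * ·))))) := by
      simp only [q]
      rw [smul_sub, smul_smul, ← mul_inv, ← mul_pow, ← pow_succ]
      abel
    rw [dist_eq_norm, e₂, norm_neg, norm_smul, norm_inv, norm_pow, norm_pow]
    have hx : 0 < (‖(p : K)‖ ^ N) ^ v := by positivity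
    rw [inv_mul_le_iff₀ hx]
    refine this.trans ?_
    rw [norm_pow, mul_pow]
    have h₁ : (‖(p : K)‖ ^ N) ^ (l - v) ≤ ‖(p : K)‖ ^ N := by
      rw [← pow_mul]
      exact pow_le_pow_of_le_one hpn.le hp1.le (Nat.le_mul_of_pos_right N (by omega))
    have h₂ : (v : ℝ) ≤ l := by exact_mod_cast hv.le
    calc _ ≤ (l : ℝ) * (p / ‖(p : K)‖ * C * (‖(p : K)‖ ^ N * ρ ^ (l - v)) *
          ((‖(p : K)‖ ^ N) ^ v * normProd L)) := by gcongr
      _ = _ := by ring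
  have hlim : Filter.Tendsto q Filter.atTop (nhds 0) := by
    rw [Metric.tendsto_atTop]
    intro ε hε
    obtain ⟨η, hη, h⟩ := hsmall (ε / (2 * (normProd L + 1))) (by positivity)
    have : Filter.Tendsto (fun N : ℕ => ‖(p : K)‖ ^ N * ρ) Filter.atTop (nhds (0 * ρ)) :=
      (tendsto_pow_atTop_nhds_zero_of_lt_one hpn.le hp1).mul_const ρ
    rw [zero_mul] at this
    obtain ⟨N₀, hN₀⟩ := Filter.eventually_atTop.1 (this.eventually (gt_mem_nhds hη))
    refine ⟨N₀, fun N hN => ?_⟩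
    have hb := h (L.map (((p : K) ^ N) * ·)) (by simpa using hL) (hmem0 N)
      fun ζ hζ => (hmemρ N ζ hζ).trans (hN₀ N hN).le
    rw [normProd_map_mul, hL] at hb
    rw [dist_zero_right, norm_smul, norm_inv, norm_pow]
    have hx : 0 < ‖(p : K) ^ N‖ ^ v := pow_pos (norm_pos_iff.2 (hpow0 N)) v
    rw [inv_mul_lt_iff₀ hx]
    refine hb.trans_lt ?_
    have : ε / (2 * (normProd L + 1)) * normProd L < ε := by
      rw [div_mul_eq_mul_div, div_lt_iff₀ (by positivity)]; nlinarith
    calc _ = ‖(p : K) ^ N‖ ^ v * (ε / (2 * (normProd L + 1)) * normProd L) := by ring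
      _ < _ := by gcongr
  have := dist_le_of_le_geometric_of_tendsto₀ _ _ hp1 hstep hlim
  rw [dist_zero_right, hq0] at this
  refine this.trans_eq ?_
  ring

end Differences

/-! ### Taylor's formula in one variable. -/

section TaylorOneVariable

variable {K : Type*} [NontriviallyNormedField K] {Y : Type*} [NormedAddCommGroup Y]
  [NormedSpace K Y]

theorem pairing_pow_difs_cons (k : ℕ) (ζ : K) (L : List K) :
    pairing (fun τ : K => τ ^ k) (difs (ζ :: L)) =
      ∑ i ∈ Finset.range k, (k.choose i : K) * ζ ^ (k - i) *
        pairing (fun τ : K => τ ^ i) (difs L) := by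
  have h : (fun τ : K => (ζ + τ) ^ k - τ ^ k) =
      fun τ => ∑ i ∈ Finset.range k, τ ^ i • ((k.choose i : K) * ζ ^ (k - i)) := by
    ext τ
    rw [add_comm ζ τ, add_pow, Finset.sum_range_succ]
    simp only [Nat.choose_self, Nat.sub_self, pow_zero, mul_one, Nat.cast_one,
      add_sub_cancel_right, smul_eq_mul]
    exact Finset.sum_congr rfl fun i _ => by ring
  rw [difs_cons, pairing_dif_mul, h, pairing_sum]
  exact Finset.sum_congr rfl fun i _ => by rw [pairing_smul_const, smul_eq_mul, mul_comm]

theorem pairing_pow_difs_eq_zero (L : List K) {k : ℕ} (hk : k < L.length) :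
    pairing (fun τ : K => τ ^ k) (difs L) = 0 := by
  induction L generalizing k with
  | nil => simp at hk
  | cons ζ L ih =>
    rw [pairing_pow_difs_cons]
    refine Finset.sum_eq_zero fun i hi => ?_
    have h₁ := Finset.mem_range.1 hi
    rw [List.length_cons] at hk
    rw [ih (by omega), mul_zero]

/-- Divided differences of order v of τ^k tend to the v-th derivative at 0, which is v! for k = v
and 0 otherwise. Subtracting a Taylor polynomial therefore makes the lower divided differences tend
to 0. -/
theorem exists_pairing_pow_difs_bound (hnat : ∀ c : ℕ, ‖(c : K)‖ ≤ 1) (v k : ℕ) :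
    ∃ C, 0 ≤ C ∧ ∀ ρ ≤ 1, ∀ L : List K, L.length = v → (∀ ζ ∈ L, ‖ζ‖ ≤ ρ) →
      ‖pairing (fun τ : K => τ ^ k) (difs L) - if k = v then (v.factorial : K) * L.prod else 0‖ ≤
        C * ρ * normProd L := by
  induction v generalizing k with
  | zero =>
    refine ⟨0, le_rfl, fun ρ _ L hL _ => ?_⟩
    obtain rfl := List.length_eq_zero_iff.1 hL
    rcases eq_or_ne k 0 with rfl | hk <;> simp_all
  | succ v ih =>
    choose C hC hC' using ih
    refine ⟨∑ i ∈ Finset.range k, C i + 1,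
      add_nonneg (Finset.sum_nonneg fun i _ => hC i) zero_le_one, fun ρ hρ1 L hL hρ => ?_⟩
    obtain _ | ⟨ζ, L⟩ := L
    · simp at hL
    have hLv : L.length = v := by simpa using hL
    have hζ : ‖ζ‖ ≤ ρ := hρ ζ (by simp)
    have hζ1 : ‖ζ‖ ≤ 1 := hζ.trans hρ1
    have hρ₀ : 0 ≤ ρ := (norm_nonneg _).trans hζ
    have hL' : ∀ ζ ∈ L, ‖ζ‖ ≤ ρ := fun x hx => hρ x (by simp [hx])
    have n₁ := normProd_nonneg L
    set e : ℕ → K := fun i => pairing (fun τ : K => τ ^ i) (difs L) -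
      if i = v then (v.factorial : K) * L.prod else 0 with he
    have hsum : ∀ i, pairing (fun τ : K => τ ^ i) (difs L) =
        (if i = v then (v.factorial : K) * L.prod else 0) + e i := fun i => by simp [he]
    rw [pairing_pow_difs_cons]
    simp only [hsum, mul_add, Finset.sum_add_distrib]
    have h₁ : ‖∑ i ∈ Finset.range k, (k.choose i : K) * ζ ^ (k - i) * e i‖ ≤
        (∑ i ∈ Finset.range k, C i) * ρ * (‖ζ‖ * normProd L) := by
      rw [Finset.sum_mul, Finset.sum_mul]
      refine norm_sum_le_of_le _ fun i hi => ?_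
      have hik := Finset.mem_range.1 hi
      have hpow : ‖ζ‖ ^ (k - i) ≤ ‖ζ‖ := by
        simpa using pow_le_pow_of_le_one (norm_nonneg ζ) hζ1 (show 1 ≤ k - i by omega)
      rw [norm_mul, norm_mul, norm_pow]
      calc _ ≤ 1 * ‖ζ‖ * (C i * ρ * normProd L) := by
            gcongr
            · exact hnat _
            · exact hC' i ρ hρ1 L hLv hL'
        _ = _ := by ring
    have h₂ : ‖(∑ i ∈ Finset.range k, (k.choose i : K) * ζ ^ (k - i) *
        (if i = v then (v.factorial : K) * L.prod else 0)) -
        if k = v + 1 then ((v + 1).factorial : K) * (ζ :: L).prod else 0‖ ≤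
        ρ * (‖ζ‖ * normProd L) := by
      have hR : 0 ≤ ρ * (‖ζ‖ * normProd L) := by positivity
      simp only [mul_ite, mul_zero, Finset.sum_ite_eq', Finset.mem_range]
      by_cases hvk : v < k
      · rw [if_pos hvk]
        rcases eq_or_ne k (v + 1) with rfl | hk
        · have : ((v + 1).choose v : K) * ζ ^ (v + 1 - v) * ((v.factorial : K) * L.prod) -
              ((v + 1).factorial : K) * (ζ :: L).prod = 0 := by
            rw [Nat.choose_succ_self_right, Nat.add_sub_cancel_left, Nat.factorial_succ,
              List.prod_cons]
            push_cast; ring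
          rw [if_pos rfl, this, norm_zero]
          exact hR
        · rw [if_neg hk, sub_zero, norm_mul, norm_mul, norm_mul, norm_pow, ← normProd_eq]
          have hpow : ‖ζ‖ ^ (k - v) ≤ ρ * ‖ζ‖ := by
            calc ‖ζ‖ ^ (k - v) ≤ ‖ζ‖ ^ 2 :=
                  pow_le_pow_of_le_one (norm_nonneg ζ) hζ1 (by omega)
              _ = ‖ζ‖ * ‖ζ‖ := sq _
              _ ≤ ρ * ‖ζ‖ := by gcongr
          calc _ ≤ 1 * (ρ * ‖ζ‖) * (1 * normProd L) := by
                gcongr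
                · exact hnat _
                · exact hnat _
            _ = _ := by ring
      · rw [if_neg hvk, if_neg (by omega), sub_zero, norm_zero]
        exact hR
    rw [normProd_cons, add_sub_right_comm]
    refine (norm_add_le_of_le h₂ h₁).trans_eq ?_
    ring

variable [CharZero K] {p : ℕ}

theorem DiffBound.of_small {δ C : ℝ} {l : ℕ} {φ : K → Y} (hφ : DiffBound δ l l C φ)
    (hC : 0 ≤ C) (hp : p ≠ 0) (hnat : ∀ c : ℕ, ‖(c : K)‖ ≤ 1) (hp1 : ‖(p : K)‖ < 1)
    (hsmall : ∀ v < l, ∀ ε > 0, ∃ η > 0, ∀ L : List K, L.length = v → (∀ ζ ∈ L, ζ ≠ 0) →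
      (∀ ζ ∈ L, ‖ζ‖ ≤ η) → ‖pairing φ (difs L)‖ ≤ ε * normProd L) (d v : ℕ) (hd : v + d = l) :
    DiffBound δ l v ((l * (p / ‖(p : K)‖) / (1 - ‖(p : K)‖)) ^ d * C) φ := by
  induction d generalizing v with
  | zero =>
    obtain rfl : v = l := by omega
    simpa using hφ
  | succ d ih =>
    have h1 : 0 ≤ 1 - ‖(p : K)‖ := by linarith
    have := (ih (v + 1) (by omega)).pred (by positivity) (by omega) hp hnat hp1
      (hsmall v (by omega))
    rwa [← mul_assoc, ← pow_succ'] at this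

/-- Taylor's formula for a function of one variable whose differences of order `l` are bounded by
the products of the steps. -/
theorem taylor_of_diffBound {δ C : ℝ} {l : ℕ} {φ : K → Y} (hφ : DiffBound δ l l C φ)
    (hl : 1 ≤ l) (hC : 0 ≤ C) (hp : p ≠ 0) (hnat : ∀ c : ℕ, ‖(c : K)‖ ≤ 1) (hp1 : ‖(p : K)‖ < 1)
    (c : ℕ → Y) (hc : ∀ v < l, ∀ ε > 0, ∃ η > 0, ∀ L : List K, L.length = v →
      (∀ ζ ∈ L, ζ ≠ 0) → (∀ ζ ∈ L, ‖ζ‖ ≤ η) →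
      ‖pairing φ (difs L) - L.prod • ((v.factorial : K) • c v)‖ ≤ ε * normProd L)
    (τ : K) (hτ : ‖τ‖ ≤ δ) :
    ‖φ τ - ∑ k ∈ Finset.range l, τ ^ k • c k‖ ≤
      (l * (p / ‖(p : K)‖) / (1 - ‖(p : K)‖)) ^ (l - 1) * C * ‖τ‖ ^ l := by
  set g : K → Y := fun τ => φ τ - ∑ k ∈ Finset.range l, τ ^ k • c k with hg
  have hgp : ∀ L : List K, pairing g (difs L) = pairing φ (difs L) -
      ∑ k ∈ Finset.range l, pairing (fun τ : K => τ ^ k) (difs L) • c k := fun L => by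
    rw [hg, pairing_sub, pairing_sum]
    simp only [pairing_smul_const]
  -- Differences of order l annihilate polynomials of degree less than l.
  have hgl : DiffBound δ l l C g := by
    intro L hL h0 ρ hρ₀ hρδ hρ
    rw [hgp, Finset.sum_eq_zero, sub_zero]
    · exact hφ L hL h0 ρ hρ₀ hρδ hρ
    · intro k hk
      rw [pairing_pow_difs_eq_zero L (hL.symm ▸ Finset.mem_range.1 hk), zero_smul]
  have hgs : ∀ v < l, ∀ ε > 0, ∃ η > 0, ∀ L : List K, L.length = v → (∀ ζ ∈ L, ζ ≠ 0) →
      (∀ ζ ∈ L, ‖ζ‖ ≤ η) → ‖pairing g (difs L)‖ ≤ ε * normProd L := by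
    intro v hv ε hε
    obtain ⟨η, hη, h⟩ := hc v hv (ε / 2) (by positivity)
    choose D hD hD' using exists_pairing_pow_difs_bound hnat v
    set A := ∑ k ∈ Finset.range l, D k * ‖c k‖ with hA
    have hA₀ : 0 ≤ A := Finset.sum_nonneg fun k _ => mul_nonneg (hD k) (norm_nonneg _)
    set η' := min η (min 1 (ε / (2 * (A + 1)))) with hη'
    have hη'₀ : 0 < η' := by positivity
    refine ⟨η', hη'₀, fun L hL h0 hLη => ?_⟩
    have n₁ := normProd_nonneg L
    have h₁ := h L hL h0 fun ζ hζ => (hLη ζ hζ).trans (min_le_left _ _)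
    have h₂ : ‖∑ k ∈ Finset.range l, (pairing (fun τ : K => τ ^ k) (difs L) -
        if k = v then (v.factorial : K) * L.prod else 0) • c k‖ ≤ A * (η' * normProd L) := by
      rw [hA, Finset.sum_mul]
      refine norm_sum_le_of_le _ fun k _ => ?_
      rw [norm_smul]
      calc _ ≤ D k * η' * normProd L * ‖c k‖ := by
            gcongr
            exact hD' k η' ((min_le_right _ _).trans (min_le_left _ _)) L hL hLη
        _ = _ := by ring
    have h₃ : A * η' ≤ ε / 2 := by
      have h₄ : η' ≤ ε / (2 * (A + 1)) := (min_le_right _ _).trans (min_le_right _ _)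
      rw [le_div_iff₀ (by positivity)] at h₄
      nlinarith
    have e : pairing g (difs L) = (pairing φ (difs L) - L.prod • ((v.factorial : K) • c v)) -
        ∑ k ∈ Finset.range l, (pairing (fun τ : K => τ ^ k) (difs L) -
          if k = v then (v.factorial : K) * L.prod else 0) • c k := by
      rw [hgp]
      simp only [sub_smul, Finset.sum_sub_distrib, ite_smul, zero_smul, Finset.sum_ite_eq',
        Finset.mem_range, if_pos hv, smul_smul, mul_comm]
      abel
    rw [e]
    refine (norm_sub_le_of_le h₁ h₂).trans ?_
    rw [← mul_assoc, ← add_mul]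
    gcongr
    linarith
  have h0 : g 0 = 0 := by
    rw [← norm_eq_zero]
    refine le_antisymm (le_of_forall_pos_le_add fun ε hε => ?_) (norm_nonneg _)
    obtain ⟨η, -, h⟩ := hgs 0 (by omega) ε hε
    simpa using h [] rfl (by simp) (by simp)
  change ‖g τ‖ ≤ _
  rcases eq_or_ne τ 0 with rfl | hτ0
  · have h1 : 0 ≤ 1 - ‖(p : K)‖ := by linarith
    rw [h0, norm_zero]
    positivity
  -- A single step τ with ρ = ‖τ‖ gives the factor ‖τ‖^(l-1) ‖τ‖; the difference is g τ because g 0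
  -- = 0.
  have := hgl.of_small hC hp hnat hp1 hgs (l - 1) 1 (by omega) [τ] rfl (by simpa using hτ0) ‖τ‖
    (norm_nonneg _) hτ (by simp)
  rw [difs_cons, difs_nil, pairing_dif_mul, pairing_one, add_zero, h0, sub_zero, normProd_cons,
    normProd_nil, mul_one, mul_assoc, ← pow_succ, Nat.sub_add_cancel hl] at this
  exact this

end TaylorOneVariable

/-! ### The derivatives of a C^l function as multilinear maps. -/

section MultilinearDerivative

variable {K : Type*} [NontriviallyNormedField K] {m v : ℕ}
  {Y : Type*} [NormedAddCommGroup Y] [NormedSpace K Y] {f : (Fin m → K) → Y}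

theorem diffQuot_eq_pairing (f : (Fin m → K) → Y) (x : Fin m → K) (h : Fin v → Fin m → K)
    (ζ : Fin v → K) :
    diffQuot f x h ζ = (∏ i, ζ i)⁻¹ • pairing (fun y => f (x + y)) (∏ i, dif K (ζ i • h i)) := by
  rw [pairing_prod_dif]; rfl

theorem pairing_difs_eq_diffQuot (f : (Fin m → K) → Y) (x h : Fin m → K) (L : List K)
    (h0 : ∀ ζ ∈ L, ζ ≠ 0) :
    pairing (fun τ : K => f (x + τ • h)) (difs L) =
      L.prod • diffQuot f x (fun _ : Fin L.length => h) L.get := by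
  have hprod : ∏ i, L.get i = L.prod := by
    rw [← List.prod_ofFn, List.ofFn_get]
  have hdifs : difs L = ∏ i, dif K (L.get i) := by
    rw [← List.prod_ofFn, difs]
    conv_lhs => rw [← List.ofFn_get L, List.map_ofFn]
    rfl
  have hne : L.prod ≠ 0 := List.prod_ne_zero fun h => h0 0 h rfl
  rw [diffQuot, hprod, smul_inv_smul₀ hne, hdifs, pairing_prod_dif]
  simp only [vertex, Finset.sum_smul]

theorem continuous_vertex (S : Finset (Fin v)) :
    Continuous fun w : (Fin m → K) × (Fin v → Fin m → K) × (Fin v → K) =>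
      vertex w.1 w.2.1 w.2.2 S := by
  unfold vertex
  fun_prop

theorem isOpen_quotDomain {Ω : Set (Fin m → K)} (hΩ : IsOpen Ω) :
    IsOpen (quotDomain (v := v) univ Ω) := by
  have : quotDomain (v := v) univ Ω = ⋂ S : Finset (Fin v),
      (fun w : (Fin m → K) × (Fin v → Fin m → K) × (Fin v → K) =>
        vertex w.1 w.2.1 w.2.2 S) ⁻¹' Ω := by
    ext w; simp [quotDomain]
  rw [this]
  exact isOpen_iInter_of_finite fun S => hΩ.preimage (continuous_vertex S)

theorem mem_quotDomain_zero {Ω : Set (Fin m → K)} {x : Fin m → K} (hx : x ∈ Ω)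
    (h : Fin v → Fin m → K) : (x, h, (0 : Fin v → K)) ∈ quotDomain univ Ω := by
  simp [quotDomain, vertex, hx]

variable {Ω : Set (Fin m → K)} {Φ : (Fin m → K) × (Fin v → Fin m → K) × (Fin v → K) → Y}

theorem tendsto_diffQuot (hΩ : IsOpen Ω) (hΦ : ContinuousOn Φ (quotDomain univ Ω))
    (hΦf : ∀ x h ζ, (x, h, ζ) ∈ quotDomain univ Ω → (∀ i, ζ i ≠ 0) →
      Φ (x, h, ζ) = diffQuot f x h ζ) {x : Fin m → K} (hx : x ∈ Ω) (h : Fin v → Fin m → K)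
    {X : K → Fin m → K} {Z : K → Fin v → K} (hX : Continuous X) (hX0 : X 0 = x)
    (hZ : Continuous Z) (hZ0 : Z 0 = 0) (hZne : ∀ t ≠ 0, ∀ i, Z t i ≠ 0) :
    Filter.Tendsto (fun t => diffQuot f (X t) h (Z t)) (nhdsWithin 0 {0}ᶜ)
      (nhds (Φ (x, h, 0))) := by
  have hmem := (isOpen_quotDomain hΩ).mem_nhds (mem_quotDomain_zero hx h)
  have hpath : Filter.Tendsto (fun t => (X t, h, Z t)) (nhds 0) (nhds (x, h, 0)) := by
    have : Continuous fun t => (X t, h, Z t) := by fun_prop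
    simpa [hX0, hZ0] using this.tendsto 0
  have hlim := ((hΦ.continuousAt hmem).tendsto.comp hpath).mono_left
    (nhdsWithin_le_nhds (s := {0}ᶜ))
  refine hlim.congr' ?_
  filter_upwards [nhdsWithin_le_nhds (hpath.eventually_mem hmem), self_mem_nhdsWithin] with t h₁ h₂
  exact hΦf _ _ _ h₁ (hZne t h₂)

theorem diffQuot_update_smul (x : Fin m → K) (h : Fin v → Fin m → K) (i : Fin v) (c : K)
    (a : Fin m → K) (ζ : Fin v → K) :
    diffQuot f x (Function.update h i (c • a)) ζ =
      c • diffQuot f x (Function.update h i a) (Function.update ζ i (c * ζ i)) := by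
  have hd : ∏ j, dif K (ζ j • Function.update h i (c • a) j) =
      ∏ j, dif K (Function.update ζ i (c * ζ i) j • Function.update h i a j) := by
    refine Finset.prod_congr rfl fun j _ => ?_
    by_cases hj : j = i
    · subst hj; simp [smul_smul, mul_comm]
    · simp [hj]
  have hp : ∏ j, Function.update ζ i (c * ζ i) j = c * ∏ j, ζ j := by
    rw [Finset.prod_update_of_mem (Finset.mem_univ i), mul_assoc, ← Finset.erase_eq,
      Finset.mul_prod_erase _ _ (Finset.mem_univ i)]
  rw [diffQuot_eq_pairing, diffQuot_eq_pairing, hd, hp, smul_smul]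
  rcases eq_or_ne c 0 with rfl | hc
  · have h0 : ∏ j, dif K (Function.update ζ i (0 * ζ i) j • Function.update h i a j) = 0 :=
      Finset.prod_eq_zero (Finset.mem_univ i) (by simp)
    rw [h0, map_zero, smul_zero, smul_zero]
  · rw [mul_inv, mul_inv_cancel_left₀ hc]

/-- Additivity in a direction is exact up to a shift of the base point by ζ_i a', which disappears
in the limit ζ → 0 by joint continuity. -/
theorem diffQuot_update_add (x : Fin m → K) (h : Fin v → Fin m → K) (i : Fin v)
    (a a' : Fin m → K) (ζ : Fin v → K) :
    diffQuot f x (Function.update h i (a + a')) ζ =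
      diffQuot f (x + ζ i • a') (Function.update h i a) ζ
        + diffQuot f x (Function.update h i a') ζ := by
  have hd : ∀ b : Fin m → K, ∏ j, dif K (ζ j • Function.update h i b j) =
      dif K (ζ i • b) * ∏ j ∈ Finset.univ.erase i, dif K (ζ j • h j) := fun b => by
    rw [← Finset.mul_prod_erase _ _ (Finset.mem_univ i), Function.update_self]
    congr 1
    refine Finset.prod_congr rfl fun j hj => ?_
    rw [Function.update_of_ne (Finset.ne_of_mem_erase hj)]
  rw [diffQuot_eq_pairing, diffQuot_eq_pairing, diffQuot_eq_pairing, ← smul_add]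
  simp only [hd, smul_add, dif_add, add_mul, map_add, mul_assoc, pairing_single_mul, add_assoc]

/-- The `v`-th derivative at `x` of a function with continuous difference quotients. -/
def multilinearDeriv (hΩ : IsOpen Ω) (hΦ : ContinuousOn Φ (quotDomain univ Ω))
    (hΦf : ∀ x h ζ, (x, h, ζ) ∈ quotDomain univ Ω → (∀ i, ζ i ≠ 0) →
      Φ (x, h, ζ) = diffQuot f x h ζ) {x : Fin m → K} (hx : x ∈ Ω) :
    MultilinearMap K (fun _ : Fin v => Fin m → K) Y :=
  MultilinearMap.mk' (fun h => Φ (x, h, 0))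
    (fun h i a a' => by
      have hl := tendsto_diffQuot hΩ hΦ hΦf hx (Function.update h i (a + a')) (X := fun _ => x)
        (Z := fun t _ => t) (by fun_prop) rfl (by fun_prop) rfl (fun t ht _ => ht)
      have h₁ := tendsto_diffQuot hΩ hΦ hΦf hx (Function.update h i a) (X := fun t => x + t • a')
        (Z := fun t _ => t) (by fun_prop) (by simp) (by fun_prop) rfl (fun t ht _ => ht)
      have h₂ := tendsto_diffQuot hΩ hΦ hΦf hx (Function.update h i a') (X := fun _ => x)
        (Z := fun t _ => t) (by fun_prop) rfl (by fun_prop) rfl (fun t ht _ => ht)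
      refine tendsto_nhds_unique hl ((h₁.add h₂).congr fun t => ?_)
      rw [diffQuot_update_add])
    (fun h i c a => by
      have hl := tendsto_diffQuot hΩ hΦ hΦf hx (Function.update h i (c • a)) (X := fun _ => x)
        (Z := fun t _ => t) (by fun_prop) rfl (by fun_prop) rfl (fun t ht _ => ht)
      rcases eq_or_ne c 0 with rfl | hc
      · refine (tendsto_nhds_unique hl (tendsto_const_nhds.congr fun t => ?_)).trans
          (zero_smul K _).symm
        rw [diffQuot_update_smul, zero_smul]
      -- Scaling a direction by c amounts to scaling its step, so the limit is taken along steps t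
      -- with the i-th one replaced by c t.
      have h₁ := tendsto_diffQuot hΩ hΦ hΦf hx (Function.update h i a) (X := fun _ => x)
        (Z := fun t => Function.update (fun _ => t) i (c * t)) (by fun_prop) rfl (by fun_prop)
        (by simp [funext_iff]) (fun t ht j => by
          by_cases hj : j = i
          · subst hj; simpa using ⟨hc, ht⟩
          · simpa [hj] using ht)
      refine tendsto_nhds_unique hl ((h₁.const_smul c).congr fun t => ?_)
      rw [diffQuot_update_smul])

theorem multilinear_apply_diag (D : MultilinearMap K (fun _ : Fin v => Fin m → K) Y)
    (w : Fin m → K) :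
    D (fun _ => w) = ∑ r : Fin v → Fin m, (∏ i, w (r i)) • D fun i => Pi.single (r i) 1 := by
  have hw : (fun _ : Fin v => w) = fun _ => ∑ j, w j • (Pi.single j 1 : Fin m → K) := by
    ext i j; simp [Finset.sum_apply, Pi.single_apply]
  rw [hw, D.map_sum]
  exact Finset.sum_congr rfl fun r _ => D.map_smul_univ _ _

end MultilinearDerivative

/-! ### From C^l functions to Whitney fields, and the local form of Sard's theorem. -/

section Taylor

variable {K : Type*} [NontriviallyNormedField K] {a b l : ℕ}

/-- In `K^m` with the maximum norm every vector is a multiple of a unit vector. -/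
theorem exists_eq_smul_norm_eq {m : ℕ} (w : Fin m → K) :
    ∃ (τ : K) (h : Fin m → K), w = τ • h ∧ ‖τ‖ = ‖w‖ ∧ ‖h‖ ≤ 1 := by
  rcases eq_or_ne w 0 with rfl | hw
  · exact ⟨0, 0, by simp⟩
  obtain ⟨i₀, -⟩ := Function.ne_iff.1 hw
  have : Nonempty (Fin m) := ⟨i₀⟩
  obtain ⟨i, hi⟩ := Finite.exists_max fun i => ‖w i‖
  have hn : ‖w i‖ = ‖w‖ :=
    le_antisymm (norm_le_pi_norm w i) ((pi_norm_le_iff_of_nonneg (norm_nonneg _)).2 hi)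
  have hpos : 0 < ‖w‖ := norm_pos_iff.2 hw
  have hne : w i ≠ 0 := norm_pos_iff.1 (hn ▸ hpos)
  refine ⟨w i, (w i)⁻¹ • w, (smul_inv_smul₀ hne w).symm, hn, ?_⟩
  rw [norm_smul, norm_inv, hn, inv_mul_cancel₀ hpos.ne']

variable [CharZero K] [ProperSpace K] {p : ℕ}

/-- Taylor's formula: on a small ball, a function of class `C^l` is approximated to the order `l`
by polynomials, which form a Whitney field of order `l`. -/
theorem IsC.exists_whitney {Ω : Set (Fin a → K)} {f : (Fin a → K) → Fin b → K} (hf : IsC l Ω f)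
    (hl : 1 ≤ l) (hΩ : IsOpen Ω) (hp : p ≠ 0) (hnat : ∀ c : ℕ, ‖(c : K)‖ ≤ 1)
    (hp1 : ‖(p : K)‖ < 1) {x₀ : Fin a → K} (hx₀ : x₀ ∈ Ω) :
    ∃ ρ > 0, ∃ P : Fin b → Metric.closedBall x₀ ρ → (Fin a → K) → K,
      (∀ j, PolyFamily (P j)) ∧ (∀ j, IsWhitney l Subtype.val (P j)) ∧
      ∃ C, 0 ≤ C ∧ ∀ (t : Metric.closedBall x₀ ρ), ∀ z ∈ Metric.closedBall x₀ (2 * ρ), ∀ j,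
        ‖f z j - P j t z‖ ≤ C * ‖z - t‖ ^ l := by
  obtain ⟨r, hr, hrΩ⟩ := Metric.nhds_basis_closedBall.mem_iff.1 (hΩ.mem_nhds hx₀)
  -- For t within ρ and z within 2ρ of x₀ the steps have norm at most 3ρ. So every vertex with l
  -- steps stays within ρ + 3lρ = r of x₀.
  set ρ := r / (3 * l + 1) with hρ
  have hρ₀ : 0 < ρ := by positivity
  have hρr : ρ + l * (3 * ρ) = r := by rw [hρ]; field_simp; ring
  have hρΩ : Metric.closedBall x₀ ρ ⊆ Ω :=
    (Metric.closedBall_subset_closedBall (by nlinarith [show (0 : ℝ) ≤ l by positivity])).trans hrΩ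
  choose Φ hΦ hΦf using fun v : Fin (l + 1) => hf v (Nat.lt_succ_iff.1 v.2)
  let D : ∀ (v : Fin (l + 1)) (t : Metric.closedBall x₀ ρ),
      MultilinearMap K (fun _ : Fin (v : ℕ) => Fin a → K) (Fin b → K) := fun v t =>
    multilinearDeriv hΩ (hΦ v) (hΦf v) (hρΩ t.2)
  let P : Fin b → Metric.closedBall x₀ ρ → (Fin a → K) → K := fun j t z =>
    ∑ k : Fin l, ((k : ℕ).factorial : K)⁻¹ * D k.castSucc t (fun _ => z - t) j
  have hP : ∀ j, PolyFamily (P j) := by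
    intro j
    refine .sum _ fun k _ => .mul (.const _) ?_
    have e : (fun (t : Metric.closedBall x₀ ρ) (z : Fin a → K) =>
        D k.castSucc t (fun _ => z - t) j) =
        fun (t : Metric.closedBall x₀ ρ) z => ∑ r : Fin (k : ℕ) → Fin a,
          (∏ i, (z (r i) - (t : Fin a → K) (r i))) *
            D k.castSucc t (fun i => Pi.single (r i) 1) j := by
      ext t z
      rw [multilinear_apply_diag, Finset.sum_apply]
      rfl
    rw [e]
    refine .sum _ fun r _ => .mul (.prod _ fun i _ => .sub (.coord _) ?_) ?_
    · refine .param (fun t : Metric.closedBall x₀ ρ => (t : Fin a → K) (r i)) (‖x₀‖ + ρ)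
        fun t => ?_
      refine (norm_le_pi_norm (t : Fin a → K) (r i)).trans ?_
      have h₁ := mem_closedBall_iff_norm.1 t.2
      have h₂ : ‖(t : Fin a → K)‖ ≤ ‖x₀‖ + ‖(t : Fin a → K) - x₀‖ := by
        simpa using norm_add_le x₀ ((t : Fin a → K) - x₀)
      linarith
    · have hcont : ContinuousOn (fun t => Φ k.castSucc (t, (fun i => Pi.single (r i) 1), 0))
          (Metric.closedBall x₀ ρ) := by
        refine (hΦ k.castSucc).comp (by fun_prop) fun t ht => ?_
        exact mem_quotDomain_zero (hρΩ ht) _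
      obtain ⟨C, hC⟩ := (isCompact_closedBall x₀ ρ).exists_bound_of_continuousOn hcont
      exact .param _ C fun t => (norm_le_pi_norm _ j).trans (hC t t.2)
  have hTaylor : ∃ C, 0 ≤ C ∧ ∀ (t : Metric.closedBall x₀ ρ), ∀ z ∈ Metric.closedBall x₀ (2 * ρ),
      ∀ j, ‖f z j - P j t z‖ ≤ C * ‖z - t‖ ^ l := by
    set Q : Set ((Fin a → K) × (Fin l → Fin a → K) × (Fin l → K)) :=
      Metric.closedBall x₀ ρ ×ˢ Metric.closedBall 0 1 ×ˢ Metric.closedBall 0 (3 * ρ) with hQ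
    have hQc : IsCompact Q := (isCompact_closedBall _ _).prod
      ((isCompact_closedBall _ _).prod (isCompact_closedBall _ _))
    have hQd : Q ⊆ quotDomain univ Ω := by
      rintro ⟨x, h, ζ⟩ ⟨hx, hh, hζ⟩
      refine ⟨trivial, fun S => hrΩ ?_⟩
      simp only [mem_closedBall_iff_norm, sub_zero] at hx hh hζ ⊢
      have hs : ‖∑ i ∈ S, ζ i • h i‖ ≤ l * (3 * ρ) := by
        calc ‖∑ i ∈ S, ζ i • h i‖ ≤ ∑ i ∈ S, 3 * ρ := by
              refine norm_sum_le_of_le _ fun i _ => ?_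
              rw [norm_smul]
              calc ‖ζ i‖ * ‖h i‖ ≤ 3 * ρ * 1 := by
                    gcongr
                    · exact (norm_le_pi_norm ζ i).trans hζ
                    · exact (norm_le_pi_norm h i).trans hh
                _ = _ := mul_one _
          _ = S.card * (3 * ρ) := by rw [Finset.sum_const, nsmul_eq_mul]
          _ ≤ _ := by
              gcongr
              exact (Finset.card_le_univ S).trans_eq (Fintype.card_fin l)
      calc ‖vertex x h ζ S - x₀‖ = ‖(x - x₀) + ∑ i ∈ S, ζ i • h i‖ := by
            rw [vertex, add_sub_right_comm]
        _ ≤ _ := norm_add_le_of_le hx hs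
        _ = r := hρr
    obtain ⟨C, hC⟩ := hQc.exists_bound_of_continuousOn ((hΦ (Fin.last l)).mono hQd)
    have h1 : 0 ≤ 1 - ‖(p : K)‖ := by linarith
    refine ⟨(l * (p / ‖(p : K)‖) / (1 - ‖(p : K)‖)) ^ (l - 1) * max C 0, by positivity,
      fun t z hz j => ?_⟩
    -- Taylor's formula is applied on the line through t and z. As ‖h‖ ≤ 1, the bound for Φ on the
    -- compact set Q is uniform in the direction.
    obtain ⟨τ, h, hw, hτ, hh⟩ := exists_eq_smul_norm_eq (z - (t : Fin a → K))
    have hzt : ‖z - (t : Fin a → K)‖ ≤ 3 * ρ := by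
      have h₁ := mem_closedBall_iff_norm.1 t.2
      have h₂ := mem_closedBall_iff_norm.1 hz
      calc ‖z - (t : Fin a → K)‖ = ‖(z - x₀) - (t - x₀)‖ := by abel_nf
        _ ≤ 2 * ρ + ρ := norm_sub_le_of_le h₂ h₁
        _ = 3 * ρ := by ring
    have hhpi : ∀ v : ℕ, ‖fun _ : Fin v => h‖ ≤ 1 := fun v =>
      (pi_norm_le_iff_of_nonneg zero_le_one).2 fun _ => hh
    let c : ℕ → Fin b → K := fun k => if hk : k < l then
      ((k : ℕ).factorial : K)⁻¹ • D (⟨k, hk⟩ : Fin l).castSucc t (fun _ => h) else 0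
    have key := taylor_of_diffBound (δ := 3 * ρ) (C := max C 0) (l := l) (p := p)
      (φ := fun τ : K => f (t + τ • h)) ?_ hl (le_max_right _ _) hp hnat hp1 c ?_ τ
      (hτ.trans_le hzt)
    · have e₁ : (t : Fin a → K) + τ • h = z := by rw [← hw]; abel
      have e₂ : P j t z = (∑ k ∈ Finset.range l, τ ^ k • c k) j := by
        rw [Finset.sum_range, Finset.sum_apply]
        refine Finset.sum_congr rfl fun k _ => ?_
        have e₃ : (D k.castSucc t fun _ => z - t) = τ ^ (k : ℕ) • D k.castSucc t fun _ => h := by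
          rw [hw]
          simpa using (D k.castSucc t).map_smul_univ (fun _ => τ) (fun _ => h)
        simp only [c, k.2, dif_pos, e₃, Pi.smul_apply, smul_eq_mul]
        ring
      rw [e₂, ← hτ]
      refine le_trans ?_ key
      simp only [e₁]
      exact norm_le_pi_norm (f z - ∑ k ∈ Finset.range l, τ ^ k • c k) j
    · intro L hL h0 ρ' hρ'₀ hρ' hLρ
      rw [pairing_difs_eq_diffQuot f _ h L h0, norm_smul, ← normProd_eq]
      subst hL
      have hmem : ((t : Fin a → K), (fun _ : Fin L.length => h), L.get) ∈ Q := by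
        refine ⟨t.2, mem_closedBall_zero_iff.2 (hhpi _), mem_closedBall_zero_iff.2 ?_⟩
        exact (pi_norm_le_iff_of_nonneg (by positivity)).2 fun i =>
          (hLρ _ (L.get_mem i)).trans hρ'
      have := hC _ hmem
      rw [hΦf (Fin.last L.length) _ _ _ (hQd hmem) fun i => h0 _ (L.get_mem i)] at this
      have n₁ := normProd_nonneg L
      rw [Nat.sub_self, pow_zero, mul_one, mul_comm]
      gcongr
      exact this.trans (le_max_left _ _)
    · intro v hv ε hε
      have hmem0 := mem_quotDomain_zero (hρΩ t.2) (fun _ : Fin v => h)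
      have hnh := (isOpen_quotDomain (v := v) hΩ).mem_nhds hmem0
      have hcont : Filter.Tendsto (fun ζ : Fin v → K => ((t : Fin a → K), (fun _ : Fin v => h), ζ))
          (nhds 0) (nhds ((t : Fin a → K), (fun _ : Fin v => h), 0)) :=
        (by fun_prop : Continuous fun ζ : Fin v → K =>
          ((t : Fin a → K), (fun _ : Fin v => h), ζ)).tendsto 0
      have hlim := ((hΦ (⟨v, hv⟩ : Fin l).castSucc).continuousAt hnh).tendsto.comp hcont
      have hev := (hcont.eventually_mem hnh).and (hlim (Metric.closedBall_mem_nhds _ hε))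
      obtain ⟨η, hη, hη'⟩ := Metric.nhds_basis_closedBall.eventually_iff.1 hev
      refine ⟨η, hη, fun L hL h0 hLη => ?_⟩
      subst hL
      have hget : L.get ∈ Metric.closedBall (0 : Fin L.length → K) η :=
        mem_closedBall_zero_iff.2 <| (pi_norm_le_iff_of_nonneg hη.le).2 fun i =>
          hLη _ (L.get_mem i)
      obtain ⟨m₁, m₂⟩ := hη' hget
      have hfac : (L.length.factorial : K) ≠ 0 := Nat.cast_ne_zero.2 (Nat.factorial_ne_zero _)
      have e : (L.length.factorial : K) • c L.length =
          Φ (⟨L.length, hv⟩ : Fin l).castSucc (t, (fun _ => h), 0) := by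
        simp only [c, hv, dif_pos]
        rw [smul_inv_smul₀ hfac]
        rfl
      rw [pairing_difs_eq_diffQuot f _ h L h0, e, ← smul_sub, norm_smul, ← normProd_eq, mul_comm]
      have m₃ : ‖Φ (⟨L.length, hv⟩ : Fin l).castSucc (t, (fun _ => h), L.get) -
          Φ (⟨L.length, hv⟩ : Fin l).castSucc (t, (fun _ => h), 0)‖ ≤ ε :=
        mem_closedBall_iff_norm.1 m₂
      have m₄ : Φ (⟨L.length, hv⟩ : Fin l).castSucc (t, (fun _ => h), L.get) =
          diffQuot f t (fun _ => h) L.get :=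
        hΦf (⟨L.length, hv⟩ : Fin l).castSucc _ _ _ m₁ fun i => h0 _ (L.get_mem i)
      have m₅ := m₄ ▸ m₃
      have n₁ := normProd_nonneg L
      gcongr
  refine ⟨ρ, hρ₀, P, hP, fun j R => ?_, hTaylor⟩
  obtain ⟨C, hC, hT⟩ := hTaylor
  obtain ⟨B, hB, hB'⟩ := (hP j).bounded R
  refine ⟨2 * C + 2 * B / ρ ^ l, by positivity, fun s t z hz => ?_⟩
  set d := ‖z - (t : Fin a → K)‖ + ‖z - (s : Fin a → K)‖ with hd
  by_cases hzρ : z ∈ Metric.closedBall x₀ (2 * ρ)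
  · have h₁ : ‖f z j - P j t z‖ ≤ C * d ^ l := (hT t z hzρ j).trans (by
      gcongr; exact le_add_of_nonneg_right (norm_nonneg _))
    have h₂ : ‖f z j - P j s z‖ ≤ C * d ^ l := (hT s z hzρ j).trans (by
      gcongr; exact le_add_of_nonneg_left (norm_nonneg _))
    calc ‖P j t z - P j s z‖ = ‖(f z j - P j s z) - (f z j - P j t z)‖ := by abel_nf
      _ ≤ C * d ^ l + C * d ^ l := norm_sub_le_of_le h₂ h₁
      _ = 2 * C * d ^ l := by ring
      _ ≤ _ := by gcongr; exact le_add_of_nonneg_right (by positivity)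
  -- Far from x₀ nothing is known about f, but d is bounded below there, so boundedness of the
  -- polynomials suffices.
  · have hρd : ρ ≤ d := by
      have h₁ := mem_closedBall_iff_norm.1 t.2
      rw [mem_closedBall_iff_norm, not_le] at hzρ
      have h₂ : ‖z - x₀‖ ≤ ‖z - (t : Fin a → K)‖ + ‖(t : Fin a → K) - x₀‖ := by
        simpa using norm_add_le (z - (t : Fin a → K)) (t - x₀)
      have h₃ := norm_nonneg (z - (s : Fin a → K))
      linarith
    calc ‖P j t z - P j s z‖ ≤ B + B := norm_sub_le_of_le (hB' t z hz) (hB' s z hz)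
      _ = 2 * B / ρ ^ l * ρ ^ l := by field_simp; ring
      _ ≤ (2 * C + 2 * B / ρ ^ l) * d ^ l := by
        gcongr; exact le_add_of_nonneg_left (by positivity)

/-- Sard's theorem for functions of class `C^l` on open sets, in a neighbourhood of a point. -/
theorem IsC.exists_null [MeasurableSpace K] [BorelSpace K] (μ : Measure K) [μ.IsAddHaarMeasure]
    {Ω : Set (Fin a → K)} {f : (Fin a → K) → Fin b → K} (hf : IsC l Ω f) (hal : a < l)
    (hl : 2 ≤ l) (hΩ : IsOpen Ω) (hp : p ≠ 0) (hnat : ∀ c : ℕ, ‖(c : K)‖ ≤ 1)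
    (hp1 : ‖(p : K)‖ < 1) {x₀ : Fin a → K} (hx₀ : x₀ ∈ Ω) :
    ∃ ρ > 0, ∃ S : Set (Fin b → K), IsCompact S ∧ (Measure.pi fun _ : Fin b => μ) S = 0 ∧
      ∀ x ∈ Metric.closedBall x₀ ρ, DifferentiableAt K f x ∧
        (Module.finrank K (LinearMap.range (fderiv K f x).toLinearMap) < b → f x ∈ S) := by
  obtain ⟨ρ, hρ, P, hP, hPW, C, hC, hT⟩ := hf.exists_whitney (by omega) hΩ hp hnat hp1 hx₀
  set B := ‖x₀‖ + ρ with hB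
  have hu : ∀ t : Metric.closedBall x₀ ρ, ‖(t : Fin a → K)‖ ≤ B := fun t => by
    have h₁ := mem_closedBall_iff_norm.1 t.2
    have h₂ : ‖(t : Fin a → K)‖ ≤ ‖x₀‖ + ‖(t : Fin a → K) - x₀‖ := by
      simpa using norm_add_le x₀ ((t : Fin a → K) - x₀)
    linarith
  obtain ⟨l, rfl⟩ : ∃ l', l = l' + 2 := ⟨l - 2, by omega⟩
  have hfP : ∀ (t : Metric.closedBall x₀ ρ) j, P j t t = f t j := fun t j => by
    have := hT t t (Metric.closedBall_subset_closedBall (by linarith) t.2) j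
    simp only [sub_self, norm_zero, ne_eq, Nat.add_eq_zero_iff, OfNat.ofNat_ne_zero, and_false,
      not_false_eq_true, zero_pow, mul_zero, norm_le_zero_iff, sub_eq_zero] at this
    exact this.symm
  let J : Metric.closedBall x₀ ρ → (Fin a → K) →L[K] (Fin b → K) := fun t =>
    ContinuousLinearMap.pi fun j =>
      ∑ i, (pd i (P j) t t) • (ContinuousLinearMap.proj i : (Fin a → K) →L[K] K)
  have hJ : ∀ t w j, J t w j = ∑ i, pd i (P j) t t * w i := fun t w j => by
    simp [J]
  have hquad : ∀ R : ℝ, ∃ A, 0 ≤ A ∧ ∀ (t : Metric.closedBall x₀ ρ) z, ‖z‖ ≤ R → ∀ j,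
      ‖P j t z - P j t t - J t (z - t) j‖ ≤ A * ‖z - t‖ ^ 2 := by
    intro R
    choose A hA hA' using fun j => (hP j).taylor_one (max R B)
    refine ⟨∑ j, A j, Finset.sum_nonneg fun j _ => hA j, fun t z hz j => ?_⟩
    have htB : ‖(t : Fin a → K)‖ ≤ max R B := (hu t).trans (le_max_right _ _)
    have := hA' j t t z t htB (hz.trans (le_max_left _ _)) htB
    rw [hJ]
    refine this.trans ?_
    rw [sub_self, norm_zero, add_zero, mul_assoc, ← sq]
    gcongr
    exact Finset.single_le_sum (fun j _ => hA j) (Finset.mem_univ j)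
  have hderiv : ∀ t : Metric.closedBall x₀ ρ, HasFDerivAt f (J t) t := by
    intro t
    obtain ⟨A, hA, hA'⟩ := hquad (‖x₀‖ + 2 * ρ)
    have hO : (fun z => f z - f t - J t (z - t)) =O[nhds (t : Fin a → K)]
        fun z => ‖z - (t : Fin a → K)‖ ^ 2 := by
      refine Asymptotics.IsBigO.of_bound (C * (3 * ρ) ^ l + A) ?_
      have ht : (t : Fin a → K) ∈ Metric.ball x₀ (2 * ρ) :=
        Metric.mem_ball.2 ((Metric.mem_closedBall.1 t.2).trans_lt (by linarith))
      filter_upwards [Metric.isOpen_ball.mem_nhds ht] with z hz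
      have hzn := mem_ball_iff_norm.1 hz
      have htn := mem_closedBall_iff_norm.1 t.2
      have hzR : ‖z‖ ≤ ‖x₀‖ + 2 * ρ := by
        have h₂ : ‖z‖ ≤ ‖x₀‖ + ‖z - x₀‖ := by simpa using norm_add_le x₀ (z - x₀)
        linarith
      have hzt : ‖z - (t : Fin a → K)‖ ≤ 3 * ρ := by
        calc ‖z - (t : Fin a → K)‖ = ‖(z - x₀) - (t - x₀)‖ := by abel_nf
          _ ≤ 2 * ρ + ρ := norm_sub_le_of_le hzn.le htn
          _ = 3 * ρ := by ring
      rw [norm_pow, norm_norm]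
      refine (pi_norm_le_iff_of_nonneg (by positivity)).2 fun j => ?_
      have h₁ := hT t z (Metric.ball_subset_closedBall hz) j
      have h₂ := hA' t z hzR j
      rw [hfP] at h₂
      calc ‖(f z - f t - J t (z - t)) j‖
          = ‖(f z j - P j t z) + (P j t z - f t j - J t (z - t) j)‖ := by
            simp only [Pi.sub_apply]; ring_nf
        _ ≤ C * ‖z - (t : Fin a → K)‖ ^ (l + 2) + A * ‖z - (t : Fin a → K)‖ ^ 2 :=
            norm_add_le_of_le h₁ h₂
        _ ≤ C * ((3 * ρ) ^ l * ‖z - (t : Fin a → K)‖ ^ 2) + A * ‖z - (t : Fin a → K)‖ ^ 2 := by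
            rw [pow_add]; gcongr
        _ = _ := by ring
    have h₀ := Asymptotics.IsBigO.hasFDerivAt (𝕜 := K) hO one_lt_two
    have h₁ := (h₀.add ((J t).hasFDerivAt.comp (t : Fin a → K)
      ((hasFDerivAt_id (t : Fin a → K)).sub_const (t : Fin a → K)))).add_const (f t)
    refine (h₁.congr_fderiv ?_).congr_of_eventuallyEq (Filter.Eventually.of_forall fun z => ?_)
    · ext; simp
    · simp
  -- A critical point is paired with a unit vector v that annihilates the range of the derivative.
  -- The set of such pairs is closed, so the parameter space is compact.
  let T : Set (Metric.closedBall x₀ ρ × Metric.sphere (0 : Fin b → K) 1) :=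
    {w | ∀ i, ∑ j, (w.2 : Fin b → K) j * pd i (P j) w.1 w.1 = 0}
  have hTc : IsClosed T := by
    have hpdc : ∀ i j, Continuous fun t : Metric.closedBall x₀ ρ => pd i (P j) t t := fun i j =>
      IsWhitney.continuous (l := l) (IsWhitney.pd (hPW j) (hP j) hu i) ((hP j).pd i) hu
        continuous_subtype_val
    simp only [T, ofPred_forall]
    refine isClosed_iInter fun i => isClosed_eq ?_ continuous_const
    refine continuous_finsetSum _ fun j _ => ?_
    exact ((continuous_apply j).comp (continuous_subtype_val.comp continuous_snd)).mul
      ((hpdc i j).comp continuous_fst)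
  have hball : CompactSpace (Metric.closedBall x₀ ρ) :=
    isCompact_iff_compactSpace.1 (isCompact_closedBall _ _)
  have hsph : CompactSpace (Metric.sphere (0 : Fin b → K) 1) :=
    isCompact_iff_compactSpace.1 (isCompact_sphere _ _)
  have hTcomp : CompactSpace T := isCompact_iff_compactSpace.1 hTc.isCompact
  have hucont : Continuous fun t : T => (t.1.1 : Fin a → K) :=
    continuous_subtype_val.comp (continuous_fst.comp continuous_subtype_val)
  have hnull := sardAt μ hal b T (fun t => (t.1.1 : Fin a → K)) (fun j t => P j t.1.1) hucont
    (fun j => (hP j).comp_index fun t : T => t.1.1)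
    (fun j => (hPW j).comp_index fun t : T => t.1.1) fun t => by
      refine ⟨t.1.2.1, fun h0 => ?_, fun R => ?_⟩
      · have := mem_sphere_zero_iff_norm.1 t.1.2.2
        rw [h0, norm_zero] at this
        exact zero_ne_one this
      obtain ⟨A, hA, hA'⟩ := hquad R
      set v : Fin b → K := t.1.2.1
      refine ⟨∑ j, ‖v j‖ * A, by positivity, fun z hz => ?_⟩
      have e : ∑ j, v j * J t.1.1 (z - t.1.1) j = 0 := by
        simp only [hJ, Finset.mul_sum]
        rw [Finset.sum_comm]
        refine Finset.sum_eq_zero fun i _ => ?_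
        rw [← zero_mul ((z - (t.1.1 : Fin a → K)) i), ← t.2 i, Finset.sum_mul]
        exact Finset.sum_congr rfl fun j _ => by ring
      rw [← sub_zero (∑ j, v j * _), ← e, ← Finset.sum_sub_distrib, Finset.sum_mul]
      refine norm_sum_le_of_le _ fun j _ => ?_
      rw [← mul_sub, norm_mul, mul_assoc]
      gcongr
      exact hA' t.1.1 z hz j
  refine ⟨ρ, hρ, _, isCompact_range (continuous_pi fun j => ?_), hnull, fun x hx => ?_⟩
  · exact IsWhitney.continuous (l := l + 1) ((hPW j).comp_index fun t : T => t.1.1)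
      ((hP j).comp_index _) (fun t => hu t.1.1) hucont
  refine ⟨(hderiv ⟨x, hx⟩).differentiableAt, fun hrank => ?_⟩
  rw [(hderiv ⟨x, hx⟩).fderiv] at hrank
  have hlt : LinearMap.range (J ⟨x, hx⟩).toLinearMap < ⊤ := by
    refine lt_top_iff_ne_top.2 fun h => ?_
    rw [h, finrank_top, Module.finrank_fin_fun] at hrank
    exact lt_irrefl _ hrank
  -- A derivative that is not onto is annihilated by a nonzero functional. Its coefficient vector,
  -- divided by a scalar of the same norm, lies on the unit sphere.
  obtain ⟨φ, hφ, hφ'⟩ := Submodule.exists_le_ker_of_lt_top _ hlt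
  have hφsum : ∀ w : Fin b → K, φ w = ∑ j, w j * φ (Pi.single j 1) := fun w => by
    rw [LinearMap.pi_apply_eq_sum_univ φ w]
    refine Finset.sum_congr rfl fun j _ => ?_
    rw [smul_eq_mul]
    congr 2
    ext k; simp [Pi.single_apply, eq_comm]
  let v : Fin b → K := fun j => φ (Pi.single j 1)
  have hv : v ≠ 0 := fun h => hφ <| LinearMap.ext fun w => by
    rw [hφsum, LinearMap.zero_apply]
    exact Finset.sum_eq_zero fun j _ => by rw [show φ (Pi.single j 1) = 0 from congrFun h j, mul_zero]
  obtain ⟨τ, h, hvh, hτ, -⟩ := exists_eq_smul_norm_eq v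
  have hvn : 0 < ‖v‖ := norm_pos_iff.2 hv
  have hτ0 : τ ≠ 0 := norm_pos_iff.1 (hτ ▸ hvn)
  have hh1 : ‖h‖ = 1 := by
    have := congrArg norm hvh
    rw [norm_smul, hτ] at this
    exact (mul_right_eq_self₀.1 this.symm).resolve_right hvn.ne'
  refine ⟨⟨(⟨x, hx⟩, ⟨h, mem_sphere_zero_iff_norm.2 hh1⟩), fun i => ?_⟩, funext fun j => hfP _ j⟩
  have h₁ : φ (J ⟨x, hx⟩ (Pi.single i 1)) = 0 := hφ' ⟨Pi.single i 1, rfl⟩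
  rw [hφsum] at h₁
  have h₂ : τ * ∑ j, h j * pd i (P j) ⟨x, hx⟩ x = 0 := by
    rw [← h₁, Finset.mul_sum]
    refine Finset.sum_congr rfl fun j _ => ?_
    rw [hJ, ← mul_assoc, show τ * h j = v j from (congrFun hvh j).symm, mul_comm]
    congr 1
    simp [Pi.single_apply]
  exact (mul_eq_zero.1 h₂).resolve_left hτ0

end Taylor

/-! ### Differentiability of transition maps and independence of the charts. -/

section Manifold

variable {K : Type*} [NontriviallyNormedField K]

theorem diffQuot_one {m : ℕ} {Y : Type*} [NormedAddCommGroup Y] [NormedSpace K Y]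
    (f : (Fin m → K) → Y) (x : Fin m → K) (h : Fin 1 → Fin m → K) (ζ : Fin 1 → K) :
    diffQuot f x h ζ = (ζ 0)⁻¹ • (f (x + ζ 0 • h 0) - f x) := by
  rw [diffQuot_eq_pairing]
  simp [dif]

/-- First-order partial quotients are jointly continuous in the point and the step. So an increment,
split into moves along the axes, is approximated by the partial derivatives at x; in the maximum
norm all intermediate points stay within ‖z - x‖ of x. -/
theorem IsCPair.differentiableAt {m t s : ℕ} {Y : Type*} [NormedAddCommGroup Y] [NormedSpace K Y]
    {Ω : Set (Fin m → K)} {f : (Fin m → K) → Y} (hf : IsCPair (t + 1) s Ω f) (hΩ : IsOpen Ω)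
    {x : Fin m → K} (hx : x ∈ Ω) : DifferentiableAt K f x := by
  have hq : ∀ j : Fin m, HasContDiffQuot (v := 1) {fun _ => Pi.single j 1} Ω f := fun j => by
    refine hf 1 (fun _ => j) ?_
    calc ∑ j', ((Finset.univ.filter fun _ : Fin 1 => j = j').card - s)
        ≤ ∑ j', if j = j' then 1 else 0 := Finset.sum_le_sum fun j' _ => by
          by_cases h : j = j' <;> simp [h]
      _ = 1 := by simp
      _ ≤ t + 1 := by omega
  choose Φ hΦ hΦf using hq
  let e : Fin m → Fin 1 → Fin m → K := fun j _ => Pi.single j 1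
  let A : (Fin m → K) →L[K] Y := ∑ j, (ContinuousLinearMap.proj j : (Fin m → K) →L[K] K).smulRight
    (Φ j (x, e j, 0))
  have hA : ∀ w, A w = ∑ j, w j • Φ j (x, e j, 0) := fun w => by simp [A]
  refine ⟨A, .of_isLittleO (Asymptotics.isLittleO_iff.2 fun ε hε => ?_)⟩
  have hε' : 0 < ε / (m + 1) := by positivity
  have hcont : ∀ j, ∃ η > 0, ∀ y τ, ‖y - x‖ < η → ‖τ‖ < η → y ∈ Ω → y + τ • Pi.single j 1 ∈ Ω →
      ‖Φ j (y, e j, fun _ => τ) - Φ j (x, e j, 0)‖ ≤ ε / (m + 1) := fun j => by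
    have hmem : (x, e j, (0 : Fin 1 → K)) ∈ quotDomain {fun _ => Pi.single j 1} Ω :=
      ⟨rfl, fun S => by simpa [vertex] using hx⟩
    obtain ⟨η, hη, h⟩ := Metric.continuousWithinAt_iff.1 (hΦ j _ hmem) _ hε'
    refine ⟨η, hη, fun y τ hy hτ hyΩ hyΩ' => ?_⟩
    have hd : (y, e j, fun _ : Fin 1 => τ) ∈ quotDomain {fun _ => Pi.single j 1} Ω := by
      refine ⟨rfl, fun S => ?_⟩
      rcases Finset.eq_empty_or_nonempty S with rfl | ⟨i, hi⟩
      · simpa [vertex] using hyΩ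
      · have hS : S = {0} := by
          ext k; rw [Subsingleton.elim k 0, ← Subsingleton.elim i 0]; simp [hi]
        simpa [vertex, hS] using hyΩ'
    rw [← dist_eq_norm]
    refine (h hd ?_).le
    rw [Prod.dist_eq, Prod.dist_eq, dist_self, dist_eq_norm, dist_zero_right]
    refine max_lt hy (max_lt hη ?_)
    exact (pi_norm_lt_iff hη).2 fun _ => hτ
  choose η hη hη' using hcont
  have hnear : ∀ᶠ z in nhds x, (∀ j, ‖z - x‖ < η j) ∧ Metric.closedBall x ‖z - x‖ ⊆ Ω := by
    have hz : Filter.Tendsto (fun z => ‖z - x‖) (nhds x) (nhds 0) := by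
      simpa using (by fun_prop : Continuous fun z => ‖z - x‖).tendsto x
    refine (Filter.eventually_all.2 fun j => hz.eventually (gt_mem_nhds (hη j))).and ?_
    obtain ⟨r, hr, hrΩ⟩ := Metric.nhds_basis_closedBall.mem_iff.1 (hΩ.mem_nhds hx)
    filter_upwards [hz.eventually (gt_mem_nhds hr)] with z hz'
    exact (Metric.closedBall_subset_closedBall hz'.le).trans hrΩ
  filter_upwards [hnear] with z ⟨hzη, hzΩ⟩
  have hball : ∀ y : Fin m → K, (∀ k, y k = x k ∨ y k = z k) → ‖y - x‖ ≤ ‖z - x‖ := fun y hy => by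
    refine (pi_norm_le_iff_of_nonneg (norm_nonneg _)).2 fun k => ?_
    rcases hy k with h | h
    · simp [h]
    · rw [Pi.sub_apply, h]; exact norm_le_pi_norm (z - x) k
  have key := norm_sub_le_of_update (fun y => f y - A y) x z (ε / (m + 1) * ‖z - x‖)
    fun i y hy hyi => by
      set τ := z i - x i with hτ
      have hup : Function.update y i (z i) = y + τ • Pi.single i 1 := by
        ext k
        by_cases hk : k = i
        · subst hk; simp [hτ, hyi]
        · simp [hk]
      have hAτ : A (y + τ • Pi.single i 1) = A y + τ • Φ i (x, e i, 0) := by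
        rw [map_add, map_smul, hA (Pi.single i 1)]
        simp [Pi.single_apply]
      have hyb := hball y hy
      have hyΩ : y ∈ Ω := hzΩ (mem_closedBall_iff_norm.2 hyb)
      have hyb' : Function.update y i (z i) ∈ Ω := hzΩ <| mem_closedBall_iff_norm.2 <|
        hball _ fun k => by
          by_cases hk : k = i
          · subst hk; simp
          · simpa [hk] using hy k
      rw [hup] at hyb' ⊢
      rcases eq_or_ne τ 0 with h0 | h0
      · rw [h0, zero_smul, add_zero, sub_self, norm_zero]; positivity
      have hτn : ‖τ‖ ≤ ‖z - x‖ := norm_le_pi_norm (z - x) i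
      have hb := hη' i y τ (hyb.trans_lt (hzη i)) (hτn.trans_lt (hzη i)) hyΩ hyb'
      have hd : (y, e i, fun _ : Fin 1 => τ) ∈ quotDomain {fun _ => Pi.single i 1} Ω := by
        refine ⟨rfl, fun S => ?_⟩
        rcases Finset.eq_empty_or_nonempty S with rfl | ⟨i', hi⟩
        · simpa [vertex] using hyΩ
        · have hS : S = {0} := by
            ext k; rw [Subsingleton.elim k 0, ← Subsingleton.elim i' 0]; simp [hi]
          simpa [vertex, hS] using hyb'
      rw [hΦf i _ _ _ hd fun _ => h0, diffQuot_one] at hb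
      calc ‖f (y + τ • Pi.single i 1) - A (y + τ • Pi.single i 1) - (f y - A y)‖
          = ‖τ • (τ⁻¹ • (f (y + τ • Pi.single i 1) - f y) - Φ i (x, e i, 0))‖ := by
            rw [smul_sub, smul_inv_smul₀ h0, hAτ]; congr 1; abel
        _ ≤ ‖z - x‖ * (ε / (m + 1)) := by
            rw [norm_smul]; gcongr
        _ = _ := mul_comm _ _
  calc ‖f z - f x - A (z - x)‖ = ‖f z - A z - (f x - A x)‖ := by rw [map_sub]; congr 1; abel
    _ ≤ m * (ε / (m + 1) * ‖z - x‖) := key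
    _ = m / (m + 1) * (ε * ‖z - x‖) := by ring
    _ ≤ 1 * (ε * ‖z - x‖) := by
        gcongr
        rw [div_le_one (by positivity)]; linarith
    _ = _ := one_mul _

theorem IsSCManifold.differentiableAt_transition {A : ApproxSystem K} {q n m : ℕ} {M : Type*}
    [TopologicalSpace M] [ChartedSpace (Fin m → K) M] (hM : IsSCManifold A q n m M)
    {e e' : OpenPartialHomeomorph M (Fin m → K)} (he : e ∈ atlas (Fin m → K) M)
    (he' : e' ∈ atlas (Fin m → K) M) {x : Fin m → K} (hx : x ∈ e.target)
    (hx' : e.symm x ∈ e'.source) : DifferentiableAt K (e' ∘ e.symm) x := by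
  by_cases h : e = e'
  · subst h
    refine differentiableAt_id.congr_of_eventuallyEq ?_
    filter_upwards [e.open_target.mem_nhds hx] with y hy
    exact e.right_inv hy
  · exact (hM.transition e he e' he' h).1.differentiableAt
      (e.symm.isOpen_inter_preimage e'.open_source) ⟨hx, hx'⟩

theorem finrank_range_comp_comp_le {E₁ E₂ E₃ E₄ : Type*} [AddCommGroup E₁] [Module K E₁]
    [AddCommGroup E₂] [Module K E₂] [AddCommGroup E₃] [Module K E₃] [AddCommGroup E₄] [Module K E₄]
    [FiniteDimensional K E₃] (A : E₃ →ₗ[K] E₄) (B : E₂ →ₗ[K] E₃) (C : E₁ →ₗ[K] E₂) :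
    Module.finrank K (LinearMap.range (A ∘ₗ B ∘ₗ C)) ≤ Module.finrank K (LinearMap.range B) := by
  rw [LinearMap.range_comp]
  exact (Submodule.finrank_map_le _ _).trans (Submodule.finrank_mono (LinearMap.range_comp_le_range _ _))

variable [CharZero K] [ProperSpace K] [MeasurableSpace K] [BorelSpace K]
  (μ : Measure K) [μ.IsAddHaarMeasure] {p a b l q n : ℕ} {A : ApproxSystem K}
  {M : Type*} [TopologicalSpace M] [ChartedSpace (Fin a → K) M]
  {N : Type*} [TopologicalSpace N] [ChartedSpace (Fin b → K) N]

/-- In the charts, the images of the critical points near a given point form a null set. -/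
theorem IsCMap.exists_null (hM : IsSCManifold A q n a M) (hN : IsSCManifold A q n b N)
    {f : M → N} (hf : IsCMap K a b l f) (hl : max a b < l) (hp : p ≠ 0)
    (hnat : ∀ c : ℕ, ‖(c : K)‖ ≤ 1) (hp1 : ‖(p : K)‖ < 1)
    {e' : OpenPartialHomeomorph N (Fin b → K)} (he' : e' ∈ atlas (Fin b → K) N) {z₀ : M}
    (hz₀ : f z₀ ∈ e'.source) :
    ∃ U ∈ nhds z₀, ∃ S : Set (Fin b → K), IsCompact S ∧
      (Measure.pi fun _ : Fin b => μ) S = 0 ∧ ∀ z ∈ U, z ∈ criticalSet K a b f → e' (f z) ∈ S := by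
  -- For b = 0 no point is critical. For b ≥ 1 the hypothesis yields l ≥ 2, which the quadratic
  -- remainder requires.
  rcases Nat.eq_zero_or_pos b with rfl | hb
  · exact ⟨univ, Filter.univ_mem, ∅, isCompact_empty, measure_empty,
      fun z _ hz => absurd hz (Nat.not_lt_zero _)⟩
  have hal : a < l := (le_max_left _ _).trans_lt hl
  have hl2 : 2 ≤ l := by have := (le_max_right a b).trans_lt hl; omega
  have hopen : ∀ (e : OpenPartialHomeomorph M (Fin a → K)) (e' : OpenPartialHomeomorph N (Fin b → K)),
      IsOpen (e.target ∩ e.symm ⁻¹' (f ⁻¹' e'.source)) := fun e e' =>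
    e.symm.isOpen_inter_preimage (e'.open_source.preimage hf.continuous)
  set e := chartAt (Fin a → K) z₀ with he
  have hez₀ : z₀ ∈ e.source := mem_chart_source _ z₀
  obtain ⟨ρ, hρ, S, hS, hS0, h⟩ := IsC.exists_null μ (hf.isC e (chart_mem_atlas _ z₀) e' he') hal hl2
    (hopen e e') hp hnat hp1 (x₀ := e z₀)
    ⟨e.map_source hez₀, by simpa [e.left_inv hez₀] using hz₀⟩
  refine ⟨(e.source ∩ e ⁻¹' Metric.closedBall (e z₀) ρ) ∩ f ⁻¹' e'.source, ?_, S, hS, hS0, ?_⟩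
  · refine Filter.inter_mem (Filter.inter_mem (e.open_source.mem_nhds hez₀) ?_) ?_
    · exact (e.continuousAt hez₀) (Metric.closedBall_mem_nhds _ hρ)
    · exact hf.continuous.continuousAt (e'.open_source.mem_nhds hz₀)
  rintro z ⟨⟨hze, hzρ⟩, hzf⟩ hz
  obtain ⟨-, hrank⟩ := h (e z) hzρ
  have hgoal : (e' ∘ f ∘ e.symm) (e z) = e' (f z) := by simp [e.left_inv hze]
  rw [← hgoal]
  -- The differential is taken in the charts at z and f z, the local theorem in fixed charts. The
  -- chain rule exhibits the derivative in the fixed charts as a composite with the differential in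
  -- the middle, so its rank is no larger.
  refine hrank (lt_of_le_of_lt ?_ hz)
  set φ := chartAt (Fin a → K) z with hφ
  set φ' := chartAt (Fin b → K) (f z) with hφ'
  have hzφ : z ∈ φ.source := mem_chart_source _ z
  have hzφ' : f z ∈ φ'.source := mem_chart_source _ (f z)
  -- Only the differentiability at the centre is used here.
  obtain ⟨r, hr, S', -, -, hd⟩ := IsC.exists_null μ
    (hf.isC φ (chart_mem_atlas _ z) φ' (chart_mem_atlas _ (f z))) hal hl2 (hopen φ φ') hp hnat hp1
    (x₀ := φ z) ⟨φ.map_source hzφ, by simpa [φ.left_inv hzφ] using hzφ'⟩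
  have hG : DifferentiableAt K (φ' ∘ f ∘ φ.symm) (φ z) :=
    (hd (φ z) (Metric.mem_closedBall_self hr.le)).1
  have hdiff : differential K a b f z = fderiv K (φ' ∘ f ∘ φ.symm) (φ z) := by
    have hmd : MDifferentiableAt 𝓘(K, Fin a → K) 𝓘(K, Fin b → K) f z := by
      rw [mdifferentiableAt_iff]
      refine ⟨hf.continuous.continuousAt, ?_⟩
      exact hG.differentiableWithinAt
    refine (hmd.mfderiv : mfderiv 𝓘(K, Fin a → K) 𝓘(K, Fin b → K) f z = _).trans ?_
    change fderivWithin K (φ' ∘ f ∘ φ.symm) (range 𝓘(K, Fin a → K)) (φ z) = _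
    rw [modelWithCornersSelf_coe, range_id, fderivWithin_univ]
  have hτ : DifferentiableAt K (φ ∘ e.symm) (e z) :=
    hM.differentiableAt_transition (chart_mem_atlas _ z₀) (chart_mem_atlas _ z)
      (e.map_source hze) (by rwa [e.left_inv hze])
  have hτ' : DifferentiableAt K (e' ∘ φ'.symm) (φ' (f z)) :=
    hN.differentiableAt_transition (chart_mem_atlas _ (f z)) he'
      (φ'.map_source hzφ') (by rwa [φ'.left_inv hzφ'])
  have hev : e' ∘ f ∘ e.symm =ᶠ[nhds (e z)]
      (e' ∘ φ'.symm) ∘ (φ' ∘ f ∘ φ.symm) ∘ (φ ∘ e.symm) := by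
    have hc : ContinuousAt e.symm (e z) := e.continuousAt_symm (e.map_source hze)
    have h₁ : ∀ᶠ y in nhds (e z), e.symm y ∈ φ.source :=
      hc (φ.open_source.mem_nhds (by rwa [e.left_inv hze]))
    have h₂ : ∀ᶠ y in nhds (e z), e.symm y ∈ f ⁻¹' φ'.source :=
      hc ((φ'.open_source.preimage hf.continuous).mem_nhds (by
        rw [e.left_inv hze]; exact hzφ'))
    filter_upwards [h₁, h₂] with y hy₁ hy₂
    simp [φ.left_inv hy₁, φ'.left_inv hy₂]
  have hφe : (φ ∘ e.symm) (e z) = φ z := by simp [e.left_inv hze]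
  have hGe : (φ' ∘ f ∘ φ.symm) (φ z) = φ' (f z) := by simp [φ.left_inv hzφ]
  have hG' : DifferentiableAt K (φ' ∘ f ∘ φ.symm) ((φ ∘ e.symm) (e z)) := by rwa [hφe]
  have hτ'' : DifferentiableAt K (e' ∘ φ'.symm)
      (((φ' ∘ f ∘ φ.symm) ∘ (φ ∘ e.symm)) (e z)) := by
    rw [Function.comp_apply (f := φ' ∘ f ∘ φ.symm), hφe, hGe]; exact hτ'
  rw [hev.fderiv_eq, fderiv_comp _ hτ'' (hG'.comp _ hτ), fderiv_comp _ hG' hτ, hφe, ← hdiff]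
  exact finrank_range_comp_comp_le _ _ _

end Manifold

/-! ### Globalisation over M and density of the complement. -/

section Global

variable {K : Type*} [NontriviallyNormedField K] [CharZero K] [ProperSpace K] [MeasurableSpace K]
  [BorelSpace K] (μ : Measure K) [μ.IsAddHaarMeasure] {p a b l q n : ℕ} {A : ApproxSystem K}
  {M : Type*} [TopologicalSpace M] [ChartedSpace (Fin a → K) M] [SecondCountableTopology M]
  {N : Type*} [TopologicalSpace N] [ChartedSpace (Fin b → K) N]

/-- In each chart of the target, the critical values form a null set. -/
theorem IsCMap.exists_measurableSet_null (hM : IsSCManifold A q n a M)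
    (hN : IsSCManifold A q n b N) {f : M → N} (hf : IsCMap K a b l f) (hl : max a b < l)
    (hp : p ≠ 0) (hnat : ∀ c : ℕ, ‖(c : K)‖ ≤ 1) (hp1 : ‖(p : K)‖ < 1)
    {e' : OpenPartialHomeomorph N (Fin b → K)} (he' : e' ∈ atlas (Fin b → K) N) :
    ∃ T : Set (Fin b → K), MeasurableSet T ∧ (Measure.pi fun _ : Fin b => μ) T = 0 ∧
      ∀ z ∈ criticalSet K a b f, f z ∈ e'.source → e' (f z) ∈ T := by
  have key : ∀ z₀ : M, ∃ U ∈ nhds z₀, ∃ S : Set (Fin b → K), IsCompact S ∧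
      (Measure.pi fun _ : Fin b => μ) S = 0 ∧
      ∀ z ∈ U, z ∈ criticalSet K a b f → f z ∈ e'.source → e' (f z) ∈ S := by
    intro z₀
    by_cases hz₀ : f z₀ ∈ e'.source
    · obtain ⟨U, hU, S, hS, hS0, h⟩ := hf.exists_null μ hM hN hl hp hnat hp1 he' hz₀
      exact ⟨U, hU, S, hS, hS0, fun z hz hzc _ => h z hz hzc⟩
    -- Chart domains are closed as well as open, so a point mapped outside has a whole neighbourhood
    -- mapped outside.
    · exact ⟨f ⁻¹' e'.sourceᶜ,
        ((hN.isClopen_source e' he').compl.isOpen.preimage hf.continuous).mem_nhds hz₀,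
        ∅, isCompact_empty, measure_empty, fun z hz _ hzs => absurd hzs hz⟩
  choose U hU S hS hS0 h using key
  obtain ⟨s, hs, hsU⟩ := TopologicalSpace.countable_cover_nhds hU
  refine ⟨⋃ z ∈ s, S z, .biUnion hs fun z _ => (hS z).measurableSet,
    (measure_biUnion_null_iff hs).2 fun z _ => hS0 z, fun z hz hzs => ?_⟩
  have hz' : z ∈ ⋃ x ∈ s, U x := hsU ▸ mem_univ z
  obtain ⟨y, hy, hzy⟩ := mem_iUnion₂.1 hz'
  exact mem_iUnion₂.2 ⟨y, hy, h y z hzy hz hzs⟩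

theorem IsCMap.dense_compl_image_criticalSet (hM : IsSCManifold A q n a M)
    (hN : IsSCManifold A q n b N) {f : M → N} (hf : IsCMap K a b l f) (hl : max a b < l)
    (hp : p ≠ 0) (hnat : ∀ c : ℕ, ‖(c : K)‖ ≤ 1) (hp1 : ‖(p : K)‖ < 1) :
    Dense (f '' criticalSet K a b f)ᶜ := by
  obtain ⟨μ, hμ⟩ : ∃ μ : Measure K, μ.IsAddHaarMeasure := ⟨Measure.addHaar, inferInstance⟩
  refine dense_iff_inter_open.2 fun V hV ⟨y, hy⟩ => ?_
  set e := chartAt (Fin b → K) y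
  obtain ⟨T, -, hT0, hT⟩ := hf.exists_measurableSet_null μ hM hN hl hp hnat hp1
    (chart_mem_atlas _ y)
  by_contra hne
  have hopen : IsOpen (e '' (e.source ∩ V)) := e.isOpen_image_source_inter hV
  have hsub : e '' (e.source ∩ V) ⊆ T := by
    rintro _ ⟨w, ⟨hw, hwV⟩, rfl⟩
    by_contra hwT
    refine hne ⟨w, hwV, ?_⟩
    rintro ⟨z, hz, rfl⟩
    exact hwT (hT z hz hw)
  exact (hopen.measure_pos (Measure.pi fun _ : Fin b => μ)
    ⟨e y, mem_image_of_mem _ ⟨mem_chart_source _ y, hy⟩⟩).ne' (measure_mono_null hsub hT0)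

end Global

theorem DisjointRefinement.measurableSet_inter_preimage {K : Type*} [NontriviallyNormedField K]
    [ProperSpace K] [MeasurableSpace K] [BorelSpace K] {b : ℕ} {N : Type*} [TopologicalSpace N]
    [ChartedSpace (Fin b → K) N] [MeasurableSpace N] [BorelSpace N] {ι : Type*}
    (D : DisjointRefinement K b N ι) (i : ι) {T : Set (Fin b → K)} (hT : MeasurableSet T) :
    MeasurableSet (D.cell i ∩ D.chart i ⁻¹' T) := by
  have hc : Continuous ((D.cell i).domRestrict (D.chart i)) :=
    continuousOn_iff_continuous_domRestrict.1 ((D.chart i).continuousOn.mono (D.cell_subset i))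
  have h := (D.isClopen_cell i).isOpen.measurableSet.subtype_image (hc.measurable hT)
  rwa [domRestrict_eq, preimage_comp, Subtype.image_preimage_coe] at h

/-! ### Finite extensions of ℚ_p and the induced measures. -/

section Padic

theorem norm_natCast_le_one (p : ℕ) [Fact p.Prime] (K : Type*) [NontriviallyNormedField K]
    [NormedAlgebra ℚ_[p] K] (c : ℕ) : ‖(c : K)‖ ≤ 1 := by
  rw [← map_natCast (algebraMap ℚ_[p] K), norm_algebraMap']
  exact_mod_cast Padic.norm_int_le_one (p := p) c

theorem norm_natCast_self_lt_one (p : ℕ) [Fact p.Prime] (K : Type*) [NontriviallyNormedField K]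
    [NormedAlgebra ℚ_[p] K] : ‖(p : K)‖ < 1 := by
  rw [← map_natCast (algebraMap ℚ_[p] K), norm_algebraMap']
  exact Padic.norm_p_lt_one

variable {p : ℕ} [Fact p.Prime] {K : Type*} [NontriviallyNormedField K] [NormedAlgebra ℚ_[p] K]
  [FiniteDimensional ℚ_[p] K] [MeasurableSpace K] [BorelSpace K]
  {b : ℕ} {N : Type*} [TopologicalSpace N] [ChartedSpace (Fin b → K) N] [MeasurableSpace N]
  [BorelSpace N] {ι : Type*}

/-- The cells are disjoint, so only the i-th summand can charge this set. -/
theorem inducedMeasure_inter_preimage_eq_zero (D : DisjointRefinement K b N ι) (i : ι)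
    {T : Set (Fin b → K)} (hT : MeasurableSet T) (hT0 : haar p K b T = 0) :
    inducedMeasure p D (D.cell i ∩ D.chart i ⁻¹' T) = 0 := by
  have : ProperSpace K := FiniteDimensional.proper ℚ_[p] K
  have hm := D.measurableSet_inter_preimage i hT
  rw [inducedMeasure, Measure.sum_apply _ hm, ENNReal.tsum_eq_zero]
  intro k
  -- `Measure.map` takes the default value 0 when the map is not almost everywhere measurable, so
  -- that case is immediate.
  by_cases hae : AEMeasurable (D.chart k).symm ((haar p K b).restrict (D.chart k '' D.cell k))
  · have hopen : IsOpen (D.chart k '' D.cell k) := by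
      rw [← inter_eq_right.2 (D.cell_subset k)]
      exact (D.chart k).isOpen_image_source_inter (D.isClopen_cell k).isOpen
    rw [Measure.map_apply_of_aemeasurable hae hm, Measure.restrict_apply' hopen.measurableSet]
    refine measure_mono_null ?_ hT0
    rintro _ ⟨⟨hy, hyT⟩, w, hw, rfl⟩
    rw [(D.chart k).left_inv (D.cell_subset k hw)] at hy
    rw [mem_preimage, (D.chart k).left_inv (D.cell_subset k hw)] at hyT
    rcases eq_or_ne k i with rfl | hki
    · exact hyT
    · exact absurd hy (disjoint_left.1 (D.disjoint hki) hw)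
  · rw [Measure.map_of_not_aemeasurable hae, Measure.coe_zero, Pi.zero_apply]

theorem IsCMap.inducedMeasure_image_criticalSet {a l q n : ℕ} {A : ApproxSystem K} {M : Type*}
    [TopologicalSpace M] [SecondCountableTopology M] [ChartedSpace (Fin a → K) M]
    (hM : IsSCManifold A q n a M) (hN : IsSCManifold A q n b N) {f : M → N}
    (hf : IsCMap K a b l f) (hl : max a b < l) (D : DisjointRefinement K b N ι) :
    inducedMeasure p D (f '' criticalSet K a b f) = 0 := by
  have : ProperSpace K := FiniteDimensional.proper ℚ_[p] K
  have : CharZero K := charZero_of_injective_algebraMap (algebraMap ℚ_[p] K).injective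
  have : (haar p K b).IsAddHaarMeasure := by unfold haar; infer_instance
  have hac : haar p K b ≪ Measure.pi fun _ : Fin b => (Measure.addHaar : Measure K) :=
    Measure.absolutelyContinuous_isAddHaarMeasure _ _
  choose T hT hT0 h using fun i => hf.exists_measurableSet_null Measure.addHaar hM hN hl
    (Fact.out : p.Prime).ne_zero (norm_natCast_le_one p K) (norm_natCast_self_lt_one p K)
    (D.chart_mem i)
  -- N may have uncountably many cells, but their preimages are disjoint open subsets of the second
  -- countable M, so only countably many meet f(M).
  have hcount : {i | (f ⁻¹' D.cell i).Nonempty}.Countable := by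
    refine PairwiseDisjoint.countable_of_isOpen (s := fun i => f ⁻¹' D.cell i)
      (fun i _ k _ hik => (D.disjoint hik).preimage f)
      (fun i _ => (D.isClopen_cell i).isOpen.preimage hf.continuous) fun i hi => hi
  refine measure_mono_null ?_ ((measure_biUnion_null_iff hcount).2 fun i _ =>
    inducedMeasure_inter_preimage_eq_zero D i (hT i) (hac (hT0 i)))
  rintro _ ⟨z, hz, rfl⟩
  obtain ⟨i, hi⟩ := mem_iUnion.1 (D.iUnion_cell ▸ mem_univ (f z))
  exact mem_iUnion₂.2 ⟨i, ⟨z, hi⟩, hi, h i z hz (D.cell_subset i hi)⟩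

end Padic

theorem criticalSet_eq_univ {K : Type*} [NontriviallyNormedField K] {a b : ℕ} {M : Type*}
    [TopologicalSpace M] [ChartedSpace (Fin a → K) M] {N : Type*} [TopologicalSpace N]
    [ChartedSpace (Fin b → K) N] (f : M → N) (hab : a < b) : criticalSet K a b f = univ := by
  refine eq_univ_of_forall fun z => lt_of_le_of_lt (LinearMap.finrank_range_le _) ?_
  rwa [Module.finrank_fin_fun]

end NASard

end

theorem theorem3p19 (p : ℕ) [Fact p.Prime]
    {K : Type*} [NontriviallyNormedField K] [NormedAlgebra ℚ_[p] K] [FiniteDimensional ℚ_[p] K]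
    [MeasurableSpace K] [BorelSpace K]
    (A : NASard.ApproxSystem K) (q n : ℕ) (hn : 1 ≤ n) (a b l : ℕ) (hl : max a b < l)
    {M : Type*} [TopologicalSpace M] [SecondCountableTopology M] [ChartedSpace (Fin a → K) M]
    (hM : NASard.IsSCManifold A q n a M)
    {N : Type*} [TopologicalSpace N] [ChartedSpace (Fin b → K) N]
    [MeasurableSpace N] [BorelSpace N]
    (hN : NASard.IsSCManifold A q n b N)
    (f : M → N) (hf : NASard.IsCMap K a b l f) :
    (∀ (ι : Type*) (D : NASard.DisjointRefinement K b N ι),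
      NASard.inducedMeasure p D (f '' NASard.criticalSet K a b f) = 0) ∧
    Dense (f '' NASard.criticalSet K a b f)ᶜ ∧
    (a < b → ∀ (ι : Type*) (D : NASard.DisjointRefinement K b N ι),
      NASard.inducedMeasure p D (range f) = 0) := by
  have : ProperSpace K := FiniteDimensional.proper ℚ_[p] K
  have : CharZero K := charZero_of_injective_algebraMap (algebraMap ℚ_[p] K).injective
  refine ⟨fun ι D => hf.inducedMeasure_image_criticalSet hM hN hl D,
    hf.dense_compl_image_criticalSet hM hN hl (Fact.out : p.Prime).ne_zero
      (NASard.norm_natCast_le_one p K) (NASard.norm_natCast_self_lt_one p K), fun hab ι D => ?_⟩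
  rw [← image_univ, ← NASard.criticalSet_eq_univ (K := K) f hab]
  exact hf.inducedMeasure_image_criticalSet hM hN hl D
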